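/- Let $d$ be a dimension and let $s,t>0$ satisfy $s+t>1$. Let $\Sigma_t^s(\mathbf R^d)$ be the Beurling type Gelfand--Shilov space of all $f\in C^\infty(\mathbf R^d)$ such that, for every $h>0$, $$\|f\|_{t,s,h}=\sup_{\alpha,\beta\in\mathbf N^d,\;x\in\mathbf R^d}\frac{|x^\alpha D^\beta f(x)|}{h^{|\alpha+\beta|}\,\alpha!^t\,\beta!^s}<\infty ,$$ and let $(\Sigma_t^s)'(\mathbf R^d)$ be its topological dual, written as the space of continuous conjugate linear functionals $\varphi\mapsto(u,\varphi)$ (consistently with the $L^2$ inner product). For $\psi\in\Sigma_t^s(\mathbf R^d)\setminus 0$ and $u\in(\Sigma_t^s)'(\mathbf R^d)$ let $$V_\psi u(x,\xi)=(2\pi)^{-d/2}(u,M_\xi T_x\psi),\qquad M_\xi T_x\psi(y)=e^{i\langle y,\xi\rangle}\psi(y-x),$$ and let $\mathrm{WF}^{t,s}(u)\subseteq T^*\mathbf R^d\setminus 0$ be defined by: $(x_0,\xi_0)\in T^*\mathbf R^d\setminus 0$ satisfies $(x_0,\xi_0)\notin\mathrm{WF}^{t,s}(u)$ if and only if there is an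 open set $U\subseteq T^*\mathbf R^d\setminus 0$ containing $(x_0,\xi_0)$ such that $$\sup_{\lambda>0,\;(x,\xi)\in U}e^{r\lambda}\,|V_\psi u(\lambda^t x,\lambda^s\xi)|<\infty\qquad\text{for all } r>0 .$$ The identities below hold for every choice of the nonzero windows $\psi$ used to define the two wave front sets involved (each in the test function space belonging to its ultradistribution). Let $u\in(\Sigma_t^s)'(\mathbf R^d)$. (i) Let $\widehat f(\xi)=(2\pi)^{-d/2}\int f(x)e^{-i\langle x,\xi\rangle}\,dx$. The Fourier transform maps $\Sigma_t^s(\mathbf R^d)$ into $\Sigma_s^t(\mathbf R^d)$, there is a unique $\widehat u\in(\Sigma_s^t)'(\mathbf R^d)$ such that $(\widehat u,\widehat\varphi)=(u,\varphi)$ for all $\varphi\in\Sigma_t^s(\mathbf R^d)$, and $$\mathrm{WF}^{s,t}(\widehat u)=\mathcal J\,\mathrm{WF}^{t,s}(u),\qquad \mathcal J(x,\xi)=(\xi,-x).$$ (ii) Let $A\in\mathrm{GL}(d,\mathbf R)$ and $u_A(x)=|A|^{1/2}u(Ax)$. Here $|A|=\det A$, and $|A|^{1/2}$ may be any complex number of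 modulus $|\det A|^{1/2}$ (for instance a square root of $\det A$). That is, $u_A\in(\Sigma_t^s)'(\mathbf R^d)$ is the well-defined, unique element with $(u_A,\varphi)=|A|^{1/2}\,|\det A|^{-1}\,(u,\varphi(A^{-1}\,\cdot\,))$ for all $\varphi\in\Sigma_t^s(\mathbf R^d)$. Then $$\mathrm{WF}^{t,s}(u_A)=\begin{pmatrix}A^{-1}&0\\0&A^T\end{pmatrix}\mathrm{WF}^{t,s}(u).$$ -/

import Mathlib

open scoped ContDiff ENNReal NNReal

noncomputable section

namespace GelfandShilov

/-- The configuration space `ℝᵈ` with its Euclidean structure. -/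
abbrev E (d : ℕ) : Type := EuclideanSpace ℝ (Fin d)

/-! ### Multi-indices -/

/-- The length `|α| = α₁ + ⋯ + α_d` of a multi-index. -/
def mlen {d : ℕ} (α : Fin d → ℕ) : ℕ := ∑ i, α i

/-- The factorial `α! = α₁! ⋯ α_d!` of a multi-index. -/
def mfact {d : ℕ} (α : Fin d → ℕ) : ℕ := ∏ i, (α i).factorial

/-- The monomial `x ^ α = x₁ ^ α₁ ⋯ x_d ^ α_d`. -/
def mpow {d : ℕ} (α : Fin d → ℕ) (x : E d) : ℝ := ∏ i, x i ^ α i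

/-- The partial derivative `∂ᵢ f`. -/
def pderiv {d : ℕ} (i : Fin d) (f : E d → ℂ) : E d → ℂ :=
  fun x => fderiv ℝ f x (EuclideanSpace.single i 1)

/-- The derivative `∂₁ ^ β₁ ⋯ ∂_d ^ β_d f`. It has the same modulus as `D ^ β f`, where
`D_j = -i ∂_j`. -/
def mderiv {d : ℕ} (β : Fin d → ℕ) (f : E d → ℂ) : E d → ℂ :=
  (List.finRange d).foldr (fun i g => (pderiv i)^[β i] g) f

/-! ### Gelfand--Shilov spaces of Beurling type and their duals -/

/-- The norm `sup |x ^ α D ^ β f(x)| / (h ^ |α + β| α! ^ t β! ^ s)`, the supremum being over all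
`α, β ∈ ℕᵈ` and `x ∈ ℝᵈ`, as an element of `[0, ∞]`. -/
def gsNorm {d : ℕ} (t s h : ℝ) (f : E d → ℂ) : ℝ≥0∞ :=
  ⨆ (α : Fin d → ℕ) (β : Fin d → ℕ) (x : E d),
    ENNReal.ofReal (‖(mpow α x : ℂ) * mderiv β f x‖ /
      (h ^ mlen (α + β) * (mfact α : ℝ) ^ t * (mfact β : ℝ) ^ s))

/-- Membership in the space `Σ_t^s(ℝᵈ)`: smoothness and finiteness of all the norms. -/
def IsGelfandShilov {d : ℕ} (t s : ℝ) (f : E d → ℂ) : Prop :=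
  ContDiff ℝ ∞ f ∧ ∀ h : ℝ, 0 < h → gsNorm t s h f < ⊤

section Aux

variable {d : ℕ}

/-- The space of smooth functions, used only to prove closure properties. -/
def Sm (d : ℕ) : Submodule ℂ (E d → ℂ) where
  carrier := {f | ContDiff ℝ ∞ f}
  add_mem' := fun {f g} (hf : ContDiff ℝ ∞ f) (hg : ContDiff ℝ ∞ g) => hf.add hg
  zero_mem' := (contDiff_const : ContDiff ℝ ∞ fun _ : E d => (0 : ℂ))
  smul_mem' := fun c f (hf : ContDiff ℝ ∞ f) => (contDiff_const.smul hf : ContDiff ℝ ∞ (c • f))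

/-- The partial derivative as an endomorphism of the smooth functions. -/
def pd (i : Fin d) : Module.End ℂ (Sm d) where
  toFun f := ⟨pderiv i f.1, by
    have hf : ContDiff ℝ ∞ f.1 := f.2
    exact (hf.fderiv_right (m := ∞) (by simp)).clm_apply contDiff_const⟩
  map_add' f g := by
    ext x
    have hf : ContDiff ℝ ∞ f.1 := f.2
    have hg : ContDiff ℝ ∞ g.1 := g.2
    change fderiv ℝ (f.1 + g.1) x _ = fderiv ℝ f.1 x _ + fderiv ℝ g.1 x _
    rw [fderiv_add (hf.differentiable (by simp) x) (hg.differentiable (by simp) x)]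
    rfl
  map_smul' c f := by
    ext x
    have hf : ContDiff ℝ ∞ f.1 := f.2
    change fderiv ℝ (c • f.1) x _ = c • fderiv ℝ f.1 x _
    rw [fderiv_const_smul (hf.differentiable (by simp) x)]
    rfl

lemma pd_coe (i : Fin d) (f : Sm d) : (pd i f : E d → ℂ) = pderiv i f.1 := rfl

lemma pd_pow_coe (i : Fin d) (n : ℕ) (f : Sm d) :
    (((pd i) ^ n) f : E d → ℂ) = (pderiv i)^[n] f.1 := by
  induction n generalizing f with
  | zero => rfl
  | succ n ih => rw [pow_succ, Module.End.mul_apply, ih, pd_coe, Function.iterate_succ_apply]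

/-- The differential operator `∂ ^ β` as an endomorphism of the smooth functions. -/
def md (β : Fin d → ℕ) : Module.End ℂ (Sm d) := ((List.finRange d).map fun i => pd i ^ β i).prod

lemma md_coe (β : Fin d → ℕ) (f : Sm d) : (md β f : E d → ℂ) = mderiv β f.1 := by
  unfold md mderiv
  induction List.finRange d with
  | nil => rfl
  | cons i l ih =>
    rw [List.map_cons, List.prod_cons, Module.End.mul_apply, pd_pow_coe, ih, List.foldr_cons]

lemma mfact_pos (α : Fin d → ℕ) : 0 < (mfact α : ℝ) := by
  have : 0 < mfact α := Finset.prod_pos fun i _ => Nat.factorial_pos _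
  exact_mod_cast this

/-- The denominators in the norms. -/
def wt (t s h : ℝ) (α β : Fin d → ℕ) : ℝ :=
  h ^ mlen (α + β) * (mfact α : ℝ) ^ t * (mfact β : ℝ) ^ s

lemma wt_pos {t s h : ℝ} (hh : 0 < h) (α β : Fin d → ℕ) : 0 < wt t s h α β := by
  have := mfact_pos α
  have := mfact_pos β
  unfold wt
  positivity

lemma gsNorm_lt_top_iff {t s h : ℝ} (hh : 0 < h) (f : E d → ℂ) :
    gsNorm t s h f < ⊤ ↔ ∃ B : ℝ, 0 ≤ B ∧ ∀ α β x,
      ‖(mpow α x : ℂ) * mderiv β f x‖ ≤ B * wt t s h α β := by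
  constructor
  · intro H
    refine ⟨(gsNorm t s h f).toReal, ENNReal.toReal_nonneg, fun α β x => ?_⟩
    rw [← div_le_iff₀ (wt_pos hh α β)]
    rw [← ENNReal.ofReal_le_iff_le_toReal H.ne]
    unfold gsNorm
    exact le_iSup_of_le α (le_iSup_of_le β (le_iSup_of_le x le_rfl))
  · rintro ⟨B, hB, H⟩
    refine lt_of_le_of_lt ?_ (ENNReal.ofReal_lt_top (r := B))
    refine iSup_le fun α => iSup_le fun β => iSup_le fun x => ?_
    refine ENNReal.ofReal_le_ofReal ?_
    exact (div_le_iff₀ (wt_pos hh α β)).2 (H α β x)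

lemma isGelfandShilov_iff {t s : ℝ} (f : E d → ℂ) :
    IsGelfandShilov t s f ↔ ∃ hf : f ∈ Sm d, ∀ h : ℝ, 0 < h → ∃ B : ℝ, 0 ≤ B ∧ ∀ α β x,
      ‖(mpow α x : ℂ) * (md β ⟨f, hf⟩ : Sm d).1 x‖ ≤ B * wt t s h α β := by
  constructor
  · rintro ⟨h1, h2⟩
    refine ⟨h1, fun h hh => ?_⟩
    simp only [md_coe]
    exact (gsNorm_lt_top_iff hh f).1 (h2 h hh)
  · rintro ⟨h1, h2⟩
    refine ⟨h1, fun h hh => ?_⟩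
    simp only [md_coe] at h2
    exact (gsNorm_lt_top_iff hh f).2 (h2 h hh)

lemma isGelfandShilov_zero (t s : ℝ) : IsGelfandShilov t s (0 : E d → ℂ) := by
  rw [isGelfandShilov_iff]
  refine ⟨zero_mem _, fun h hh => ⟨0, le_rfl, fun α β x => ?_⟩⟩
  have : (⟨0, zero_mem _⟩ : Sm d) = 0 := rfl
  rw [this, map_zero]
  simp

lemma IsGelfandShilov.add {t s : ℝ} {f g : E d → ℂ} (hf : IsGelfandShilov t s f)
    (hg : IsGelfandShilov t s g) : IsGelfandShilov t s (f + g) := by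
  rw [isGelfandShilov_iff] at *
  obtain ⟨f1, f2⟩ := hf
  obtain ⟨g1, g2⟩ := hg
  refine ⟨add_mem f1 g1, fun h hh => ?_⟩
  obtain ⟨B, hB, HB⟩ := f2 h hh
  obtain ⟨C, hC, HC⟩ := g2 h hh
  refine ⟨B + C, by positivity, fun α β x => ?_⟩
  have : (⟨f + g, add_mem f1 g1⟩ : Sm d) = ⟨f, f1⟩ + ⟨g, g1⟩ := rfl
  rw [this, map_add, add_mul]
  refine le_trans ?_ (add_le_add (HB α β x) (HC α β x))
  rw [Submodule.coe_add, Pi.add_apply, mul_add]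
  exact norm_add_le _ _

lemma IsGelfandShilov.smul {t s : ℝ} {f : E d → ℂ} (c : ℂ) (hf : IsGelfandShilov t s f) :
    IsGelfandShilov t s (c • f) := by
  rw [isGelfandShilov_iff] at *
  obtain ⟨f1, f2⟩ := hf
  refine ⟨Submodule.smul_mem _ c f1, fun h hh => ?_⟩
  obtain ⟨B, hB, HB⟩ := f2 h hh
  refine ⟨‖c‖ * B, by positivity, fun α β x => ?_⟩
  have : (⟨c • f, Submodule.smul_mem _ c f1⟩ : Sm d) = c • ⟨f, f1⟩ := rfl
  rw [this, map_smul, mul_assoc]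
  refine le_trans (le_of_eq ?_) (mul_le_mul_of_nonneg_left (HB α β x) (norm_nonneg c))
  rw [Submodule.coe_smul, Pi.smul_apply, smul_eq_mul, mul_left_comm, norm_mul]

/-! Bounds for the sums that arise from the binomial formula. -/

lemma mlen_update (β : Fin d → ℕ) (i : Fin d) {j : ℕ} (hj : j ≤ β i) :
    mlen (Function.update β i j) + (β i - j) = mlen β := by
  unfold mlen
  rw [← Finset.add_sum_erase _ _ (Finset.mem_univ i), ← Finset.add_sum_erase _ _ (Finset.mem_univ i)]
  have : ∑ x ∈ Finset.univ.erase i, Function.update β i j x = ∑ x ∈ Finset.univ.erase i, β x :=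
    Finset.sum_congr rfl fun k hk => by rw [Function.update_of_ne (Finset.ne_of_mem_erase hk)]
  rw [this, Function.update_self]
  omega

lemma mfact_update (β : Fin d → ℕ) (i : Fin d) {j : ℕ} (hj : j ≤ β i) :
    mfact (Function.update β i j) * (β i - j).factorial ≤ mfact β := by
  unfold mfact
  rw [← Finset.mul_prod_erase _ _ (Finset.mem_univ i),
    ← Finset.mul_prod_erase _ (fun i => (β i).factorial) (Finset.mem_univ i)]
  have : ∏ x ∈ Finset.univ.erase i, (Function.update β i j x).factorial
      = ∏ x ∈ Finset.univ.erase i, (β x).factorial :=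
    Finset.prod_congr rfl fun k hk => by rw [Function.update_of_ne (Finset.ne_of_mem_erase hk)]
  rw [this, Function.update_self, mul_right_comm]
  refine Nat.mul_le_mul_right _ ?_
  exact Nat.le_of_dvd (Nat.factorial_pos _) (Nat.factorial_mul_factorial_dvd_factorial hj)

lemma pow_le_factorial_rpow {s h : ℝ} (hs : 0 < s) (hh : 0 < h) {a : ℝ} (ha : 0 ≤ a) :
    ∃ K : ℝ, 0 ≤ K ∧ ∀ m : ℕ, a ^ m ≤ K * h ^ m * (m.factorial : ℝ) ^ s := by
  refine ⟨(Real.exp ((a / h) ^ (1 / s))) ^ s, by positivity, fun m => ?_⟩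
  have h1 := Real.pow_div_factorial_le_exp (x := (a / h) ^ (1 / s)) (by positivity) m
  have hm : (0 : ℝ) < m.factorial := by exact_mod_cast Nat.factorial_pos m
  rw [div_le_iff₀ hm] at h1
  have h2 := Real.rpow_le_rpow (by positivity) h1 hs.le
  rw [Real.mul_rpow (by positivity) hm.le, ← Real.rpow_natCast, ← Real.rpow_mul (by positivity),
    ← Real.rpow_mul (by positivity)] at h2
  have e : 1 / s * (m * s) = (m : ℝ) := by field_simp
  rw [e, Real.rpow_natCast, div_pow, div_le_iff₀ (by positivity)] at h2
  linarith

lemma sum_bound {s h : ℝ} (hs : 0 < s) (hh : 0 < h) {a : ℝ} (ha : 0 ≤ a) :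
    ∃ K : ℝ, 0 ≤ K ∧ ∀ (β : Fin d → ℕ) (i : Fin d),
      ∑ j ∈ Finset.range (β i + 1), a ^ (β i - j) * (β i).choose j *
        ((h / 2) ^ mlen (Function.update β i j) * (mfact (Function.update β i j) : ℝ) ^ s)
        ≤ K * (h ^ mlen β * (mfact β : ℝ) ^ s) := by
  obtain ⟨K, hK, H⟩ := pow_le_factorial_rpow hs (half_pos hh) ha
  refine ⟨K, hK, fun β i => ?_⟩
  have key : ∀ j ∈ Finset.range (β i + 1), a ^ (β i - j) * (β i).choose j *
        ((h / 2) ^ mlen (Function.update β i j) * (mfact (Function.update β i j) : ℝ) ^ s)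
        ≤ (β i).choose j * (K * ((h / 2) ^ mlen β * (mfact β : ℝ) ^ s)) := by
    intro j hj
    have hj' : j ≤ β i := Nat.lt_succ_iff.1 (Finset.mem_range.1 hj)
    have h1 : (mfact (Function.update β i j) : ℝ) ^ s * ((β i - j).factorial : ℝ) ^ s
        ≤ (mfact β : ℝ) ^ s := by
      rw [← Real.mul_rpow (by positivity) (by positivity)]
      refine Real.rpow_le_rpow (by positivity) ?_ hs.le
      exact_mod_cast mfact_update β i hj'
    have h2 := mlen_update β i hj'
    have h3 := H (β i - j)
    calc _ ≤ (K * (h / 2) ^ (β i - j) * ((β i - j).factorial : ℝ) ^ s) * (β i).choose j *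
        ((h / 2) ^ mlen (Function.update β i j) * (mfact (Function.update β i j) : ℝ) ^ s) := by
          gcongr
      _ = (β i).choose j * (K * ((h / 2) ^ (mlen (Function.update β i j) + (β i - j)) *
          ((mfact (Function.update β i j) : ℝ) ^ s * ((β i - j).factorial : ℝ) ^ s))) := by
          rw [pow_add]; ring
      _ ≤ _ := by rw [h2]; gcongr
  refine (Finset.sum_le_sum key).trans ?_
  rw [← Finset.sum_mul]
  have h4 : ∑ j ∈ Finset.range (β i + 1), ((β i).choose j : ℝ) = 2 ^ β i := by
    exact_mod_cast Nat.sum_range_choose (β i)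
  have h5 : (2 : ℝ) ^ β i ≤ 2 ^ mlen β := by
    refine pow_le_pow_right₀ (by norm_num) ?_
    exact Finset.single_le_sum (f := β) (fun _ _ => Nat.zero_le _) (Finset.mem_univ i)
  rw [h4]
  calc (2 : ℝ) ^ β i * (K * ((h / 2) ^ mlen β * (mfact β : ℝ) ^ s))
      ≤ 2 ^ mlen β * (K * ((h / 2) ^ mlen β * (mfact β : ℝ) ^ s)) := by gcongr
    _ = _ := by rw [div_pow]; field_simp

lemma wt_eq (t s h : ℝ) (α β : Fin d → ℕ) :
    wt t s h α β = (h ^ mlen α * (mfact α : ℝ) ^ t) * (h ^ mlen β * (mfact β : ℝ) ^ s) := by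
  have : mlen (α + β) = mlen α + mlen β := by simp [mlen, Finset.sum_add_distrib]
  rw [wt, this, pow_add]; ring

/-! Translation in one coordinate. -/

/-- Translation as an endomorphism of the smooth functions. -/
def tr (v : E d) : Module.End ℂ (Sm d) where
  toFun f := ⟨fun y => f.1 (y - v), by
    have hf : ContDiff ℝ ∞ f.1 := f.2
    exact hf.comp (contDiff_id.sub contDiff_const)⟩
  map_add' _ _ := rfl
  map_smul' _ _ := rfl

lemma pd_tr (i : Fin d) (v : E d) : pd i * tr v = tr v * pd i := by
  ext f x
  change fderiv ℝ (fun y => f.1 (y - v)) x _ = fderiv ℝ f.1 (x - v) _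
  rw [fderiv_comp_sub]

lemma md_tr (β : Fin d → ℕ) (v : E d) : md β * tr v = tr v * md β := by
  have h : ∀ l : List (Fin d), Commute ((l.map fun i => pd i ^ β i).prod) (tr v) := by
    intro l
    induction l with
    | nil => exact Commute.one_left _
    | cons i l ih =>
      rw [List.map_cons, List.prod_cons]
      exact ((show Commute (pd i) (tr v) from pd_tr i v).pow_left _).mul_left ih
  exact h _

lemma mpow_add_single (α : Fin d → ℕ) (i : Fin d) (a : ℝ) (x : E d) :
    mpow α (x + EuclideanSpace.single i a) = ∑ j ∈ Finset.range (α i + 1),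
      a ^ (α i - j) * (α i).choose j * mpow (Function.update α i j) x := by
  have h1 : ∀ (γ : Fin d → ℕ) (y : E d), mpow γ y =
      y i ^ γ i * ∏ k ∈ Finset.univ.erase i, y k ^ γ k := fun γ y =>
    (Finset.mul_prod_erase _ (fun k => y k ^ γ k) (Finset.mem_univ i)).symm
  rw [h1]
  have h2 : ∏ k ∈ Finset.univ.erase i, (x + EuclideanSpace.single i a) k ^ α k
      = ∏ k ∈ Finset.univ.erase i, x k ^ α k := by
    refine Finset.prod_congr rfl fun k hk => ?_
    have := Finset.ne_of_mem_erase hk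
    simp [this]
  have h3 : ∀ j, ∏ k ∈ Finset.univ.erase i, x k ^ (Function.update α i j) k
      = ∏ k ∈ Finset.univ.erase i, x k ^ α k := fun j => by
    refine Finset.prod_congr rfl fun k hk => ?_
    rw [Function.update_of_ne (Finset.ne_of_mem_erase hk)]
  simp only [h1 (Function.update _ _ _), h3, Function.update_self, h2]
  have : (x + EuclideanSpace.single i a) i = x i + a := by simp
  rw [this, add_pow, Finset.sum_mul]
  exact Finset.sum_congr rfl fun j _ => by ring

lemma IsGelfandShilov.translate_single {t s : ℝ} (ht : 0 < t) {f : E d → ℂ}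
    (hf : IsGelfandShilov t s f) (i : Fin d) (a : ℝ) :
    IsGelfandShilov t s (fun y => f (y - EuclideanSpace.single i a)) := by
  rw [isGelfandShilov_iff] at *
  obtain ⟨f1, f2⟩ := hf
  refine ⟨(tr (EuclideanSpace.single i a) ⟨f, f1⟩).2, fun h hh => ?_⟩
  obtain ⟨B, hB, HB⟩ := f2 (h / 2) (half_pos hh)
  obtain ⟨K, hK, HK⟩ := sum_bound (d := d) ht hh (abs_nonneg a)
  refine ⟨K * B, by positivity, fun α β x => ?_⟩
  change ‖(mpow α x : ℂ) * ((md β * tr (EuclideanSpace.single i a)) ⟨f, f1⟩ : Sm d).1 x‖ ≤ _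
  rw [md_tr]
  change ‖(mpow α x : ℂ) * (md β ⟨f, f1⟩ : Sm d).1 (x - EuclideanSpace.single i a)‖ ≤ _
  set z := x - EuclideanSpace.single i a with hz
  set G := (md β ⟨f, f1⟩ : Sm d).1 z with hG
  have hx : x = z + EuclideanSpace.single i a := by rw [hz]; abel
  rw [hx, mpow_add_single, Complex.ofReal_sum, Finset.sum_mul]
  calc _ ≤ ∑ j ∈ Finset.range (α i + 1),
        ‖((|a| ^ (α i - j) * (α i).choose j : ℝ))‖ * ‖(mpow (Function.update α i j) z : ℂ) * G‖ := by
        refine (norm_sum_le _ _).trans (le_of_eq (Finset.sum_congr rfl fun j _ => ?_))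
        push_cast
        simp only [norm_mul, norm_pow, Complex.norm_real, Real.norm_eq_abs, abs_abs]
        simp [mul_assoc]
    _ ≤ ∑ j ∈ Finset.range (α i + 1), (|a| ^ (α i - j) * (α i).choose j) *
          (B * wt t s (h / 2) (Function.update α i j) β) := by
        refine Finset.sum_le_sum fun j _ => ?_
        rw [Real.norm_of_nonneg (by positivity)]
        exact mul_le_mul_of_nonneg_left (HB _ β z) (by positivity)
    _ = (∑ j ∈ Finset.range (α i + 1), |a| ^ (α i - j) * (α i).choose j *
          ((h / 2) ^ mlen (Function.update α i j) * (mfact (Function.update α i j) : ℝ) ^ t)) *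
          (B * ((h / 2) ^ mlen β * (mfact β : ℝ) ^ s)) := by
        rw [Finset.sum_mul]
        refine Finset.sum_congr rfl fun j _ => ?_
        rw [wt_eq]; ring
    _ ≤ (K * (h ^ mlen α * (mfact α : ℝ) ^ t)) * (B * (h ^ mlen β * (mfact β : ℝ) ^ s)) := by
        have := mfact_pos β
        refine mul_le_mul (HK α i) ?_ (by positivity) (by positivity)
        gcongr
        linarith
    _ = _ := by rw [wt_eq]; ring

/-! Modulation in one coordinate. -/

/-- Modulation in one coordinate as an endomorphism of the smooth functions. -/
def mo (i : Fin d) (a : ℝ) : Module.End ℂ (Sm d) where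
  toFun f := ⟨fun y => Complex.exp (Complex.I * (y i * a : ℝ)) * f.1 y, by
    have hf : ContDiff ℝ ∞ f.1 := f.2
    refine ContDiff.mul ?_ hf
    refine ContDiff.cexp (contDiff_const.mul (Complex.ofRealCLM.contDiff.comp ?_))
    exact (EuclideanSpace.proj (𝕜 := ℝ) i).contDiff.mul contDiff_const⟩
  map_add' _ _ := by ext x; exact mul_add _ _ _
  map_smul' _ _ := by ext x; exact mul_left_comm _ _ _

lemma pd_mo (k i : Fin d) (a : ℝ) :
    pd k * mo i a = mo i a * (pd k + algebraMap ℂ _ (if k = i then Complex.I * a else 0)) := by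
  ext f x
  have hf : ContDiff ℝ ∞ f.1 := f.2
  have h0 : HasFDerivAt f.1 (fderiv ℝ f.1 x) x := (hf.differentiable (by simp) x).hasFDerivAt
  have h1 : HasFDerivAt (fun y : E d => (Complex.I * (y i * a : ℝ) : ℂ))
      (Complex.I • Complex.ofRealCLM.comp (a • (EuclideanSpace.proj (𝕜 := ℝ) i))) x := by
    have h2 : HasFDerivAt (fun y : E d => y i * a) (a • (EuclideanSpace.proj (𝕜 := ℝ) i)) x :=
      (EuclideanSpace.proj (𝕜 := ℝ) i).hasFDerivAt.mul_const a
    exact (Complex.ofRealCLM.hasFDerivAt.comp x h2).const_mul Complex.I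
  have h3 := (h1.cexp.mul h0).fderiv
  change fderiv ℝ (fun y => Complex.exp (Complex.I * (y i * a : ℝ)) * f.1 y) x _ =
    Complex.exp (Complex.I * (x i * a : ℝ)) * (fderiv ℝ f.1 x _ +
      (if k = i then Complex.I * a else 0) * f.1 x)
  change fderiv ℝ (fun y => Complex.exp (Complex.I * (y i * a : ℝ)) * f.1 y) x = _ at h3
  rw [h3]
  by_cases hk : k = i
  · subst hk
    simp
    ring
  · simp [hk, Ne.symm hk]

lemma md_mo (β : Fin d → ℕ) (i : Fin d) (a : ℝ) :
    md β * mo i a = mo i a * ∑ j ∈ Finset.range (β i + 1),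
      ((Complex.I * a) ^ (β i - j) * (β i).choose j : ℂ) • md (Function.update β i j) := by
  have h1 : ∀ (k : Fin d) (n : ℕ), pd k ^ n * mo i a =
      mo i a * (pd k + algebraMap ℂ _ (if k = i then Complex.I * a else 0)) ^ n := by
    intro k n
    induction n with
    | zero => simp
    | succ n ih => rw [pow_succ, mul_assoc, pd_mo, ← mul_assoc, ih, mul_assoc, ← pow_succ]
  have h2 : ∀ l : List (Fin d), (l.map fun k => pd k ^ β k).prod * mo i a = mo i a *
      (l.map fun k => (pd k + algebraMap ℂ (Module.End ℂ (Sm d))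
        (if k = i then Complex.I * a else 0)) ^ β k).prod := by
    intro l
    induction l with
    | nil => simp
    | cons k l ih =>
      simp only [List.map_cons, List.prod_cons]
      rw [mul_assoc, ih, ← mul_assoc, h1, mul_assoc]
  unfold md
  rw [h2]
  congr 1
  obtain ⟨l₁, l₂, hl⟩ := List.append_of_mem (List.mem_finRange i)
  have hnd : (l₁ ++ i :: l₂).Nodup := hl ▸ List.nodup_finRange d
  have hne : ∀ k ∈ l₁ ++ l₂, k ≠ i := by
    intro k hk hki
    subst hki
    have := (List.nodup_middle.1 hnd)
    exact (List.nodup_cons.1 this).1 hk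
  rw [hl]
  simp only [List.map_append, List.prod_append, List.map_cons, List.prod_cons, if_true,
    Function.update_self]
  have e1 : ∀ l : List (Fin d), (∀ k ∈ l, k ≠ i) →
      (l.map fun k => (pd k + algebraMap ℂ (Module.End ℂ (Sm d))
        (if k = i then Complex.I * a else 0)) ^ β k) = l.map fun k => pd k ^ β k := by
    intro l hl
    refine List.map_congr_left fun k hk => ?_
    simp [hl k hk]
  have e2 : ∀ (j : ℕ) (l : List (Fin d)), (∀ k ∈ l, k ≠ i) →
      (l.map fun k => (pd k : Module.End ℂ (Sm d)) ^ (Function.update β i j k))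
        = l.map fun k => pd k ^ β k := by
    intro j l hl
    refine List.map_congr_left fun k hk => ?_
    rw [Function.update_of_ne (hl k hk)]
  have n1 : ∀ k ∈ l₁, k ≠ i := fun k hk => hne k (List.mem_append_left _ hk)
  have n2 : ∀ k ∈ l₂, k ≠ i := fun k hk => hne k (List.mem_append_right _ hk)
  simp only [e1 _ n1, e1 _ n2, e2 _ _ n1, e2 _ _ n2]
  rw [(Algebra.commute_algebraMap_right (Complex.I * (a : ℂ)) (pd i)).add_pow, Finset.sum_mul,
    Finset.mul_sum]
  refine Finset.sum_congr rfl fun j _ => ?_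
  have : ((β i).choose j : Module.End ℂ (Sm d))
      = algebraMap ℂ (Module.End ℂ (Sm d)) ((β i).choose j : ℂ) := (map_natCast _ _).symm
  rw [this, ← map_pow, mul_assoc (pd i ^ j), ← map_mul, ← Algebra.commutes,
    ← Algebra.smul_def, smul_mul_assoc, mul_smul_comm]

lemma IsGelfandShilov.modulate_single {t s : ℝ} (hs : 0 < s) {f : E d → ℂ}
    (hf : IsGelfandShilov t s f) (i : Fin d) (a : ℝ) :
    IsGelfandShilov t s (fun y => Complex.exp (Complex.I * (y i * a : ℝ)) * f y) := by
  rw [isGelfandShilov_iff] at *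
  obtain ⟨f1, f2⟩ := hf
  refine ⟨(mo i a ⟨f, f1⟩).2, fun h hh => ?_⟩
  obtain ⟨B, hB, HB⟩ := f2 (h / 2) (half_pos hh)
  obtain ⟨K, hK, HK⟩ := sum_bound (d := d) hs hh (abs_nonneg a)
  refine ⟨K * B, by positivity, fun α β x => ?_⟩
  change ‖(mpow α x : ℂ) * ((md β * mo i a) ⟨f, f1⟩ : Sm d).1 x‖ ≤ _
  rw [md_mo, Module.End.mul_apply, LinearMap.sum_apply]
  change ‖(mpow α x : ℂ) * (Complex.exp (Complex.I * (x i * a : ℝ)) *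
    ((∑ j ∈ Finset.range (β i + 1), ((Complex.I * a) ^ (β i - j) * (β i).choose j : ℂ) •
      md (Function.update β i j) ⟨f, f1⟩ : Sm d) : E d → ℂ) x)‖ ≤ _
  have he : ‖Complex.exp (Complex.I * (x i * a : ℝ))‖ = 1 := by
    rw [mul_comm]; exact Complex.norm_exp_ofReal_mul_I _
  rw [mul_left_comm, norm_mul, he, one_mul]
  have hsum : ((∑ j ∈ Finset.range (β i + 1), ((Complex.I * a) ^ (β i - j) * (β i).choose j : ℂ) •
      md (Function.update β i j) ⟨f, f1⟩ : Sm d) : E d → ℂ) x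
      = ∑ j ∈ Finset.range (β i + 1), ((Complex.I * a) ^ (β i - j) * (β i).choose j : ℂ) *
      (md (Function.update β i j) ⟨f, f1⟩ : Sm d).1 x := by
    rw [Submodule.coe_sum, Finset.sum_apply]
    rfl
  rw [hsum, Finset.mul_sum]
  calc _ ≤ ∑ j ∈ Finset.range (β i + 1), (|a| ^ (β i - j) * (β i).choose j) *
        ‖(mpow α x : ℂ) * (md (Function.update β i j) ⟨f, f1⟩ : Sm d).1 x‖ := by
        refine (norm_sum_le _ _).trans (le_of_eq (Finset.sum_congr rfl fun j _ => ?_))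
        rw [mul_left_comm, norm_mul]
        simp
    _ ≤ ∑ j ∈ Finset.range (β i + 1), (|a| ^ (β i - j) * (β i).choose j) *
          (B * wt t s (h / 2) α (Function.update β i j)) := by
        refine Finset.sum_le_sum fun j _ => ?_
        exact mul_le_mul_of_nonneg_left (HB α _ x) (by positivity)
    _ = (∑ j ∈ Finset.range (β i + 1), |a| ^ (β i - j) * (β i).choose j *
          ((h / 2) ^ mlen (Function.update β i j) * (mfact (Function.update β i j) : ℝ) ^ s)) *
          (B * ((h / 2) ^ mlen α * (mfact α : ℝ) ^ t)) := by
        rw [Finset.sum_mul]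
        refine Finset.sum_congr rfl fun j _ => ?_
        rw [wt_eq]; ring
    _ ≤ (K * (h ^ mlen β * (mfact β : ℝ) ^ s)) * (B * (h ^ mlen α * (mfact α : ℝ) ^ t)) := by
        have := mfact_pos α
        refine mul_le_mul (HK β i) ?_ (by positivity) (by positivity)
        gcongr
        linarith
    _ = _ := by rw [wt_eq]; ring

end Aux

/-- The space `Σ_t^s(ℝᵈ)`, as a complex vector space of functions. -/
def GSSpace (d : ℕ) (t s : ℝ) : Submodule ℂ (E d → ℂ) where
  carrier := {f | IsGelfandShilov t s f}
  add_mem' := IsGelfandShilov.add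
  zero_mem' := isGelfandShilov_zero t s
  smul_mem' := fun c _ hf => hf.smul c

/-- The ultradistributions `(Σ_t^s)'(ℝᵈ)`: the conjugate linear functionals `φ ↦ (u, φ)` on
`Σ_t^s(ℝᵈ)` that are continuous, that is, bounded by a multiple of one of the norms
(these norms generate the topology and increase as `h` decreases). -/
def GSDual (d : ℕ) (t s : ℝ) : Type :=
  {u : GSSpace d t s →ₗ⋆[ℂ] ℂ //
    ∃ h : ℝ, 0 < h ∧ ∃ C : ℝ≥0, ∀ f : GSSpace d t s, ‖u f‖ₑ ≤ C * gsNorm t s h (f : E d → ℂ)}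

/-- The action `(u, φ)` of an ultradistribution on a test function. -/
def GSDual.pair {d : ℕ} {t s : ℝ} (u : GSDual d t s) (φ : GSSpace d t s) : ℂ := u.1 φ

/-! ### Short-time Fourier transform -/

/-- The time-frequency shift `M_ξ T_x f(y) = exp(i⟨y, ξ⟩) f(y - x)`. -/
def timeFreqShift {d : ℕ} (x ξ : E d) (f : E d → ℂ) : E d → ℂ :=
  fun y => Complex.exp (Complex.I * (inner ℝ y ξ : ℝ)) * f (y - x)

/-- `Σ_t^s(ℝᵈ)` is invariant under time-frequency shifts. -/
lemma IsGelfandShilov.timeFreqShift {d : ℕ} {t s : ℝ} (ht : 0 < t) (hs : 0 < s) (x ξ : E d)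
    {f : E d → ℂ} (hf : IsGelfandShilov t s f) : IsGelfandShilov t s (timeFreqShift x ξ f) := by
  have h1 : ∀ S : Finset (Fin d),
      IsGelfandShilov t s (fun y => f (y - ∑ i ∈ S, EuclideanSpace.single i (x i))) := by
    intro S
    induction S using Finset.induction_on with
    | empty => simpa using hf
    | insert i S hi ih =>
      have := ih.translate_single ht i (x i)
      simpa only [Finset.sum_insert hi, sub_sub] using this
  have h2 : ∀ S : Finset (Fin d), IsGelfandShilov t s
      (fun y => Complex.exp (Complex.I * (∑ i ∈ S, y i * ξ i : ℝ)) * f (y - x)) := by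
    intro S
    induction S using Finset.induction_on with
    | empty =>
      have h3 := h1 Finset.univ
      have h4 : ∑ i, EuclideanSpace.single i (x i) = x := by
        ext k
        simp [Finset.sum_apply, Pi.single_apply]
      rw [h4] at h3
      simpa using h3
    | insert i S hi ih =>
      have := ih.modulate_single hs i (ξ i)
      convert this using 2 with y
      rw [Finset.sum_insert hi, Complex.ofReal_add, mul_add, Complex.exp_add, mul_assoc]
  have h5 := h2 Finset.univ
  convert h5 using 2 with y
  unfold GelfandShilov.timeFreqShift
  have : (inner ℝ y ξ : ℝ) = ∑ i, y i * ξ i := by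
    simp [PiLp.inner_apply, mul_comm]
  rw [this]

/-- The short-time Fourier transform `V_ψ u(x, ξ) = (2π)^{-d/2} (u, M_ξ T_x ψ)`. -/
def stft {d : ℕ} {t s : ℝ} (ht : 0 < t) (hs : 0 < s) (ψ : GSSpace d t s) (u : GSDual d t s)
    (x ξ : E d) : ℂ :=
  (((2 * Real.pi) ^ (-(d : ℝ) / 2) : ℝ) : ℂ) *
    u.pair ⟨timeFreqShift x ξ (ψ : E d → ℂ), IsGelfandShilov.timeFreqShift ht hs x ξ ψ.2⟩

/-! ### The wave front set -/

/-- The wave front set `WF^{t,s}(u)`, a subset of `T*ℝᵈ \ 0`, computed with the window `ψ`: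
a point `z ≠ 0` does not belong to it if and only if there is an open set `U ⊆ T*ℝᵈ \ 0`
containing `z` such that, for every `r > 0`, the quantity `exp(r λ) |V_ψ u(λ^t x, λ^s ξ)|` is
bounded over all `λ > 0` and `(x, ξ) ∈ U`. -/
def waveFrontSet {d : ℕ} {t s : ℝ} (ht : 0 < t) (hs : 0 < s) (ψ : GSSpace d t s)
    (u : GSDual d t s) : Set (E d × E d) :=
  {z | z ≠ 0 ∧ ¬ ∃ U : Set (E d × E d), IsOpen U ∧ U ⊆ {0}ᶜ ∧ z ∈ U ∧
    ∀ r : ℝ, 0 < r → ∃ C : ℝ, ∀ l : ℝ, 0 < l → ∀ p ∈ U,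
      Real.exp (r * l) * ‖stft ht hs ψ u (l ^ t • p.1) (l ^ s • p.2)‖ ≤ C}

/-! ### Fourier transform and linear changes of variables of ultradistributions -/

/-- The Fourier transform `(2π)^{-d/2} ∫ f(x) exp(-i⟨x, ξ⟩) dx` of a function. -/
def fourierFun {d : ℕ} (f : E d → ℂ) : E d → ℂ :=
  fun ξ => (((2 * Real.pi) ^ (-(d : ℝ) / 2) : ℝ) : ℂ) *
    ∫ x, f x * Complex.exp (-Complex.I * (inner ℝ x ξ : ℝ))

/-- `v = û`: the Fourier transform maps `Σ_t^s(ℝᵈ)` to `Σ_s^t(ℝᵈ)`, and it is extended to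
ultradistributions by Parseval's formula `(û, φ̂) = (u, φ)`. -/
def IsFourierTransform {d : ℕ} {t s : ℝ} (u : GSDual d t s) (v : GSDual d s t) : Prop :=
  ∀ φ : GSSpace d t s, ∃ h : fourierFun (φ : E d → ℂ) ∈ GSSpace d s t,
    v.pair ⟨fourierFun (φ : E d → ℂ), h⟩ = u.pair φ

/-- The action `x ↦ A x` of a square matrix. -/
def matAct {d : ℕ} (A : Matrix (Fin d) (Fin d) ℝ) (x : E d) : E d := WithLp.toLp 2 (A.mulVec x.ofLp)

/-- `v(x) = c u(A x)`: the linear change of variables is extended to ultradistributions by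
`(u(A ·), φ) = |det A|⁻¹ (u, φ(A⁻¹ ·))`. -/
def IsDilation {d : ℕ} {t s : ℝ} (c : ℂ) (A : Matrix.GeneralLinearGroup (Fin d) ℝ)
    (u v : GSDual d t s) : Prop :=
  ∀ φ : GSSpace d t s,
    ∃ h : (fun x => (φ : E d → ℂ) (matAct (A⁻¹).1 x)) ∈ GSSpace d t s,
      v.pair φ = c * ((|A.1.det|⁻¹ : ℝ) : ℂ) *
        u.pair ⟨fun x => (φ : E d → ℂ) (matAct (A⁻¹).1 x), h⟩

/-- The symplectic matrix `J = (0, I; -I, 0)` acting on phase space. -/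
def symplecticJ {d : ℕ} (z : E d × E d) : E d × E d := (z.2, -z.1)

/-- The block diagonal matrix `diag(A⁻¹, Aᵀ)` acting on phase space. -/
def symplecticDiag {d : ℕ} (A : Matrix.GeneralLinearGroup (Fin d) ℝ) (z : E d × E d) : E d × E d :=
  (matAct (A⁻¹).1 z.1, matAct (A.1.transpose) z.2)

end GelfandShilov

end

open GelfandShilov

noncomputable section

namespace GelfandShilov

variable {d : ℕ}
open MeasureTheory FourierTransform

/-! ### Differential operators with polynomial coefficients -/

/-! Both identities rest on the covariance of the time-frequency shifts π(x, ξ) = M_ξ T_x. The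
Fourier transform carries π(x, ξ)ψ to e^{i⟨x,ξ⟩} π(ξ, -x)ψ̂, and composition with A⁻¹ carries the
shift of φ at (A⁻¹x, Aᵀξ) to the shift of φ(A⁻¹ ·) at (x, ξ). Hence, up to a constant factor, the
short-time Fourier transform of û or u_A at the image of z has the modulus of that of u at z. 𝒥
intertwines the dilations (λ^t, λ^s) and (λ^s, λ^t), and diag(A⁻¹, Aᵀ) commutes with them, so the
decay conditions correspond (`waveFrontSet_eq_image`). This settles the claim for matched windows:
ψ̂ on the side of û, or φ(A⁻¹ ·) on the side of u. Two things remain.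

Estimates on test functions, so that û and u_A exist. One has |ξ^α D^β f̂(ξ)| = |F(D^α x^β f)(ξ)|,
with derivatives and polynomials in the opposite order to the one in the norms. Restoring the order
in one coordinate produces coefficients C(b,k) C(a,k) k!, while lowering both indices by k gains
k!^{t+s}. As s + t > 1, a factor k!^{s+t-1} is left over, and it beats every geometric factor
(`OpBound.insert`). Linear changes of variables cost only geometric factors, which are absorbed in h
(`GSBound.compLin`).

Independence of the window (`waveFrontSet_eq`). A test function f is a constant times ∫ V_ψ f(w)
π(w)ψ dw, convergent strongly enough for u to be applied (`GSDual.norm_pair_le_integral`). With f =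
π(z)φ this bounds |(u, π(z)φ)| by a multiple of ∫ |V_ψ φ(w - z)| |(u, π(w)ψ)| dw. Put ρ(x, ξ) =
|x|^{1/t} + |ξ|^{1/s}, which is homogeneous of degree one under the dilations. The first factor is
O(e^{-Rρ(w - z)}) for every R (`vst_decay`), and the second is O(e^{r₀ρ(w)}) for some r₀
(`GSDual.exists_bound_tfs`). For z the λ-dilate of p, the w that are λ-dilates of points near p are
controlled by the assumed decay for ψ. For all other w one has ρ(w - z) ≥ cλ, and a large R wins. -/

/-- Multiplication by the coordinate `x i` on the smooth functions. -/
def mulX (i : Fin d) : Module.End ℂ (Sm d) where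
  toFun f := ⟨fun y => (y i : ℂ) * f.1 y, by
    have hf : ContDiff ℝ ∞ f.1 := f.2
    exact (Complex.ofRealCLM.contDiff.comp (EuclideanSpace.proj (𝕜 := ℝ) i).contDiff).mul hf⟩
  map_add' _ _ := by ext x; exact mul_add _ _ _
  map_smul' _ _ := by ext x; exact mul_left_comm _ _ _

lemma mulX_apply (i : Fin d) (f : Sm d) (x : E d) : (mulX i f).1 x = (x i : ℂ) * f.1 x := rfl

lemma mulX_pow_apply (i : Fin d) (n : ℕ) (f : Sm d) (x : E d) :
    ((mulX i ^ n) f).1 x = (x i : ℂ) ^ n * f.1 x := by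
  induction n generalizing f with
  | zero => simp
  | succ n ih => rw [pow_succ, Module.End.mul_apply, ih, mulX_apply]; ring

lemma pd_comm (i j : Fin d) : Commute (pd i) (pd j) := by
  ext f x
  have hf : ContDiff ℝ ∞ f.1 := f.2
  have hf' : Differentiable ℝ (fderiv ℝ f.1) :=
    (hf.fderiv_right (m := ∞) (by simp)).differentiable (by simp)
  have key : ∀ u v : E d, fderiv ℝ (fun y => fderiv ℝ f.1 y u) x v =
      fderiv ℝ (fderiv ℝ f.1) x v u := by
    intro u v
    rw [fderiv_clm_apply (hf' x) (differentiableAt_const _)]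
    simp
  change fderiv ℝ (fun y => fderiv ℝ f.1 y _) x _ = fderiv ℝ (fun y => fderiv ℝ f.1 y _) x _
  rw [key, key]
  exact (hf.contDiffAt.isSymmSndFDerivAt (by
    rw [minSmoothness_of_isRCLikeNormedField]; exact WithTop.coe_le_coe.2 (le_top : (2 : ℕ∞) ≤ ⊤))) _ _

lemma pd_mulX (i j : Fin d) : pd i * mulX j = mulX j * pd i + algebraMap ℂ _ (if i = j then 1 else 0) := by
  ext f x
  have hf : ContDiff ℝ ∞ f.1 := f.2
  have h0 : HasFDerivAt f.1 (fderiv ℝ f.1 x) x := (hf.differentiable (by simp) x).hasFDerivAt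
  have h1 : HasFDerivAt (fun y : E d => (y j : ℂ))
      (Complex.ofRealCLM.comp (EuclideanSpace.proj (𝕜 := ℝ) j)) x :=
    Complex.ofRealCLM.hasFDerivAt.comp x (EuclideanSpace.proj (𝕜 := ℝ) j).hasFDerivAt
  have h3 := (h1.mul h0).fderiv
  change fderiv ℝ (fun y : E d => (y j : ℂ) * f.1 y) x _ =
    (x j : ℂ) * fderiv ℝ f.1 x _ + (if i = j then 1 else 0) * f.1 x
  change fderiv ℝ (fun y : E d => (y j : ℂ) * f.1 y) x = _ at h3
  rw [h3]
  by_cases hk : i = j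
  · subst hk
    simp
  · simp [hk, Ne.symm hk]

lemma commute_pd_mulX {i j : Fin d} (h : i ≠ j) : Commute (pd i) (mulX j) := by
  have := pd_mulX i j
  rw [if_neg h, map_zero, add_zero] at this
  exact this

lemma pd_mulX_self (i : Fin d) : pd i * mulX i = mulX i * pd i + 1 := by
  rw [pd_mulX, if_pos rfl, map_one]

lemma pd_mul_mulX_pow (i : Fin d) (a : ℕ) :
    pd i * mulX i ^ a = mulX i ^ a * pd i + a • mulX i ^ (a - 1) := by
  induction a with
  | zero => simp
  | succ a ih =>
    rw [pow_succ, ← mul_assoc, ih, add_mul, mul_assoc, pd_mulX_self, mul_add, mul_one,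
      ← mul_assoc, ← pow_succ, add_assoc, smul_mul_assoc]
    congr 1
    rcases a with _ | a
    · simp
    · rw [Nat.add_sub_cancel, ← pow_succ, Nat.add_sub_cancel, succ_nsmul (n := a + 1), add_comm]

/-- The relation [∂, x] = 1, iterated. One more ∂ passing x^{a-k} creates (a - k) x^{a-k-1}, where
C(a,k)(a - k) = C(a,k+1)(k + 1), and Pascal's rule in b merges the two resulting sums. The terms
with k > a vanish through `a.choose k`, so the truncated `a - k` is harmless. -/
lemma normal_order (i : Fin d) (a b : ℕ) :
    pd i ^ b * mulX i ^ a = ∑ k ∈ Finset.range (b + 1),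
      (b.choose k * a.choose k * k.factorial) • (mulX i ^ (a - k) * pd i ^ (b - k)) := by
  induction b with
  | zero => simp
  | succ b ih =>
    rw [pow_succ', mul_assoc, ih, Finset.mul_sum]
    have h1 : ∀ k ∈ Finset.range (b + 1),
        pd i * ((b.choose k * a.choose k * k.factorial) • (mulX i ^ (a - k) * pd i ^ (b - k))) =
        (b.choose k * a.choose k * k.factorial) • (mulX i ^ (a - k) * pd i ^ (b + 1 - k)) +
        (b.choose k * a.choose (k + 1) * (k + 1).factorial) •
          (mulX i ^ (a - (k + 1)) * pd i ^ (b + 1 - (k + 1))) := by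
      intro k hk
      have hk' : k ≤ b := Nat.lt_succ_iff.1 (Finset.mem_range.1 hk)
      rw [mul_smul_comm, ← mul_assoc, pd_mul_mulX_pow, add_mul, smul_add, mul_assoc (mulX i ^ (a - k)),
        ← pow_succ', smul_mul_assoc, smul_smul]
      have e1 : b - k + 1 = b + 1 - k := by omega
      have e2 : b + 1 - (k + 1) = b - k := by omega
      have e3 : a - k - 1 = a - (k + 1) := by omega
      have e4 : b.choose k * a.choose k * k.factorial * (a - k) =
          b.choose k * a.choose (k + 1) * (k + 1).factorial := by
        rw [Nat.factorial_succ]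
        have := Nat.choose_succ_right_eq a k
        calc _ = b.choose k * k.factorial * (a.choose k * (a - k)) := by ring
          _ = _ := by rw [← this]; ring
      rw [e1, e2, e3, e4]
    rw [Finset.sum_congr rfl h1, Finset.sum_add_distrib, Finset.sum_range_succ' (n := b + 1)]
    rw [Finset.sum_range_succ' (n := b)]
    have h2 : ∑ k ∈ Finset.range (b + 1),
        ((b + 1).choose (k + 1) * a.choose (k + 1) * (k + 1).factorial) •
          (mulX i ^ (a - (k + 1)) * pd i ^ (b + 1 - (k + 1))) =
        ∑ k ∈ Finset.range (b + 1), (b.choose k * a.choose (k + 1) * (k + 1).factorial) •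
          (mulX i ^ (a - (k + 1)) * pd i ^ (b + 1 - (k + 1))) +
        ∑ k ∈ Finset.range (b + 1), (b.choose (k + 1) * a.choose (k + 1) * (k + 1).factorial) •
          (mulX i ^ (a - (k + 1)) * pd i ^ (b + 1 - (k + 1))) := by
      rw [← Finset.sum_add_distrib]
      refine Finset.sum_congr rfl fun k _ => ?_
      rw [Nat.choose_succ_succ, add_mul, add_mul, add_smul]
    rw [h2, Finset.sum_range_succ (n := b)
      (f := fun k => (b.choose (k + 1) * a.choose (k + 1) * (k + 1).factorial) •
          (mulX i ^ (a - (k + 1)) * pd i ^ (b + 1 - (k + 1))))]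
    simp only [Nat.choose_succ_self, zero_mul, zero_smul, add_zero, Nat.choose_zero_right]
    abel

/-- Regrouping only moves B i past A j for distinct indices. Each A i stays to the left of its own B
i, so those two need not commute; this is the situation of x i and ∂ i. -/
lemma list_prod_map_mul {ι M : Type*} [Monoid M] (l : List ι) (hl : l.Nodup) (A B : ι → M)
    (h : ∀ i ∈ l, ∀ j ∈ l, i ≠ j → Commute (B i) (A j)) :
    (l.map fun i => A i * B i).prod = (l.map A).prod * (l.map B).prod := by
  induction l with
  | nil => simp
  | cons i l ih =>
    obtain ⟨h1, h2⟩ := List.nodup_cons.1 hl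
    simp only [List.map_cons, List.prod_cons]
    rw [ih h2 fun a ha b hb => h a (List.mem_cons_of_mem _ ha) b (List.mem_cons_of_mem _ hb)]
    have : Commute (B i) (l.map A).prod := by
      refine Commute.list_prod_right _ _ fun x hx => ?_
      obtain ⟨j, hj, rfl⟩ := List.mem_map.1 hx
      exact h i (by simp) j (List.mem_cons_of_mem _ hj) fun e => h1 (e ▸ hj)
    rw [mul_assoc, mul_assoc, ← mul_assoc (B i), this.eq, mul_assoc]

/-- Multiplication by the monomial `x ^ α` on the smooth functions. -/
def mX (α : Fin d → ℕ) : Module.End ℂ (Sm d) := ((List.finRange d).map fun i => mulX i ^ α i).prod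

lemma mX_apply (α : Fin d → ℕ) (f : Sm d) (x : E d) : (mX α f).1 x = (mpow α x : ℂ) * f.1 x := by
  have h : ∀ l : List (Fin d), (((l.map fun i => mulX i ^ α i).prod) f).1 x =
      (l.map fun i => ((x i : ℂ) ^ α i)).prod * f.1 x := by
    intro l
    induction l with
    | nil => simp
    | cons i l ih =>
      simp only [List.map_cons, List.prod_cons]
      rw [Module.End.mul_apply, mulX_pow_apply, ih, mul_assoc]
  rw [mX, h, mpow, ← Fin.prod_univ_def]
  push_cast
  rfl

lemma md_add (α β : Fin d → ℕ) : md (α + β) = md α * md β := by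
  unfold md
  rw [← list_prod_map_mul _ (List.nodup_finRange d) _ _
    fun i _ j _ _ => ((pd_comm i j).pow_left _).pow_right _]
  simp only [Pi.add_apply, pow_add]

lemma list_prod_map_eq_single {ι M : Type*} [Monoid M] (l : List ι) (hl : l.Nodup) (A : ι → M)
    (i : ι) (hi : i ∈ l) (h : ∀ j, j ≠ i → A j = 1) : (l.map A).prod = A i := by
  obtain ⟨l₁, l₂, rfl⟩ := List.append_of_mem hi
  have h0 := (List.nodup_cons.1 (List.nodup_middle.1 hl)).1
  have h1 : ∀ l : List ι, i ∉ l → (l.map A).prod = 1 := fun l hl =>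
    List.prod_eq_one fun x hx => by
      obtain ⟨j, hj, rfl⟩ := List.mem_map.1 hx
      exact h j fun e => hl (e ▸ hj)
  rw [List.mem_append, not_or] at h0
  simp [h1 _ h0.1, h1 _ h0.2]

lemma md_single (i : Fin d) (n : ℕ) : md (Pi.single i n) = pd i ^ n := by
  unfold md
  rw [list_prod_map_eq_single _ (List.nodup_finRange d) _ i (List.mem_finRange i)]
  · simp
  · intro j hj
    simp [hj]

lemma md_zero : md (0 : Fin d → ℕ) = 1 := by
  unfold md
  refine List.prod_eq_one fun x hx => ?_
  obtain ⟨j, hj, rfl⟩ := List.mem_map.1 hx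
  simp

lemma md_add_single (β : Fin d → ℕ) (i : Fin d) : md (β + Pi.single i 1) = pd i * md β := by
  rw [add_comm, md_add, md_single, pow_one]

lemma mpow_add (α β : Fin d → ℕ) (x : E d) : mpow (α + β) x = mpow α x * mpow β x := by
  simp [mpow, pow_add, Finset.prod_mul_distrib]

lemma mpow_single (i : Fin d) (n : ℕ) (x : E d) : mpow (Pi.single i n) x = x i ^ n := by
  unfold mpow
  rw [Finset.prod_eq_single i]
  · simp
  · intro j _ hj; simp [hj]
  · simp

lemma mpow_zero (x : E d) : mpow 0 x = 1 := by simp [mpow]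

lemma mlen_single (i : Fin d) (n : ℕ) : mlen (Pi.single i n) = n := by
  simp [mlen]

lemma mlen_add (α β : Fin d → ℕ) : mlen (α + β) = mlen α + mlen β := by
  simp [mlen, Finset.sum_add_distrib]

lemma mfact_single (i : Fin d) (n : ℕ) : mfact (Pi.single i n) = n.factorial := by
  unfold mfact
  rw [Finset.prod_eq_single i]
  · simp
  · intro j _ hj; simp [hj]
  · simp

lemma mlen_zero : mlen (0 : Fin d → ℕ) = 0 := by simp [mlen]

lemma mfact_zero : mfact (0 : Fin d → ℕ) = 1 := by simp [mfact]

lemma wt_zero (t s h : ℝ) : wt t s h (0 : Fin d → ℕ) 0 = 1 := by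
  simp [wt, mlen_zero, mfact_zero]

/-- Products over the coordinates in which `x i` and `∂ i` are ordered one way for `i ∈ S` and the
other way for `i ∉ S`. -/
def mixedOp (S : Finset (Fin d)) (α β : Fin d → ℕ) : Module.End ℂ (Sm d) :=
  ((List.finRange d).map fun i =>
    if i ∈ S then pd i ^ β i * mulX i ^ α i else mulX i ^ α i * pd i ^ β i).prod

lemma mixedOp_empty (α β : Fin d → ℕ) : mixedOp ∅ α β = mX α * md β := by
  unfold mixedOp mX md
  simp only [Finset.notMem_empty, if_false]
  exact list_prod_map_mul _ (List.nodup_finRange d) _ _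
    fun i _ j _ hij => ((commute_pd_mulX hij).pow_left _).pow_right _

lemma mixedOp_univ (α β : Fin d → ℕ) : mixedOp Finset.univ α β = md β * mX α := by
  unfold mixedOp mX md
  simp only [Finset.mem_univ, if_true]
  exact list_prod_map_mul _ (List.nodup_finRange d) _ _
    fun i _ j _ hij => (((commute_pd_mulX hij.symm).pow_left _).pow_right _).symm

/-- Operators in different coordinates do not interact, so the order of x^α and ∂^β can be reversed
one coordinate at a time by the one-variable formula. -/
lemma mixedOp_insert {S : Finset (Fin d)} {i : Fin d} (hi : i ∉ S) (α β : Fin d → ℕ) :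
    mixedOp (insert i S) α β = ∑ k ∈ Finset.range (β i + 1),
      ((β i).choose k * (α i).choose k * k.factorial) •
        mixedOp S (Function.update α i (α i - k)) (Function.update β i (β i - k)) := by
  unfold mixedOp
  obtain ⟨l₁, l₂, hl⟩ := List.append_of_mem (List.mem_finRange i)
  have hnd : (l₁ ++ i :: l₂).Nodup := hl ▸ List.nodup_finRange d
  have hne := (List.nodup_cons.1 (List.nodup_middle.1 hnd)).1
  rw [List.mem_append, not_or] at hne
  rw [hl]
  have e : ∀ (l : List (Fin d)), i ∉ l → ∀ k, (l.map fun j => if j ∈ S then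
      pd j ^ Function.update β i (β i - k) j * mulX j ^ Function.update α i (α i - k) j
      else mulX j ^ Function.update α i (α i - k) j * pd j ^ Function.update β i (β i - k) j) =
      l.map fun j => if j ∈ insert i S then pd j ^ β j * mulX j ^ α j
        else mulX j ^ α j * pd j ^ β j := by
    intro l hl k
    refine List.map_congr_left fun j hj => ?_
    have hji : j ≠ i := fun e => hl (e ▸ hj)
    simp [hji]
  simp only [List.map_append, List.prod_append, List.map_cons, List.prod_cons, e l₁ hne.1,
    e l₂ hne.2, hi, if_false, Function.update_self, Finset.mem_insert_self, if_true]
  rw [normal_order, Finset.sum_mul, Finset.mul_sum]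
  refine Finset.sum_congr rfl fun k _ => ?_
  rw [smul_mul_assoc, mul_smul_comm]

/-! ### Bounds -/

/-- The weighted bound `w(x) |x ^ α D ^ β f(x)| ≤ B h ^ |α + β| α! ^ t β! ^ s`, with `x ^ α D ^ β`
replaced by a general family of operators. -/
def OpBound (w : E d → ℝ) (t s h B : ℝ) (P : (Fin d → ℕ) → (Fin d → ℕ) → Module.End ℂ (Sm d))
    (f : Sm d) : Prop :=
  ∀ α β x, w x * ‖(P α β f).1 x‖ ≤ B * wt t s h α β

/-- The bounds `|x ^ α D ^ β f(x)| ≤ B h ^ |α + β| α! ^ t β! ^ s`. -/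
def GSBound (t s h B : ℝ) (f : Sm d) : Prop :=
  ∀ α β x, ‖(mpow α x : ℂ) * (md β f).1 x‖ ≤ B * wt t s h α β

lemma wt_mono {t s h h' : ℝ} (hh : 0 ≤ h) (h1 : h ≤ h') (α β : Fin d → ℕ) :
    wt t s h α β ≤ wt t s h' α β := by
  have := mfact_pos α
  have := mfact_pos β
  unfold wt
  gcongr

lemma coe_sum_smul_apply {ι : Type*} (S : Finset ι) (c : ι → ℕ) (g : ι → Sm d) (x : E d) :
    (∑ k ∈ S, c k • g k : Sm d).1 x = ∑ k ∈ S, (c k : ℂ) * (g k).1 x := by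
  rw [Submodule.coe_sum, Finset.sum_apply]
  refine Finset.sum_congr rfl fun k _ => ?_
  rw [← Nat.cast_smul_eq_nsmul ℂ]
  rfl

/-- From (γ i - k)! k! ≤ (γ i)!, raised to the power t for α and s for β: removing k from both
indices gains k!^{t+s}. -/
lemma wt_update_le {t s h : ℝ} (ht : 0 < t) (hs : 0 < s) (hh : 0 < h) (α β : Fin d → ℕ) (i : Fin d)
    {k : ℕ} (ha : k ≤ α i) (hb : k ≤ β i) :
    h ^ (2 * k) * (k.factorial : ℝ) ^ (t + s) *
      wt t s h (Function.update α i (α i - k)) (Function.update β i (β i - k)) ≤ wt t s h α β := by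
  have key : ∀ (p : ℝ) (γ : Fin d → ℕ), 0 < p → k ≤ γ i →
      h ^ k * (k.factorial : ℝ) ^ p * (h ^ mlen (Function.update γ i (γ i - k)) *
        (mfact (Function.update γ i (γ i - k)) : ℝ) ^ p) ≤ h ^ mlen γ * (mfact γ : ℝ) ^ p := by
    intro p γ hp hk
    have e : γ i - (γ i - k) = k := by omega
    have h1 := mlen_update γ i (Nat.sub_le (γ i) k)
    have h2 := mfact_update γ i (Nat.sub_le (γ i) k)
    rw [e] at h1 h2
    have h3 : (mfact (Function.update γ i (γ i - k)) : ℝ) ^ p * (k.factorial : ℝ) ^ p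
        ≤ (mfact γ : ℝ) ^ p := by
      rw [← Real.mul_rpow (by positivity) (by positivity)]
      refine Real.rpow_le_rpow (by positivity) ?_ hp.le
      exact_mod_cast h2
    rw [← h1, pow_add]
    calc _ = h ^ mlen (Function.update γ i (γ i - k)) * h ^ k *
          ((mfact (Function.update γ i (γ i - k)) : ℝ) ^ p * (k.factorial : ℝ) ^ p) := by ring
      _ ≤ _ := by gcongr
  have hk : (0 : ℝ) < k.factorial := by exact_mod_cast Nat.factorial_pos k
  rw [wt_eq, wt_eq, two_mul, pow_add, Real.rpow_add hk]
  have := mul_le_mul (key t α ht ha) (key s β hs hb) (by positivity) (by positivity)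
  refine le_trans (le_of_eq ?_) this
  ring

/-- This is where s + t > 1 enters. Of the gain k!^{t+s}, one power of k! cancels the coefficient of
the normal ordering, and the surplus k!^{s+t-1} absorbs (h/2)^{-2k}. The binomial coefficients
contribute at most 2^{|α+β|}, which is paid for by passing from h/2 to h. -/
lemma OpBound.insert {t s h : ℝ} (ht : 0 < t) (hs : 0 < s) (hst : 1 < s + t) (hh : 0 < h) :
    ∃ K : ℝ, 0 ≤ K ∧ ∀ (S : Finset (Fin d)) (i : Fin d), i ∉ S → ∀ (w : E d → ℝ), (∀ x, 0 ≤ w x) →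
      ∀ (B : ℝ), 0 ≤ B → ∀ f, OpBound w t s (h / 2) B (mixedOp S) f →
        OpBound w t s h (K * B) (mixedOp (insert i S)) f := by
  -- K satisfies (h/2)^{-2k} ≤ K k!^{s+t-1} for all k.
  obtain ⟨K, hK, H⟩ := pow_le_factorial_rpow (s := s + t - 1) (h := 1) (by linarith) one_pos
    (a := ((h / 2) ^ 2)⁻¹) (by positivity)
  refine ⟨K, hK, fun S i hi w hw B hB f hf α β x => ?_⟩
  rw [mixedOp_insert hi, LinearMap.sum_apply]
  simp only [LinearMap.smul_apply]
  rw [coe_sum_smul_apply]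
  set W := wt t s (h / 2) α β with hW
  have hW0 : 0 < W := wt_pos (half_pos hh) α β
  have key : ∀ k ∈ Finset.range (β i + 1),
      w x * ‖(((β i).choose k * (α i).choose k * k.factorial : ℕ) : ℂ) *
        (mixedOp S (Function.update α i (α i - k)) (Function.update β i (β i - k)) f).1 x‖ ≤
      ((β i).choose k * 2 ^ α i) * (K * B * W) := by
    intro k hk
    have hk' : k ≤ β i := Nat.lt_succ_iff.1 (Finset.mem_range.1 hk)
    by_cases hka : k ≤ α i
    · have h1 := hf (Function.update α i (α i - k)) (Function.update β i (β i - k)) x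
      have h2 := wt_update_le ht hs (half_pos hh) α β i hka hk'
      have h3 := H k
      set V := wt t s (h / 2) (Function.update α i (α i - k)) (Function.update β i (β i - k))
      have hV : 0 < V := wt_pos (half_pos hh) _ _
      have hkf : (0 : ℝ) < k.factorial := by exact_mod_cast Nat.factorial_pos k
      have h4 : (k.factorial : ℝ) * V ≤ K * W := by
        have e1 : (k.factorial : ℝ) ^ (t + s) = (k.factorial : ℝ) * (k.factorial : ℝ) ^ (s + t - 1) := by
          nth_rewrite 2 [← Real.rpow_one (k.factorial : ℝ)]
          rw [← Real.rpow_add hkf]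
          congr 1; ring
        have hp : (0 : ℝ) < (h / 2) ^ (2 * k) := by positivity
        have e2 : (((h / 2) ^ 2)⁻¹) ^ k = ((h / 2) ^ (2 * k))⁻¹ := by
          rw [inv_pow, ← pow_mul]
        rw [e2, one_pow, mul_one, inv_le_iff_one_le_mul₀ hp] at h3
        rw [e1] at h2
        calc (k.factorial : ℝ) * V = 1 * ((k.factorial : ℝ) * V) := by ring
          _ ≤ (K * (k.factorial : ℝ) ^ (s + t - 1) * (h / 2) ^ (2 * k)) * ((k.factorial : ℝ) * V) := by
            gcongr
          _ = K * ((h / 2) ^ (2 * k) * ((k.factorial : ℝ) * (k.factorial : ℝ) ^ (s + t - 1)) * V) := by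
            ring
          _ ≤ K * W := by gcongr
      have h5 : ((α i).choose k : ℝ) ≤ 2 ^ α i := by exact_mod_cast Nat.choose_le_two_pow _ _
      rw [norm_mul, Complex.norm_natCast]
      push_cast
      calc _ = ((β i).choose k * (α i).choose k * k.factorial : ℝ) * (w x *
            ‖(mixedOp S (Function.update α i (α i - k)) (Function.update β i (β i - k)) f).1 x‖) := by
            ring
        _ ≤ ((β i).choose k * (α i).choose k * k.factorial : ℝ) * (B * V) := by gcongr
        _ = ((β i).choose k * (α i).choose k) * (B * (k.factorial * V)) := by ring
        _ ≤ ((β i).choose k * 2 ^ α i) * (B * (K * W)) := by gcongr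
        _ = _ := by ring
    · rw [Nat.choose_eq_zero_of_lt (not_le.1 hka)]
      simp only [mul_zero, zero_mul, Nat.cast_zero, norm_zero]
      positivity
  have h6 : ∑ k ∈ Finset.range (β i + 1), ((β i).choose k : ℝ) = 2 ^ β i := by
    exact_mod_cast Nat.sum_range_choose (β i)
  have h7 : (2 : ℝ) ^ β i * 2 ^ α i ≤ 2 ^ mlen (α + β) := by
    rw [← pow_add]
    refine pow_le_pow_right₀ (by norm_num) ?_
    have := Finset.single_le_sum (f := α + β) (fun _ _ => Nat.zero_le _) (Finset.mem_univ i)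
    rw [add_comm]
    exact this
  have h8 : 2 ^ mlen (α + β) * W = wt t s h α β := by
    rw [hW, wt, wt, div_pow]; field_simp
  calc _ ≤ w x * ∑ k ∈ Finset.range (β i + 1),
        ‖(((β i).choose k * (α i).choose k * k.factorial : ℕ) : ℂ) *
        (mixedOp S (Function.update α i (α i - k)) (Function.update β i (β i - k)) f).1 x‖ :=
        mul_le_mul_of_nonneg_left (norm_sum_le _ _) (hw x)
    _ ≤ ∑ k ∈ Finset.range (β i + 1), ((β i).choose k * 2 ^ α i) * (K * B * W) := by
        rw [Finset.mul_sum]; exact Finset.sum_le_sum key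
    _ = (2 ^ β i * 2 ^ α i) * (K * B * W) := by rw [← Finset.sum_mul, ← Finset.sum_mul, h6]
    _ ≤ 2 ^ mlen (α + β) * (K * B * W) := by gcongr
    _ = _ := by rw [← h8]; ring

/-- The order of `x ^ α` and `D ^ β` does not matter for the bounds. -/
lemma OpBound.mixedOp {t s : ℝ} (ht : 0 < t) (hs : 0 < s) (hst : 1 < s + t) (S : Finset (Fin d)) :
    ∀ h : ℝ, 0 < h → ∃ h' K : ℝ, 0 < h' ∧ 0 ≤ K ∧ ∀ (w : E d → ℝ), (∀ x, 0 ≤ w x) →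
      ∀ (B : ℝ), 0 ≤ B → ∀ f, OpBound w t s h' B (fun α β => mX α * md β) f →
        OpBound w t s h (K * B) (mixedOp S) f := by
  induction S using Finset.induction_on with
  | empty =>
    refine fun h hh => ⟨h, 1, hh, zero_le_one, fun w hw B hB f hf α β x => ?_⟩
    rw [mixedOp_empty, one_mul]
    exact hf α β x
  | insert i S hi ih =>
    intro h hh
    obtain ⟨h', K, hh', hK, H⟩ := ih (h / 2) (half_pos hh)
    obtain ⟨K', hK', H'⟩ := OpBound.insert (d := d) ht hs hst hh
    refine ⟨h', K' * K, hh', by positivity, fun w hw B hB f hf => ?_⟩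
    rw [mul_assoc]
    exact H' S i hi w hw _ (by positivity) f (H w hw B hB f hf)

/-! ### Real-valued bounds and the norms -/

lemma gsBound_toReal {t s h : ℝ} (hh : 0 < h) (f : Sm d) (hf : gsNorm t s h f.1 < ⊤) :
    GSBound t s h (gsNorm t s h f.1).toReal f := by
  intro α β x
  rw [← div_le_iff₀ (wt_pos hh α β), ← ENNReal.ofReal_le_iff_le_toReal hf.ne, md_coe]
  unfold gsNorm
  exact le_iSup_of_le α (le_iSup_of_le β (le_iSup_of_le x le_rfl))

lemma GSBound.gsNorm_le {t s h B : ℝ} (hh : 0 < h) {f : Sm d} (hf : GSBound t s h B f) :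
    gsNorm t s h f.1 ≤ ENNReal.ofReal B := by
  refine iSup_le fun α => iSup_le fun β => iSup_le fun x => ENNReal.ofReal_le_ofReal ?_
  have := hf α β x
  rw [md_coe] at this
  exact (div_le_iff₀ (wt_pos hh α β)).2 this

lemma GSBound.mono {t s h h' B B' : ℝ} (hh : 0 < h) (hh' : h ≤ h') (hB : 0 ≤ B) (hBB : B ≤ B')
    {f : Sm d} (hf : GSBound t s h B f) : GSBound t s h' B' f := fun α β x =>
  (hf α β x).trans (mul_le_mul hBB (wt_mono hh.le hh' α β) (wt_pos hh α β).le (hB.trans hBB))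

/-- An element of `Σ_t^s` as a smooth function. -/
def toSm {t s : ℝ} (f : GSSpace d t s) : Sm d := ⟨f.1, f.2.1⟩

@[simp] lemma coe_toSm {t s : ℝ} (f : GSSpace d t s) : (toSm f : E d → ℂ) = f := rfl

lemma exists_gsBound {t s : ℝ} (f : GSSpace d t s) {h : ℝ} (hh : 0 < h) :
    ∃ B : ℝ, 0 ≤ B ∧ GSBound t s h B (toSm f) :=
  ⟨_, ENNReal.toReal_nonneg, gsBound_toReal hh (toSm f) (f.2.2 h hh)⟩

lemma mem_gsSpace {t s : ℝ} (f : Sm d)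
    (H : ∀ h : ℝ, 0 < h → ∃ B : ℝ, GSBound t s h B f) : f.1 ∈ GSSpace d t s := by
  refine ⟨f.2, fun h hh => ?_⟩
  obtain ⟨B, hB⟩ := H h hh
  exact (hB.gsNorm_le hh).trans_lt ENNReal.ofReal_lt_top

lemma GSDual.exists_bound {t s : ℝ} (u : GSDual d t s) :
    ∃ h C : ℝ, 0 < h ∧ 0 ≤ C ∧ ∀ (f : GSSpace d t s) (B : ℝ), 0 ≤ B → GSBound t s h B (toSm f) →
      ‖u.pair f‖ ≤ C * B := by
  obtain ⟨h, hh, C, H⟩ := u.2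
  refine ⟨h, C, hh, C.2, fun f B hB hf => ?_⟩
  have h1 : ‖u.pair f‖ₑ ≤ C * ENNReal.ofReal B :=
    (H f).trans (mul_le_mul_right (hf.gsNorm_le hh) _)
  rw [← ofReal_norm, ← ENNReal.ofReal_coe_nnreal, ← ENNReal.ofReal_mul (p := (C : ℝ)) C.2] at h1
  exact (ENNReal.ofReal_le_ofReal_iff (by positivity)).1 h1

/-- An ultradistribution from a conjugate linear functional with a real-valued bound. -/
def GSDual.ofBound {t s : ℝ} (L : GSSpace d t s →ₗ⋆[ℂ] ℂ)
    (H : ∃ h C : ℝ, 0 < h ∧ 0 ≤ C ∧ ∀ (f : GSSpace d t s) (B : ℝ), 0 ≤ B →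
      GSBound t s h B (toSm f) → ‖L f‖ ≤ C * B) : GSDual d t s :=
  ⟨L, by
    obtain ⟨h, C, hh, hC, H⟩ := H
    refine ⟨h, hh, C.toNNReal, fun f => ?_⟩
    have h1 := H f _ ENNReal.toReal_nonneg (gsBound_toReal hh (toSm f) (f.2.2 h hh))
    rw [← ofReal_norm]
    refine (ENNReal.ofReal_le_ofReal h1).trans (le_of_eq ?_)
    rw [ENNReal.ofReal_mul hC]
    congr 1
    exact ENNReal.ofReal_toReal (f.2.2 h hh).ne⟩

/-! ### Exponential decay -/

lemma norm_le_card_mul_coord [NeZero d] (x : E d) : ∃ i, ‖x‖ ≤ d * |x i| := by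
  obtain ⟨i, -, hi⟩ := Finset.exists_max_image Finset.univ (fun i => |x i|)
    ⟨0, Finset.mem_univ _⟩
  refine ⟨i, ?_⟩
  have h1 : x = ∑ j, EuclideanSpace.single j (x j) := by
    ext k
    simp [Finset.sum_apply, Pi.single_apply]
  calc ‖x‖ = ‖∑ j, EuclideanSpace.single j (x j)‖ := by rw [← h1]
    _ ≤ ∑ j, ‖EuclideanSpace.single j (x j)‖ := norm_sum_le _ _
    _ = ∑ j, |x j| := by simp
    _ ≤ ∑ _j : Fin d, |x i| := Finset.sum_le_sum fun j hj => hi j hj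
    _ = d * |x i| := by simp

/-- With b = y^{1/t}, the 1/t-th power of the hypothesis reads b^n a^{1/t} / n! ≤ B^{1/t}. Halving b
turns the right side into a geometric series with sum 2 B^{1/t}; the left side sums to e^{b/2}
a^{1/t}. Raising to the power t gives the exponent t/2 and the factor 2^t. -/
lemma mul_exp_le_of_forall_pow {t a B y : ℝ} (ht : 0 < t) (ha : 0 ≤ a) (hB : 0 ≤ B) (hy : 0 ≤ y)
    (H : ∀ n : ℕ, y ^ n * a ≤ B * (n.factorial : ℝ) ^ t) :
    a * Real.exp (t / 2 * y ^ (1 / t)) ≤ 2 ^ t * B := by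
  set b := y ^ (1 / t) with hb
  have hb0 : 0 ≤ b := by positivity
  have h1 : ∀ n : ℕ, (b / 2) ^ n / n.factorial * a ^ (1 / t) ≤ B ^ (1 / t) * (1 / 2) ^ n := by
    intro n
    have hn : (0 : ℝ) < n.factorial := by exact_mod_cast Nat.factorial_pos n
    have h2 := Real.rpow_le_rpow (by positivity) (H n) (by positivity : 0 ≤ 1 / t)
    rw [Real.mul_rpow (by positivity) ha, Real.mul_rpow hB (by positivity), ← Real.rpow_mul hn.le,
      mul_one_div_cancel ht.ne', Real.rpow_one, ← Real.rpow_natCast, ← Real.rpow_mul hy,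
      mul_comm (n : ℝ), Real.rpow_mul hy, Real.rpow_natCast, ← hb] at h2
    rw [div_pow, div_pow, one_pow, div_div, div_mul_eq_mul_div, div_le_iff₀ (by positivity)]
    refine h2.trans (le_of_eq ?_)
    field_simp
  have h3 : HasSum (fun n : ℕ => (b / 2) ^ n / n.factorial) (Real.exp (b / 2)) := by
    rw [Real.exp_eq_exp_ℝ]
    exact NormedSpace.expSeries_div_hasSum_exp (b / 2)
  have h4 := hasSum_le h1 (h3.mul_right _) (hasSum_geometric_two.mul_left _)
  have h5 := Real.rpow_le_rpow (by positivity) h4 ht.le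
  rw [Real.mul_rpow (by positivity) (by positivity), Real.mul_rpow (by positivity) (by positivity),
    ← Real.rpow_mul ha, ← Real.rpow_mul hB, one_div_mul_cancel ht.ne', Real.rpow_one, Real.rpow_one,
    ← Real.exp_mul] at h5
  calc _ = Real.exp (b / 2 * t) * a := by rw [mul_comm]; congr 2; ring
    _ ≤ _ := h5
    _ = _ := mul_comm _ _

lemma exp_decay_of_forall_coord {t r : ℝ} (ht : 0 < t) (hr : 0 < r) :
    ∃ h : ℝ, 0 < h ∧ ∀ (x : E d) (a B : ℝ), 0 ≤ a → a ≤ B →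
      (∀ (i : Fin d) (n : ℕ), |x i| ^ n * a ≤ B * (h ^ n * (n.factorial : ℝ) ^ t)) →
        a ≤ 2 ^ t * B * Real.exp (-r * ‖x‖ ^ (1 / t)) := by
  -- In dimension zero the coordinate bounds are vacuous and `a ≤ B` carries the estimate.
  rcases Nat.eq_zero_or_pos d with rfl | hd
  · refine ⟨1, one_pos, fun x a B ha hB _ => ?_⟩
    have hx : x = 0 := Subsingleton.elim _ _
    rw [hx, norm_zero, Real.zero_rpow (by positivity), mul_zero, Real.exp_zero, mul_one]
    have : (1 : ℝ) ≤ 2 ^ t := Real.one_le_rpow one_le_two ht.le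
    nlinarith
  · have : NeZero d := ⟨hd.ne'⟩
    have hd' : (0 : ℝ) < d := by exact_mod_cast hd
    -- This h solves (t/2)(|x i| / h)^{1/t} = r (d |x i|)^{1/t}, and d |x i| ≥ ‖x‖ for the largest
    -- coordinate.
    refine ⟨(t / (2 * r)) ^ t / d, by positivity, fun x a B ha hB H => ?_⟩
    set h := (t / (2 * r)) ^ t / d with hh
    have hh0 : 0 < h := by positivity
    obtain ⟨i, hi⟩ := norm_le_card_mul_coord x
    have h1 := mul_exp_le_of_forall_pow (y := |x i| / h) ht ha (ha.trans hB) (by positivity)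
      fun n => by
        rw [div_pow, div_mul_eq_mul_div, div_le_iff₀ (by positivity)]
        exact (H i n).trans (le_of_eq (by ring))
    have h2 : t / 2 * (|x i| / h) ^ (1 / t) = r * (d * |x i|) ^ (1 / t) := by
      have e1 : |x i| / h = d * |x i| / (t / (2 * r)) ^ t := by rw [hh]; field_simp
      rw [e1, Real.div_rpow (by positivity) (by positivity), ← Real.rpow_mul (by positivity),
        mul_one_div_cancel ht.ne', Real.rpow_one]
      field_simp
    have h3 : r * ‖x‖ ^ (1 / t) ≤ t / 2 * (|x i| / h) ^ (1 / t) := by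
      rw [h2]; gcongr
    rw [neg_mul, Real.exp_neg, ← div_eq_mul_inv, le_div_iff₀ (Real.exp_pos _)]
    exact (mul_le_mul_of_nonneg_left (Real.exp_le_exp.2 h3) ha).trans h1

lemma GSBound.norm_le {t s h B : ℝ} {f : Sm d} (hf : GSBound t s h B f) (x : E d) :
    ‖f.1 x‖ ≤ B := by
  have := hf 0 0 x
  rwa [mpow_zero, md_zero, wt_zero, mul_one, Complex.ofReal_one, one_mul] at this

lemma exp_decay {t s : ℝ} (ht : 0 < t) (f : GSSpace d t s) {r : ℝ} (hr : 0 < r) :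
    ∃ C : ℝ, 0 ≤ C ∧ ∀ x, ‖f.1 x‖ ≤ C * Real.exp (-r * ‖x‖ ^ (1 / t)) := by
  obtain ⟨h, hh, H⟩ := exp_decay_of_forall_coord (d := d) ht hr
  obtain ⟨B, hB, hf⟩ := exists_gsBound f hh
  refine ⟨2 ^ t * B, by positivity, fun x => H x _ B (norm_nonneg _) (hf.norm_le x) ?_⟩
  intro i n
  have := hf (Pi.single i n) 0 x
  rw [mpow_single, md_zero, norm_mul, wt_eq, mlen_single, mfact_single, mlen_zero, mfact_zero] at this
  change ‖_‖ * ‖f.1 x‖ ≤ _ at this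
  simpa using this

/-! ### Integrability of the weights -/

lemma one_add_pow_le_exp (N : ℕ) {p r : ℝ} (hp : 0 < p) (hr : 0 < r) :
    ∃ C : ℝ, 0 ≤ C ∧ ∀ y : ℝ, 0 ≤ y → (1 + y) ^ N ≤ C * Real.exp (r * y ^ p) := by
  -- With np ≥ N, y^N ≤ (y^p)^n for y ≥ 1, and a single term of the exponential series bounds the
  -- latter.
  obtain ⟨n, hn⟩ := exists_nat_ge (N / p)
  rw [div_le_iff₀ hp] at hn
  refine ⟨2 ^ N * (1 + n.factorial / r ^ n), by positivity, fun y hy => ?_⟩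
  have hfac : (0 : ℝ) < n.factorial := by exact_mod_cast Nat.factorial_pos n
  have h0 : (1 : ℝ) ≤ Real.exp (r * y ^ p) := Real.one_le_exp (by positivity)
  rcases le_total y 1 with h1 | h1
  · calc (1 + y) ^ N ≤ 2 ^ N := by gcongr; linarith
      _ = 2 ^ N * 1 * 1 := by ring
      _ ≤ 2 ^ N * (1 + n.factorial / r ^ n) * Real.exp (r * y ^ p) := by
        gcongr
        exact le_add_of_nonneg_right (by positivity)
  · have h2 := Real.pow_div_factorial_le_exp (x := r * y ^ p) (by positivity) n
    rw [div_le_iff₀ hfac, mul_pow] at h2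
    have h3 : y ^ N ≤ (y ^ p) ^ n := by
      rw [← Real.rpow_natCast, ← Real.rpow_natCast, ← Real.rpow_mul hy]
      exact Real.rpow_le_rpow_of_exponent_le h1 (by linarith)
    have h4 : y ^ N ≤ n.factorial / r ^ n * Real.exp (r * y ^ p) := by
      refine h3.trans ?_
      rw [div_mul_eq_mul_div, le_div_iff₀ (by positivity)]
      linarith
    calc (1 + y) ^ N ≤ (2 * y) ^ N := by gcongr; linarith
      _ = 2 ^ N * y ^ N := mul_pow _ _ _
      _ ≤ 2 ^ N * (n.factorial / r ^ n * Real.exp (r * y ^ p)) := by gcongr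
      _ ≤ 2 ^ N * (1 + n.factorial / r ^ n) * Real.exp (r * y ^ p) := by
        rw [mul_assoc]
        gcongr
        exact le_add_of_nonneg_left zero_le_one

lemma integrable_one_add_norm_inv : Integrable fun x : E d => ((1 + ‖x‖) ^ (d + 1))⁻¹ := by
  have := integrable_one_add_norm (E := E d) (μ := volume) (r := d + 1) (by simp)
  refine this.congr (Filter.Eventually.of_forall fun x => ?_)
  have h1 : 0 ≤ 1 + ‖x‖ := by positivity
  simp only
  rw [Real.rpow_neg h1]
  congr 1
  exact_mod_cast Real.rpow_natCast (1 + ‖x‖) (d + 1)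

lemma integrable_exp_neg_rpow {p r : ℝ} (hp : 0 < p) (hr : 0 < r) :
    Integrable fun x : E d => Real.exp (-r * ‖x‖ ^ p) := by
  obtain ⟨C, hC, H⟩ := one_add_pow_le_exp (d + 1) hp hr
  refine (integrable_one_add_norm_inv.const_mul C).mono' ?_ (Filter.Eventually.of_forall fun x => ?_)
  · refine Continuous.aestronglyMeasurable ?_
    exact Real.continuous_exp.comp (continuous_const.mul
      (continuous_norm.rpow_const fun _ => Or.inr hp.le))
  · rw [Real.norm_of_nonneg (Real.exp_pos _).le, neg_mul, Real.exp_neg, ← div_eq_mul_inv,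
      inv_eq_one_div, div_le_div_iff₀ (Real.exp_pos _) (by positivity), one_mul]
    exact H _ (norm_nonneg x)

/-- The quasi-norm adapted to the dilations `(x, ξ) ↦ (λ ^ t x, λ ^ s ξ)`. -/
def rho (t s : ℝ) (z : E d × E d) : ℝ := ‖z.1‖ ^ (1 / t) + ‖z.2‖ ^ (1 / s)

lemma rho_nonneg (t s : ℝ) (z : E d × E d) : 0 ≤ rho t s z := by
  unfold rho; positivity

lemma continuous_rho {t s : ℝ} (ht : 0 < t) (hs : 0 < s) : Continuous (rho (d := d) t s) :=
  (continuous_fst.norm.rpow_const fun _ => Or.inr (by positivity)).add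
    (continuous_snd.norm.rpow_const fun _ => Or.inr (by positivity))

lemma rho_dilate {t s l : ℝ} (ht : 0 < t) (hs : 0 < s) (hl : 0 ≤ l) (x ξ : E d) :
    rho t s (l ^ t • x, l ^ s • ξ) = l * rho t s (x, ξ) := by
  unfold rho
  simp only [norm_smul, Real.norm_of_nonneg (Real.rpow_nonneg hl _)]
  rw [Real.mul_rpow (by positivity) (norm_nonneg _), Real.mul_rpow (by positivity) (norm_nonneg _),
    ← Real.rpow_mul hl, ← Real.rpow_mul hl, mul_one_div_cancel ht.ne', mul_one_div_cancel hs.ne',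
    Real.rpow_one, mul_add]

lemma norm_add_rpow_le {p : ℝ} (hp : 0 < p) (x y : E d) :
    ‖x + y‖ ^ p ≤ 2 ^ p * (‖x‖ ^ p + ‖y‖ ^ p) := by
  have key : ∀ a b : ℝ, 0 ≤ a → 0 ≤ b → a ≤ b → (a + b) ^ p ≤ 2 ^ p * (a ^ p + b ^ p) := by
    intro a b ha hb hab
    calc (a + b) ^ p ≤ (2 * b) ^ p := Real.rpow_le_rpow (by positivity) (by linarith) hp.le
      _ = 2 ^ p * b ^ p := Real.mul_rpow (by norm_num) hb
      _ ≤ _ := by gcongr; exact le_add_of_nonneg_left (by positivity)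
  refine (Real.rpow_le_rpow (norm_nonneg _) (norm_add_le x y) hp.le).trans ?_
  rcases le_total ‖x‖ ‖y‖ with h | h
  · exact key _ _ (norm_nonneg _) (norm_nonneg _) h
  · rw [add_comm ‖x‖, add_comm (‖x‖ ^ p)]
    exact key _ _ (norm_nonneg _) (norm_nonneg _) h

/-- The exponents 1/t and 1/s may exceed 1, so ρ satisfies the triangle inequality only up to a
constant. That constant reappears in the choice of R in `waveFrontSet_subset`. -/
lemma rho_add_le {t s : ℝ} (ht : 0 < t) (hs : 0 < s) :
    ∃ K : ℝ, 1 ≤ K ∧ ∀ z w : E d × E d, rho t s (z + w) ≤ K * (rho t s z + rho t s w) := by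
  have h1 : (1 : ℝ) ≤ 2 ^ (1 / t) := Real.one_le_rpow one_le_two (by positivity)
  refine ⟨2 ^ (1 / t) + 2 ^ (1 / s), by
    have : (0 : ℝ) ≤ 2 ^ (1 / s) := by positivity
    linarith, fun z w => ?_⟩
  have h2 := norm_add_rpow_le (p := 1 / t) (by positivity) z.1 w.1
  have h3 := norm_add_rpow_le (p := 1 / s) (by positivity) z.2 w.2
  have e1 : (z + w).1 = z.1 + w.1 := rfl
  have e2 : (z + w).2 = z.2 + w.2 := rfl
  unfold rho
  rw [e1, e2]
  have n1 : 0 ≤ ‖z.1‖ ^ (1 / t) + ‖w.1‖ ^ (1 / t) := by positivity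
  have n2 : 0 ≤ ‖z.2‖ ^ (1 / s) + ‖w.2‖ ^ (1 / s) := by positivity
  have n3 : (0 : ℝ) ≤ 2 ^ (1 / s) := by positivity
  have n4 : (0 : ℝ) ≤ 2 ^ (1 / t) := by positivity
  nlinarith [mul_nonneg n3 n1, mul_nonneg n4 n2]

lemma integrable_exp_neg_rho {t s r : ℝ} (ht : 0 < t) (hs : 0 < s) (hr : 0 < r) :
    Integrable fun z : E d × E d => Real.exp (-r * rho t s z) := by
  have := (integrable_exp_neg_rpow (d := d) (p := 1 / t) (by positivity) hr).mul_prod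
    (integrable_exp_neg_rpow (d := d) (p := 1 / s) (by positivity) hr)
  refine this.congr (Filter.Eventually.of_forall fun z => ?_)
  simp only [rho]
  rw [← Real.exp_add]
  congr 1; ring

/-! ### Stability under derivatives and multiplication by polynomials -/

lemma multiindex_induction {P : (Fin d → ℕ) → Prop} (h0 : P 0)
    (hs : ∀ β i, P β → P (β + Pi.single i 1)) (β : Fin d → ℕ) : P β := by
  have : ∀ n, ∀ β : Fin d → ℕ, mlen β = n → P β := by
    intro n
    induction n with
    | zero =>
      intro β hβ
      have : β = 0 := by
        funext i
        have := Finset.sum_eq_zero_iff.1 hβ i (Finset.mem_univ i)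
        simpa using this
      rw [this]; exact h0
    | succ n ih =>
      intro β hβ
      obtain ⟨i, hi⟩ : ∃ i, β i ≠ 0 := by
        by_contra! h
        simp [mlen, h] at hβ
      have e : β = (β - Pi.single i 1) + Pi.single i 1 := by
        funext j
        by_cases hj : j = i
        · subst hj; simp; omega
        · simp [hj]
      have h1 : mlen (β - Pi.single i 1) + 1 = n + 1 := by
        have := congrArg mlen e
        rw [mlen_add, mlen_single, hβ] at this
        exact this.symm
      rw [e]
      exact hs _ _ (ih _ (by omega))
  exact this _ β rfl

lemma wt_swap (t s h : ℝ) (α β : Fin d → ℕ) : wt t s h α β = wt s t h β α := by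
  rw [wt_eq, wt_eq, mul_comm]

lemma mfact_add_single (α : Fin d → ℕ) (i : Fin d) (n : ℕ) :
    mfact (α + Pi.single i n) ≤ 2 ^ (mlen α + n) * mfact α * n.factorial := by
  unfold mfact
  rw [← Finset.mul_prod_erase _ _ (Finset.mem_univ i),
    ← Finset.mul_prod_erase _ (fun i => (α i).factorial) (Finset.mem_univ i)]
  have : ∏ x ∈ Finset.univ.erase i, ((α + Pi.single i n : Fin d → ℕ) x).factorial
      = ∏ x ∈ Finset.univ.erase i, (α x).factorial :=
    Finset.prod_congr rfl fun k hk => by simp [Finset.ne_of_mem_erase hk]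
  rw [this]
  have h1 : (α i + n).factorial ≤ 2 ^ (mlen α + n) * ((α i).factorial * n.factorial) := by
    rw [← Nat.add_choose_mul_factorial_mul_factorial, mul_assoc]
    refine Nat.mul_le_mul_right _ ((Nat.choose_le_two_pow _ _).trans ?_)
    refine Nat.pow_le_pow_right (by norm_num) (Nat.add_le_add_right ?_ _)
    exact Finset.single_le_sum (f := α) (fun _ _ => Nat.zero_le _) (Finset.mem_univ i)
  simp only [Pi.add_apply, Pi.single_eq_same]
  calc _ ≤ (2 ^ (mlen α + n) * ((α i).factorial * n.factorial)) *
        ∏ x ∈ Finset.univ.erase i, (α x).factorial := Nat.mul_le_mul_right _ h1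
    _ = _ := by ring

/-- Since (α + n eᵢ)! ≤ 2^{|α|+n} α! n!, raising an index by a fixed n costs a geometric factor,
paid for by dividing h by 2^t. -/
lemma wt_add_single_left {t s h : ℝ} (ht : 0 < t) (hh : 0 < h) (n : ℕ) :
    ∃ K : ℝ, 0 ≤ K ∧ ∀ (α β : Fin d → ℕ) (i : Fin d),
      wt t s (h / 2 ^ t) (α + Pi.single i n) β ≤ K * wt t s h α β := by
  refine ⟨h ^ n * (n.factorial : ℝ) ^ t, by positivity, fun α β i => ?_⟩
  have h2 : (1 : ℝ) ≤ 2 ^ t := Real.one_le_rpow one_le_two ht.le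
  have h3 : (mfact (α + Pi.single i n) : ℝ) ^ t ≤
      (2 ^ t) ^ (mlen α + n) * (mfact α : ℝ) ^ t * (n.factorial : ℝ) ^ t := by
    rw [← Real.rpow_natCast, ← Real.rpow_mul (by norm_num), mul_comm t, Real.rpow_mul (by norm_num),
      Real.rpow_natCast, ← Real.mul_rpow (by positivity) (by positivity),
      ← Real.mul_rpow (by positivity) (by positivity)]
    refine Real.rpow_le_rpow (by positivity) ?_ ht.le
    exact_mod_cast mfact_add_single α i n
  have := mfact_pos α
  have := mfact_pos β
  rw [wt_eq, wt_eq, mlen_add, mlen_single]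
  have h4 : (h / 2 ^ t) ^ mlen β ≤ h ^ mlen β := by
    gcongr
    exact div_le_self hh.le h2
  calc _ ≤ ((h / 2 ^ t) ^ (mlen α + n) *
        ((2 ^ t) ^ (mlen α + n) * (mfact α : ℝ) ^ t * (n.factorial : ℝ) ^ t)) *
        (h ^ mlen β * (mfact β : ℝ) ^ s) := by gcongr
    _ = ((h / 2 ^ t * 2 ^ t) ^ (mlen α + n) * (mfact α : ℝ) ^ t * (n.factorial : ℝ) ^ t) *
        (h ^ mlen β * (mfact β : ℝ) ^ s) := by rw [mul_pow]; ring
    _ = _ := by rw [div_mul_cancel₀ _ (by positivity), pow_add]; ring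

lemma wt_add_single_right {t s h : ℝ} (hs : 0 < s) (hh : 0 < h) (n : ℕ) :
    ∃ K : ℝ, 0 ≤ K ∧ ∀ (α β : Fin d → ℕ) (i : Fin d),
      wt t s (h / 2 ^ s) α (β + Pi.single i n) ≤ K * wt t s h α β := by
  obtain ⟨K, hK, H⟩ := wt_add_single_left (d := d) (s := t) hs hh n
  exact ⟨K, hK, fun α β i => by rw [wt_swap, wt_swap t]; exact H β α i⟩

lemma md_mul_pd (β : Fin d → ℕ) (i : Fin d) : md β * pd i = md (β + Pi.single i 1) := by
  rw [md_add, md_single, pow_one]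

lemma GSBound.pd {t s h : ℝ} (hs : 0 < s) (hh : 0 < h) :
    ∃ K : ℝ, 0 ≤ K ∧ ∀ (f : Sm d) (B : ℝ), 0 ≤ B → GSBound t s (h / 2 ^ s) B f →
      ∀ i, GSBound t s h (K * B) (pd i f) := by
  obtain ⟨K, hK, H⟩ := wt_add_single_right (d := d) (t := t) hs hh 1
  refine ⟨K, hK, fun f B hB hf i α β x => ?_⟩
  rw [← Module.End.mul_apply, md_mul_pd]
  calc _ ≤ B * wt t s (h / 2 ^ s) α (β + Pi.single i 1) := hf _ _ _
    _ ≤ B * (K * wt t s h α β) := by gcongr; exact H α β i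
    _ = _ := by ring

/-- The commutator [∂^β, x i] is β i ∂^{β - eᵢ}. When β i = 0 the coefficient vanishes, so the
truncated subtraction does no harm. -/
lemma md_mulX (β : Fin d → ℕ) (i : Fin d) :
    md β * mulX i = mulX i * md β + β i • md (β - Pi.single i 1) := by
  induction β using multiindex_induction with
  | h0 => simp [md_zero]
  | hs β k ih =>
    rw [md_add_single, mul_assoc, ih, mul_add, ← mul_assoc, pd_mulX, add_mul, mul_smul_comm,
      ← md_add_single, mul_assoc, add_assoc]
    congr 1
    by_cases hk : k = i
    · subst hk
      rw [if_pos rfl, map_one, one_mul]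
      simp only [Pi.add_apply, Pi.single_eq_same, add_tsub_cancel_right]
      rcases Nat.eq_zero_or_pos (β k) with h0 | h0
      · simp [h0]
      · have : β - Pi.single k 1 + Pi.single k 1 = β := by
          funext j
          by_cases hj : j = k
          · subst hj; simp; omega
          · simp [hj]
        rw [this, add_smul, one_smul, add_comm]
    · rw [if_neg hk, map_zero, zero_mul, zero_add]
      have e1 : (β + Pi.single k 1 : Fin d → ℕ) i = β i := by simp [Ne.symm hk]
      have e2 : β - Pi.single i 1 + Pi.single k 1 = β + Pi.single k 1 - Pi.single i 1 := by
        funext j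
        by_cases hj : j = k
        · subst hj; simp [hk]
        · simp [hj]
      rw [e1, e2]

lemma mpow_add_single_apply (α : Fin d → ℕ) (i : Fin d) (n : ℕ) (x : E d) :
    mpow (α + Pi.single i n) x = x i ^ n * mpow α x := by
  rw [mpow_add, mpow_single, mul_comm]

lemma GSBound.mulX {t s : ℝ} (ht : 0 < t) (hs : 0 < s) {h : ℝ} (hh : 0 < h) :
    ∃ h' K : ℝ, 0 < h' ∧ 0 ≤ K ∧ ∀ (f : Sm d) (B : ℝ), 0 ≤ B → GSBound t s h' B f →
      ∀ i, GSBound t s h (K * B) (mulX i f) := by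
  obtain ⟨K, hK, H⟩ := wt_add_single_left (d := d) (s := s) ht hh 1
  -- The first bound pays for raising α by eᵢ, the second for the factor β i ≤ 2^{|α+β|} of the
  -- commutator term.
  set h' := min (h / 2 ^ t) (h / 2) with hh'
  have hp : 0 < h' := by positivity
  refine ⟨h', K + (h / 2)⁻¹, hp, by positivity, fun f B hB hf i α β x => ?_⟩
  rw [← Module.End.mul_apply, md_mulX, LinearMap.add_apply, Submodule.coe_add, Pi.add_apply, mul_add]
  have h1 : ‖(mpow α x : ℂ) * ((GelfandShilov.mulX i * md β) f).1 x‖ ≤ B * (K * wt t s h α β) := by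
    have := hf (α + Pi.single i 1) β x
    rw [mpow_add_single_apply] at this
    rw [Module.End.mul_apply, mulX_apply, ← mul_assoc, mul_comm (mpow α x : ℂ)]
    push_cast at this
    rw [pow_one] at this
    refine this.trans ?_
    gcongr
    exact (wt_mono hp.le (min_le_left _ _) _ _).trans (H α β i)
  have h2 : ‖(mpow α x : ℂ) * ((β i • md (β - Pi.single i 1)) f).1 x‖ ≤
      B * ((h / 2)⁻¹ * wt t s h α β) := by
    have e1 : ((β i • md (β - Pi.single i 1)) f).1 x =
        (β i : ℂ) * ((md (β - Pi.single i 1)) f).1 x := by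
      rw [LinearMap.smul_apply, ← Nat.cast_smul_eq_nsmul ℂ]
      rfl
    rw [e1, mul_left_comm, norm_mul, Complex.norm_natCast]
    rcases Nat.eq_zero_or_pos (β i) with h0 | h0
    · rw [h0, Nat.cast_zero, zero_mul]
      have := wt_pos (t := t) (s := s) hh α β
      positivity
    · have h3 := hf α (β - Pi.single i 1) x
      have e2 : β - Pi.single i 1 = Function.update β i (β i - 1) := by
        funext j
        by_cases hj : j = i
        · subst hj; simp
        · simp [hj]
      have h4 : wt t s (h / 2) α (β - Pi.single i 1) ≤ (h / 2)⁻¹ * wt t s (h / 2) α β := by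
        have m1 := mlen_update β i (Nat.sub_le (β i) 1)
        have m2 := mfact_update β i (Nat.sub_le (β i) 1)
        have m3 : β i - (β i - 1) = 1 := by omega
        rw [m3] at m1 m2
        rw [Nat.factorial_one, mul_one] at m2
        rw [e2, wt_eq, wt_eq, ← m1, pow_succ]
        have := mfact_pos α
        have m4 : (mfact (Function.update β i (β i - 1)) : ℝ) ^ s ≤ (mfact β : ℝ) ^ s :=
          Real.rpow_le_rpow (by positivity) (by exact_mod_cast m2) hs.le
        calc _ ≤ (h / 2) ^ mlen α * (mfact α : ℝ) ^ t *
              ((h / 2) ^ mlen (Function.update β i (β i - 1)) * (mfact β : ℝ) ^ s) := by gcongr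
          _ = _ := by field_simp
      have h5 : (β i : ℝ) ≤ 2 ^ mlen (α + β) := by
        have : β i ≤ mlen (α + β) := by
          rw [mlen_add]
          exact (Finset.single_le_sum (f := β) (fun _ _ => Nat.zero_le _) (Finset.mem_univ i)).trans
            (Nat.le_add_left _ _)
        exact_mod_cast this.trans Nat.lt_two_pow_self.le
      have h6 : 2 ^ mlen (α + β) * wt t s (h / 2) α β = wt t s h α β := by
        rw [wt, wt, div_pow]; field_simp
      have := wt_pos (t := t) (s := s) (half_pos hh) α β
      have := wt_pos (t := t) (s := s) (half_pos hh) α (β - Pi.single i 1)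
      calc _ ≤ 2 ^ mlen (α + β) * (B * wt t s h' α (β - Pi.single i 1)) := by gcongr
        _ ≤ 2 ^ mlen (α + β) * (B * wt t s (h / 2) α (β - Pi.single i 1)) := by
          gcongr
          exact wt_mono hp.le (min_le_right _ _) _ _
        _ ≤ 2 ^ mlen (α + β) * (B * ((h / 2)⁻¹ * wt t s (h / 2) α β)) := by gcongr
        _ = _ := by rw [← h6]; ring
  refine (norm_add_le _ _).trans ((add_le_add h1 h2).trans (le_of_eq ?_))
  ring

lemma pd_mem {t s : ℝ} (hs : 0 < s) {f : Sm d} (hf : f.1 ∈ GSSpace d t s) (i : Fin d) :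
    (pd i f).1 ∈ GSSpace d t s := by
  refine mem_gsSpace _ fun h hh => ?_
  obtain ⟨K, hK, H⟩ := GSBound.pd (d := d) (t := t) hs hh
  obtain ⟨B, hB, hfB⟩ := exists_gsBound ⟨f.1, hf⟩ (h := h / 2 ^ s) (by positivity)
  exact ⟨_, H f B hB hfB i⟩

lemma mulX_mem {t s : ℝ} (ht : 0 < t) (hs : 0 < s) {f : Sm d} (hf : f.1 ∈ GSSpace d t s)
    (i : Fin d) : (mulX i f).1 ∈ GSSpace d t s := by
  refine mem_gsSpace _ fun h hh => ?_
  obtain ⟨h', K, hh', hK, H⟩ := GSBound.mulX (d := d) ht hs hh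
  obtain ⟨B, hB, hfB⟩ := exists_gsBound ⟨f.1, hf⟩ hh'
  exact ⟨_, H f B hB hfB i⟩

lemma mX_zero : mX (0 : Fin d → ℕ) = 1 := by
  ext f x
  rw [mX_apply, mpow_zero]
  simp

lemma mX_add_single (β : Fin d → ℕ) (i : Fin d) : mX (β + Pi.single i 1) = mulX i * mX β := by
  ext f x
  rw [mX_apply, mpow_add_single_apply, Module.End.mul_apply, mulX_apply, mX_apply]
  push_cast
  ring

lemma md_mem {t s : ℝ} (hs : 0 < s) {f : Sm d} (hf : f.1 ∈ GSSpace d t s) (β : Fin d → ℕ) :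
    (md β f).1 ∈ GSSpace d t s := by
  induction β using multiindex_induction with
  | h0 => rw [md_zero]; exact hf
  | hs β i ih => rw [md_add_single]; exact pd_mem hs ih i

lemma mX_mem {t s : ℝ} (ht : 0 < t) (hs : 0 < s) {f : Sm d} (hf : f.1 ∈ GSSpace d t s)
    (β : Fin d → ℕ) : (mX β f).1 ∈ GSSpace d t s := by
  induction β using multiindex_induction with
  | h0 => rw [mX_zero]; exact hf
  | hs β i ih => rw [mX_add_single]; exact mulX_mem ht hs ih i

/-! ### Weighted bounds -/

/-- A factor ‖x‖^N is absorbed by raising α to α + N eᵢ, with i the largest coordinate of x. With N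
= d + 1 this makes x^α D^β f integrable, with a bound of the right form in α and β. -/
lemma GSBound.weighted {t s h : ℝ} (ht : 0 < t) (hh : 0 < h) (N : ℕ) :
    ∃ h' K : ℝ, 0 < h' ∧ 0 ≤ K ∧ ∀ (f : Sm d) (B : ℝ), 0 ≤ B → GSBound t s h' B f →
      OpBound (fun x => (1 + ‖x‖) ^ N) t s h (K * B) (fun α β => mX α * md β) f := by
  obtain ⟨K, hK, H⟩ := wt_add_single_left (d := d) (s := s) ht hh N
  have h2t : (1 : ℝ) ≤ 2 ^ t := Real.one_le_rpow one_le_two ht.le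
  refine ⟨h / 2 ^ t, 2 ^ N * (2 + d ^ N * K), by positivity, by positivity,
    fun f B hB hf α β x => ?_⟩
  have hW := wt_pos (t := t) (s := s) hh α β
  set A := ‖((mX α * md β) f).1 x‖ with hA
  have hA0 : 0 ≤ A := norm_nonneg _
  have e : A = ‖(mpow α x : ℂ) * (md β f).1 x‖ := by rw [hA, Module.End.mul_apply, mX_apply]
  have h0 : A ≤ B * wt t s h α β := by
    rw [e]
    refine (hf α β x).trans ?_
    gcongr
    exact wt_mono (by positivity) (div_le_self hh.le h2t) _ _
  have h1 : ‖x‖ ^ N * A ≤ B * ((1 + d ^ N * K) * wt t s h α β) := by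
    rcases Nat.eq_zero_or_pos d with rfl | hd
    · have hx : x = 0 := Subsingleton.elim _ _
      rw [hx, norm_zero]
      have : (0 : ℝ) ^ N * A ≤ 1 * A := by
        gcongr
        exact pow_le_one₀ le_rfl zero_le_one
      rw [one_mul] at this
      refine this.trans (h0.trans ?_)
      gcongr
      refine le_mul_of_one_le_left hW.le ?_
      exact le_add_of_nonneg_right (by positivity)
    · have : NeZero d := ⟨hd.ne'⟩
      obtain ⟨i, hi⟩ := norm_le_card_mul_coord x
      have h3 := hf (α + Pi.single i N) β x
      rw [mpow_add_single_apply] at h3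
      push_cast at h3
      rw [mul_assoc, norm_mul, norm_pow, Complex.norm_real, Real.norm_eq_abs, ← e] at h3
      calc ‖x‖ ^ N * A ≤ (d * |x i|) ^ N * A := by gcongr
        _ = d ^ N * (|x i| ^ N * A) := by rw [mul_pow, mul_assoc]
        _ ≤ d ^ N * (B * (K * wt t s h α β)) :=
          mul_le_mul_of_nonneg_left (h3.trans (mul_le_mul_of_nonneg_left (H α β i) hB))
            (by positivity)
        _ = B * ((0 + d ^ N * K) * wt t s h α β) := by ring
        _ ≤ _ := by gcongr; exact zero_le_one
  have h4 : (1 + ‖x‖) ^ N ≤ 2 ^ N * (1 + ‖x‖ ^ N) := by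
    rcases le_total ‖x‖ 1 with h | h
    · calc (1 + ‖x‖) ^ N ≤ 2 ^ N := by gcongr; linarith
        _ ≤ _ := le_mul_of_one_le_right (by positivity) (le_add_of_nonneg_right (by positivity))
    · calc (1 + ‖x‖) ^ N ≤ (2 * ‖x‖) ^ N := by gcongr; linarith
        _ = 2 ^ N * ‖x‖ ^ N := mul_pow _ _ _
        _ ≤ _ := by gcongr; linarith
  calc (1 + ‖x‖) ^ N * A ≤ 2 ^ N * (1 + ‖x‖ ^ N) * A := by gcongr
    _ = 2 ^ N * (A + ‖x‖ ^ N * A) := by ring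
    _ ≤ 2 ^ N * (B * wt t s h α β + B * ((1 + d ^ N * K) * wt t s h α β)) := by gcongr
    _ = _ := by ring

/-! ### Fourier transform of test functions -/

/-- The normalizing constant `(2π)^{-d/2}`. -/
def fc (d : ℕ) : ℝ := (2 * Real.pi) ^ (-(d : ℝ) / 2)

lemma fc_pos (d : ℕ) : 0 < fc d := by unfold fc; positivity

lemma fc_mul_self (d : ℕ) : fc d * fc d * (2 * Real.pi) ^ d = 1 := by
  unfold fc
  rw [← Real.rpow_natCast, ← Real.rpow_add (by positivity), ← Real.rpow_add (by positivity)]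
  have : -(d : ℝ) / 2 + -(d : ℝ) / 2 + d = 0 := by ring
  rw [this, Real.rpow_zero]

/-- The pairing `⟨x, ξ⟩ / 2π`. -/
def pairL (d : ℕ) : E d →L[ℝ] E d →L[ℝ] ℝ := (2 * Real.pi)⁻¹ • innerSL ℝ

lemma pairL_apply (x ξ : E d) : pairL d x ξ = (2 * Real.pi)⁻¹ * inner ℝ x ξ := rfl

lemma pairL_flip : (pairL d).flip = pairL d := by
  ext x y
  rw [ContinuousLinearMap.flip_apply, pairL_apply, pairL_apply, real_inner_comm]

/-- The 1/2π in `pairL` cancels the 2π in the character 𝐞, so the general theory of `VectorFourier`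
applies to the kernel e^{-i⟨x,ξ⟩}. -/
lemma fourierChar_pairL (x ξ : E d) :
    ((Real.fourierChar (-pairL d x ξ) : Circle) : ℂ) = Complex.exp (-Complex.I * (inner ℝ x ξ : ℝ)) := by
  rw [Real.fourierChar_apply, pairL_apply]
  congr 1
  have := Real.pi_ne_zero
  push_cast
  field_simp

lemma fourierFun_eq (f : E d → ℂ) (ξ : E d) : fourierFun f ξ =
    (fc d : ℂ) * VectorFourier.fourierIntegral 𝐞 volume (pairL d).toLinearMap₁₂ f ξ := by
  unfold fourierFun VectorFourier.fourierIntegral fc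
  congr 2
  ext x
  rw [Circle.smul_def, smul_eq_mul, mul_comm, ContinuousLinearMap.toLinearMap₁₂_apply_apply_apply,
    fourierChar_pairL]

lemma norm_fourierFun_le (f : E d → ℂ) (ξ : E d) : ‖fourierFun f ξ‖ ≤ fc d * ∫ x, ‖f x‖ := by
  rw [fourierFun_eq, norm_mul, Complex.norm_real, Real.norm_of_nonneg (fc_pos d).le]
  gcongr
  · exact (fc_pos d).le
  · exact VectorFourier.norm_fourierIntegral_le_integral_norm _ _ _ _ _

lemma continuous_of_mem {t s : ℝ} {f : E d → ℂ} (hf : f ∈ GSSpace d t s) : Continuous f :=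
  hf.1.continuous

lemma integrable_pow_mul {t s : ℝ} (ht : 0 < t) {f : E d → ℂ} (hf : f ∈ GSSpace d t s) (n : ℕ) :
    Integrable fun x => ‖x‖ ^ n * ‖f x‖ := by
  obtain ⟨C, hC, H⟩ := exp_decay ht ⟨f, hf⟩ two_pos
  obtain ⟨C', hC', H'⟩ := one_add_pow_le_exp n (p := 1 / t) (by positivity) one_pos
  refine ((integrable_exp_neg_rpow (d := d) (p := 1 / t) (by positivity) one_pos).const_mul
    (C' * C)).mono' ?_ (Filter.Eventually.of_forall fun x => ?_)
  · exact ((continuous_norm.pow n).mul (continuous_of_mem hf).norm).aestronglyMeasurable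
  · rw [Real.norm_of_nonneg (by positivity)]
    have h1 : ‖x‖ ^ n ≤ (1 + ‖x‖) ^ n := by gcongr; linarith
    calc ‖x‖ ^ n * ‖f x‖ ≤ (C' * Real.exp (1 * ‖x‖ ^ (1 / t))) *
          (C * Real.exp (-2 * ‖x‖ ^ (1 / t))) := by
          gcongr
          · exact h1.trans (H' _ (norm_nonneg _))
          · exact H x
      _ = C' * C * (Real.exp (1 * ‖x‖ ^ (1 / t)) * Real.exp (-2 * ‖x‖ ^ (1 / t))) := by ring
      _ = _ := by rw [← Real.exp_add]; congr 2; ring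

lemma integrable_of_mem {t s : ℝ} (ht : 0 < t) {f : E d → ℂ} (hf : f ∈ GSSpace d t s) :
    Integrable f := by
  have := integrable_pow_mul ht hf 0
  simp only [pow_zero, one_mul] at this
  exact (integrable_norm_iff (continuous_of_mem hf).aestronglyMeasurable).1 this

/-- The Fourier transform of a test function as a smooth function. -/
def fourierSm {t s : ℝ} (ht : 0 < t) (f : Sm d) (hf : f.1 ∈ GSSpace d t s) : Sm d :=
  ⟨fourierFun f.1, by
    have h1 := VectorFourier.contDiff_fourierIntegral (pairL d) (N := ⊤) (μ := volume) (f := f.1)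
      fun n _ => integrable_pow_mul ht hf n
    have h2 : fourierFun f.1 = fun ξ => (fc d : ℂ) *
        VectorFourier.fourierIntegral 𝐞 volume (pairL d).toLinearMap₁₂ f.1 ξ :=
      funext fun ξ => fourierFun_eq _ _
    rw [h2]
    exact contDiff_const.mul h1⟩

lemma fourierFun_smul (c : ℂ) (f : E d → ℂ) (ξ : E d) :
    fourierFun (c • f) ξ = c * fourierFun f ξ := by
  rw [fourierFun_eq, fourierFun_eq, VectorFourier.fourierIntegral_const_smul, Pi.smul_apply,
    smul_eq_mul]
  ring

lemma fourierFun_add {f g : E d → ℂ} (hf : Integrable f) (hg : Integrable g) (ξ : E d) :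
    fourierFun (f + g) ξ = fourierFun f ξ + fourierFun g ξ := by
  rw [fourierFun_eq, fourierFun_eq, fourierFun_eq, ← mul_add]
  congr 1
  unfold VectorFourier.fourierIntegral
  rw [← integral_add]
  · refine integral_congr_ae (Filter.Eventually.of_forall fun x => ?_)
    simp only [Pi.add_apply, smul_add]
  · exact (Real.fourierIntegral_convergent_iff' (pairL d) ξ).2 hf
  · exact (Real.fourierIntegral_convergent_iff' (pairL d) ξ).2 hg

lemma pd_fourierSm {t s : ℝ} (ht : 0 < t) (hs : 0 < s) (f : Sm d) (hf : f.1 ∈ GSSpace d t s)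
    (i : Fin d) :
    pd i (fourierSm ht f hf) = -Complex.I • fourierSm ht (mulX i f) (mulX_mem ht hs hf i) := by
  ext ξ
  have h1 := VectorFourier.hasFDerivAt_fourierIntegral (pairL d) (integrable_of_mem ht hf)
    (by simpa only [pow_one] using integrable_pow_mul ht hf 1) ξ
  have h2 := (h1.const_mul (fc d : ℂ)).fderiv
  have h3 : fourierFun f.1 = fun ξ => (fc d : ℂ) *
        VectorFourier.fourierIntegral 𝐞 volume (pairL d).toLinearMap₁₂ f.1 ξ :=
      funext fun ξ => fourierFun_eq _ _
  have h4 : Integrable (VectorFourier.fourierSMulRight (pairL d) f.1) := by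
    refine ((integrable_pow_mul ht hf 1).const_mul (2 * Real.pi * ‖pairL d‖)).mono'
      (continuous_of_mem hf).aestronglyMeasurable.fourierSMulRight
      (Filter.Eventually.of_forall fun x => ?_)
    refine (VectorFourier.norm_fourierSMulRight_le _ _ _).trans (le_of_eq ?_)
    rw [pow_one, mul_assoc]
  change fderiv ℝ (fourierFun f.1) ξ _ = -Complex.I * fourierFun (mulX i f).1 ξ
  rw [h3, h2, FunLike.coe_smul, Pi.smul_apply,
    Real.fourierIntegral_continuousLinearMap_apply' h4, ← fourierFun_smul, fourierFun_eq,
    smul_eq_mul]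
  congr 3
  ext x
  rw [VectorFourier.fourierSMulRight_apply, Pi.smul_apply, mulX_apply, pairL_apply]
  have := Real.pi_ne_zero
  have e : inner ℝ x (EuclideanSpace.single i (1 : ℝ)) = x i := by
    rw [EuclideanSpace.inner_single_right]; simp
  rw [e]
  simp only [Complex.real_smul, smul_eq_mul]
  push_cast
  field_simp

lemma fourierFun_pd {t s : ℝ} (ht : 0 < t) (hs : 0 < s) (f : Sm d) (hf : f.1 ∈ GSSpace d t s)
    (i : Fin d) (ξ : E d) :
    fourierFun (pd i f).1 ξ = Complex.I * ξ i * fourierFun f.1 ξ := by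
  have hsm : ContDiff ℝ ∞ f.1 := f.2
  have hint : Integrable (fderiv ℝ f.1) := by
    have h1 : ∀ x, ‖fderiv ℝ f.1 x‖ ≤ ∑ j, ‖(pd j f).1 x‖ := by
      intro x
      refine ContinuousLinearMap.opNorm_le_bound _ (by positivity) fun v => ?_
      have e : v = ∑ j, v j • EuclideanSpace.single j (1 : ℝ) := by
        ext k
        simp [Finset.sum_apply, Pi.single_apply]
      calc ‖fderiv ℝ f.1 x v‖ = ‖∑ j, v j • (pd j f).1 x‖ := by
            conv_lhs => rw [e]
            rw [map_sum]
            congr 1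
            refine Finset.sum_congr rfl fun j _ => ?_
            rw [map_smul]
            rfl
        _ ≤ ∑ j, ‖v j • (pd j f).1 x‖ := norm_sum_le _ _
        _ ≤ ∑ j, ‖(pd j f).1 x‖ * ‖v‖ := by
            refine Finset.sum_le_sum fun j _ => ?_
            rw [norm_smul, mul_comm]
            gcongr
            exact PiLp.norm_apply_le v j
        _ = _ := (Finset.sum_mul _ _ _).symm
    refine (integrable_finsetSum Finset.univ fun j _ =>
      (integrable_of_mem ht (pd_mem hs hf j)).norm).mono' ?_ (Filter.Eventually.of_forall h1)
    exact (hsm.continuous_fderiv (by simp)).aestronglyMeasurable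
  have h2 := VectorFourier.fourierIntegral_fderiv (pairL d) (integrable_of_mem ht hf)
    (hsm.differentiable (by simp)) hint
  have h3 := congrArg (fun T => T (EuclideanSpace.single i (1 : ℝ))) (congrFun h2 ξ)
  rw [Real.fourierIntegral_continuousLinearMap_apply' hint] at h3
  rw [fourierFun_eq, fourierFun_eq]
  change (fc d : ℂ) * VectorFourier.fourierIntegral 𝐞 volume (pairL d).toLinearMap₁₂
    (fun x => fderiv ℝ f.1 x (EuclideanSpace.single i 1)) ξ = _
  rw [h3, VectorFourier.fourierSMulRight_apply, pairL_flip, neg_apply, neg_apply,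
    pairL_apply]
  have := Real.pi_ne_zero
  have e : inner ℝ ξ (EuclideanSpace.single i (1 : ℝ)) = ξ i := by
    rw [EuclideanSpace.inner_single_right]; simp
  rw [e]
  simp only [Complex.real_smul, smul_eq_mul]
  push_cast
  field_simp

lemma md_fourierSm {t s : ℝ} (ht : 0 < t) (hs : 0 < s) (f : Sm d) (hf : f.1 ∈ GSSpace d t s)
    (β : Fin d → ℕ) :
    md β (fourierSm ht f hf) =
      (-Complex.I) ^ mlen β • fourierSm ht (mX β f) (mX_mem ht hs hf β) := by
  induction β using multiindex_induction with
  | h0 =>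
    have : mX (0 : Fin d → ℕ) f = f := by rw [mX_zero]; rfl
    rw [md_zero, mlen_zero, pow_zero, one_smul]
    simp only [this]
    rfl
  | hs β i ih =>
    have : mX (β + Pi.single i 1) f = mulX i (mX β f) := by rw [mX_add_single]; rfl
    rw [md_add_single, Module.End.mul_apply, ih, map_smul, pd_fourierSm ht hs, smul_smul, mlen_add,
      mlen_single, pow_succ]
    simp only [this]

lemma fourierFun_md {t s : ℝ} (ht : 0 < t) (hs : 0 < s) (f : Sm d) (hf : f.1 ∈ GSSpace d t s)
    (α : Fin d → ℕ) (ξ : E d) :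
    fourierFun (md α f).1 ξ = Complex.I ^ mlen α * mpow α ξ * fourierFun f.1 ξ := by
  induction α using multiindex_induction with
  | h0 => simp [md_zero, mlen_zero, mpow_zero]
  | hs α i ih =>
    rw [md_add_single, Module.End.mul_apply, fourierFun_pd ht hs _ (md_mem hs hf α), ih, mlen_add,
      mlen_single, pow_succ, mpow_add_single_apply]
    push_cast
    ring

/-- On the Fourier side derivatives become monomials and conversely, but with D^α outside x^β. This
is the reverse of the order in the norms and the reason for the normal ordering above. -/
lemma norm_mpow_mul_md_fourierSm {t s : ℝ} (ht : 0 < t) (hs : 0 < s) (f : Sm d)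
    (hf : f.1 ∈ GSSpace d t s) (α β : Fin d → ℕ) (ξ : E d) :
    ‖(mpow α ξ : ℂ) * (md β (fourierSm ht f hf)).1 ξ‖ = ‖fourierFun (md α (mX β f)).1 ξ‖ := by
  rw [fourierFun_md ht hs _ (mX_mem ht hs hf β), md_fourierSm ht hs]
  change ‖(mpow α ξ : ℂ) * ((-Complex.I) ^ mlen β * fourierFun (mX β f).1 ξ)‖ = _
  simp

/-- Continuity of the Fourier transform from `Σ_t^s` to `Σ_s^t`. -/
lemma GSBound.fourier {t s : ℝ} (ht : 0 < t) (hs : 0 < s) (hst : 1 < s + t) {h : ℝ} (hh : 0 < h) :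
    ∃ h' K : ℝ, 0 < h' ∧ 0 ≤ K ∧ ∀ (f : Sm d) (hf : f.1 ∈ GSSpace d t s) (B : ℝ), 0 ≤ B →
      GSBound t s h' B f → GSBound s t h (K * B) (fourierSm ht f hf) := by
  obtain ⟨h₁, K₁, hh₁, hK₁, H₁⟩ := OpBound.mixedOp (d := d) ht hs hst Finset.univ h hh
  obtain ⟨h₂, K₂, hh₂, hK₂, H₂⟩ := GSBound.weighted (d := d) (s := s) ht hh₁ (d + 1)
  set I := ∫ x : E d, ((1 + ‖x‖) ^ (d + 1))⁻¹ with hI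
  have hI0 : 0 ≤ I := integral_nonneg fun x => by positivity
  have hfc := fc_pos d
  refine ⟨h₂, fc d * (K₁ * K₂ * I), hh₂, by positivity, fun f hf B hB hfB α β ξ => ?_⟩
  -- The indices are exchanged: the monomial on the side of f is x^β and the derivative is D^α. The
  -- weight (1 + ‖x‖)^{d+1} has an integrable inverse.
  have h3 := H₁ _ (fun x => by positivity) _ (by positivity) f (H₂ f B hB hfB) β α
  rw [norm_mpow_mul_md_fourierSm ht hs, wt_swap]
  refine (norm_fourierFun_le _ _).trans ?_
  set W := wt t s h β α
  have h4 : ∫ x, ‖(md α (mX β f)).1 x‖ ≤ ∫ x : E d, K₁ * (K₂ * B) * W * ((1 + ‖x‖) ^ (d + 1))⁻¹ := by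
    refine integral_mono_of_nonneg (Filter.Eventually.of_forall fun x => norm_nonneg _)
      (integrable_one_add_norm_inv.const_mul _) (Filter.Eventually.of_forall fun x => ?_)
    have h5 := h3 x
    rw [mixedOp_univ, Module.End.mul_apply] at h5
    simp only
    rw [← div_eq_mul_inv, le_div_iff₀ (by positivity), mul_comm]
    exact h5
  rw [integral_const_mul] at h4
  calc _ ≤ fc d * (K₁ * (K₂ * B) * W * I) := by gcongr
    _ = _ := by ring

lemma fourierFun_mem {t s : ℝ} (ht : 0 < t) (hs : 0 < s) (hst : 1 < s + t) {f : E d → ℂ}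
    (hf : f ∈ GSSpace d t s) : fourierFun f ∈ GSSpace d s t := by
  refine mem_gsSpace (fourierSm ht ⟨f, hf.1⟩ hf) fun h hh => ?_
  obtain ⟨h', K, hh', hK, H⟩ := GSBound.fourier (d := d) ht hs hst hh
  obtain ⟨B, hB, hfB⟩ := exists_gsBound ⟨f, hf⟩ hh'
  exact ⟨_, H _ hf B hB hfB⟩

/-! ### Inversion -/

lemma fourierFun_eq_fourier (f : E d → ℂ) (ξ : E d) :
    fourierFun f ξ = (fc d : ℂ) * 𝓕 f ((2 * Real.pi)⁻¹ • ξ) := by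
  rw [fourierFun_eq, Real.fourier_eq]
  unfold VectorFourier.fourierIntegral
  congr 2
  ext x
  rw [ContinuousLinearMap.toLinearMap₁₂_apply_apply_apply, pairL_apply, inner_smul_right]

/-- Inversion for the kernel e^{-2πi⟨x,ξ⟩}, rescaled by 2π. The Jacobian (2π)^d cancels against the
two normalizing factors `fc d`. -/
lemma fourier_inversion {f : E d → ℂ} (hc : Continuous f) (hf : Integrable f)
    (hf' : Integrable (fourierFun f)) (x : E d) :
    (fc d : ℂ) * ∫ ξ, fourierFun f ξ * Complex.exp (Complex.I * (inner ℝ x ξ : ℝ)) = f x := by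
  have hpi : (2 * Real.pi) ≠ 0 := by positivity
  have hfc := fc_pos d
  have h1 : Integrable (𝓕 f) := by
    have h2 : fourierFun f = fun ξ => (fc d : ℂ) * 𝓕 f ((2 * Real.pi)⁻¹ • ξ) :=
      funext fun ξ => fourierFun_eq_fourier f ξ
    rw [h2] at hf'
    have h3 := hf'.const_mul ((fc d : ℂ)⁻¹)
    simp only [← mul_assoc] at h3
    rw [inv_mul_cancel₀ (by exact_mod_cast hfc.ne')] at h3
    simp only [one_mul] at h3
    exact (integrable_comp_smul_iff volume (𝓕 f) (inv_ne_zero hpi)).1 h3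
  have h2 := congrFun (hc.fourierInv_fourier_eq hf h1) x
  rw [Real.fourierInv_eq'] at h2
  have h3 := Measure.integral_comp_inv_smul (volume : Measure (E d))
    (fun w => Complex.exp (((2 * Real.pi * inner ℝ w x : ℝ) : ℂ) * Complex.I) • 𝓕 f w) (2 * Real.pi)
  rw [h2] at h3
  have h4 : ∫ ξ, fourierFun f ξ * Complex.exp (Complex.I * (inner ℝ x ξ : ℝ)) = (fc d : ℂ) *
      ∫ ξ, Complex.exp (((2 * Real.pi * inner ℝ ((2 * Real.pi)⁻¹ • ξ) x : ℝ) : ℂ) * Complex.I) •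
        𝓕 f ((2 * Real.pi)⁻¹ • ξ) := by
    rw [← integral_const_mul]
    congr 1
    ext ξ
    rw [fourierFun_eq_fourier, inner_smul_left, smul_eq_mul]
    have e : 2 * Real.pi * ((starRingEnd ℝ) (2 * Real.pi)⁻¹ * inner ℝ ξ x) = inner ℝ x ξ := by
      rw [real_inner_comm]
      simp only [conj_trivial]
      field_simp
    rw [e, mul_comm Complex.I]
    ring
  rw [h4, h3]
  have h5 : |(2 * Real.pi) ^ Module.finrank ℝ (E d)| = (2 * Real.pi) ^ d := by
    rw [finrank_euclideanSpace_fin, abs_of_nonneg (by positivity)]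
  rw [h5, Complex.real_smul, ← mul_assoc, ← mul_assoc]
  have := fc_mul_self d
  have h6 : (fc d : ℂ) * (fc d : ℂ) * (((2 * Real.pi) ^ d : ℝ) : ℂ) = 1 := by exact_mod_cast this
  rw [h6, one_mul]

lemma fourierFun_fourierFun_neg {f : E d → ℂ} (hc : Continuous f) (hf : Integrable f)
    (hf' : Integrable (fourierFun f)) (x : E d) : fourierFun (fourierFun f) (-x) = f x := by
  rw [← fourier_inversion hc hf hf' x, fourierFun]
  congr 2
  ext ξ
  rw [inner_neg_right, real_inner_comm]
  push_cast
  congr 2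
  ring

lemma fourierFun_comp_neg (f : E d → ℂ) (ξ : E d) :
    fourierFun (fun x => f (-x)) ξ = fourierFun f (-ξ) := by
  unfold fourierFun
  congr 1
  rw [← integral_neg_eq_self]
  simp

/-- Parseval's formula. -/
lemma integral_conj_fourierFun_mul {f g : E d → ℂ} (hf : Integrable f) (hgc : Continuous g)
    (hg : Integrable g) (hg' : Integrable (fourierFun g)) :
    ∫ ξ, (starRingEnd ℂ) (fourierFun f ξ) * fourierFun g ξ = ∫ x, (starRingEnd ℂ) (f x) * g x := by
  have h1 := VectorFourier.integral_sesq_fourierIntegral_eq_neg_flip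
    (e := 𝐞) (μ := volume) (ν := volume) (L := (pairL d).toLinearMap₁₂) (f := f)
    (g := fourierFun g) (innerSL ℂ) Real.continuous_fourierChar (pairL d).continuous₂ hf hg'
  -- Moving the transform to the other factor produces the kernel with the opposite sign, which
  -- takes ĝ back to g.
  have h2 : ∀ x, (fc d : ℂ) * VectorFourier.fourierIntegral 𝐞 volume
      (-(pairL d).toLinearMap₁₂.flip) (fourierFun g) x = g x := by
    intro x
    rw [← fourier_inversion hgc hg hg' x]
    unfold VectorFourier.fourierIntegral
    congr 2
    ext ξ
    have e : (-(pairL d).toLinearMap₁₂.flip) ξ x = -(pairL d x ξ) := rfl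
    rw [e, neg_neg, Circle.smul_def, smul_eq_mul, mul_comm, Real.fourierChar_apply, pairL_apply]
    congr 2
    have := Real.pi_ne_zero
    push_cast
    field_simp
  calc _ = (fc d : ℂ) * ∫ ξ, innerSL ℂ (VectorFourier.fourierIntegral 𝐞 volume
        (pairL d).toLinearMap₁₂ f ξ) (fourierFun g ξ) := by
        rw [← integral_const_mul]
        congr 1
        ext ξ
        rw [fourierFun_eq f, map_mul, Complex.conj_ofReal, mul_assoc]
        congr 1
        rw [innerSL_apply_apply, RCLike.inner_apply, mul_comm]
    _ = _ := by
        rw [h1, ← integral_const_mul]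
        congr 1
        ext x
        rw [innerSL_apply_apply, RCLike.inner_apply, ← mul_assoc, h2, mul_comm]

/-! ### Linear changes of variables -/

/-- Composition with a linear map as an endomorphism of the smooth functions. -/
def compLin (M : E d →L[ℝ] E d) : Module.End ℂ (Sm d) where
  toFun f := ⟨fun y => f.1 (M y), by
    have hf : ContDiff ℝ ∞ f.1 := f.2
    exact hf.comp M.contDiff⟩
  map_add' _ _ := rfl
  map_smul' _ _ := rfl

lemma compLin_apply (M : E d →L[ℝ] E d) (f : Sm d) (x : E d) : (compLin M f).1 x = f.1 (M x) := rfl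

/-- The derivative in the direction `M eᵢ`. -/
def dirDeriv (M : E d →L[ℝ] E d) (i : Fin d) : Module.End ℂ (Sm d) :=
  ∑ j, ((M (EuclideanSpace.single i 1) j : ℝ) : ℂ) • pd j

lemma coe_sum_apply {ι : Type*} (S : Finset ι) (c : ι → ℂ) (g : ι → Sm d) (x : E d) :
    (∑ k ∈ S, c k • g k : Sm d).1 x = ∑ k ∈ S, c k * (g k).1 x := by
  rw [Submodule.coe_sum, Finset.sum_apply]
  rfl

lemma pd_compLin (M : E d →L[ℝ] E d) (i : Fin d) :
    pd i * compLin M = compLin M * dirDeriv M i := by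
  ext f x
  have hf : ContDiff ℝ ∞ f.1 := f.2
  have h1 := (((hf.differentiable (by simp)) (M x)).hasFDerivAt.comp x M.hasFDerivAt).fderiv
  change fderiv ℝ (f.1 ∘ M) x _ = (dirDeriv M i f).1 (M x)
  rw [h1, dirDeriv, LinearMap.sum_apply]
  simp only [LinearMap.smul_apply]
  rw [coe_sum_apply, ContinuousLinearMap.comp_apply]
  set v := M (EuclideanSpace.single i 1)
  have e : v = ∑ j, v j • EuclideanSpace.single j (1 : ℝ) := by
    ext k
    simp [Finset.sum_apply, Pi.single_apply]
  conv_lhs => rw [e]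
  rw [map_sum]
  refine Finset.sum_congr rfl fun j _ => ?_
  rw [map_smul, Complex.real_smul]
  rfl

/-- The derivatives of `f ∘ M` of order `β` are combinations of the derivatives of `f` of order
`|β|`. -/
lemma exists_md_compLin (M : E d →L[ℝ] E d) : ∃ C : ℝ, 0 ≤ C ∧ ∀ β : Fin d → ℕ,
    ∃ R : Module.End ℂ (Sm d), md β * compLin M = compLin M * R ∧
      ∀ (f : Sm d) (γ₀ : Fin d → ℕ) (y : E d) (a V : ℝ), 0 ≤ a →
        (∀ γ, mlen γ = mlen β + mlen γ₀ → a * ‖(md γ f).1 y‖ ≤ V) →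
        a * ‖(R (md γ₀ f)).1 y‖ ≤ C ^ mlen β * V := by
  refine ⟨d * ‖M‖, by positivity, fun β => ?_⟩
  induction β using multiindex_induction with
  | h0 =>
    refine ⟨1, by rw [md_zero, one_mul, mul_one], fun f γ₀ y a V ha H => ?_⟩
    rw [mlen_zero, pow_zero, one_mul]
    exact H γ₀ (by rw [mlen_zero, zero_add])
  | hs β i ih =>
    obtain ⟨R, hR, H⟩ := ih
    refine ⟨R * dirDeriv M i, ?_, fun f γ₀ y a V ha HV => ?_⟩
    · rw [← md_mul_pd, mul_assoc, pd_compLin, ← mul_assoc, hR, mul_assoc]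
    -- The new directional derivative acts on f before R does. Hence the estimate for R is needed on
    -- derivatives of f, which is why it carries the spare index γ₀.
    · have e1 : (R * dirDeriv M i) (md γ₀ f) = ∑ j, ((M (EuclideanSpace.single i 1) j : ℝ) : ℂ) •
          R (md (γ₀ + Pi.single j 1) f) := by
        rw [Module.End.mul_apply, dirDeriv, LinearMap.sum_apply, map_sum]
        refine Finset.sum_congr rfl fun j _ => ?_
        rw [LinearMap.smul_apply, map_smul, md_add_single]
        rfl
      rw [e1, coe_sum_apply]
      have h1 : ∀ j, a * ‖((M (EuclideanSpace.single i 1) j : ℝ) : ℂ) *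
          (R (md (γ₀ + Pi.single j 1) f)).1 y‖ ≤ ‖M‖ * ((d * ‖M‖) ^ mlen β * V) := by
        intro j
        have h2 := H f (γ₀ + Pi.single j 1) y a V ha fun γ hγ => HV γ (by
          rw [hγ, mlen_add, mlen_add, mlen_single, mlen_single]; ring)
        have h3 : |M (EuclideanSpace.single i 1) j| ≤ ‖M‖ := by
          refine (PiLp.norm_apply_le (M (EuclideanSpace.single i 1)) j).trans ?_
          refine (M.le_opNorm _).trans (le_of_eq ?_)
          simp
        rw [norm_mul, Complex.norm_real, Real.norm_eq_abs, mul_left_comm]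
        exact mul_le_mul h3 h2 (by positivity) (norm_nonneg _)
      calc _ ≤ a * ∑ j, ‖((M (EuclideanSpace.single i 1) j : ℝ) : ℂ) *
            (R (md (γ₀ + Pi.single j 1) f)).1 y‖ :=
            mul_le_mul_of_nonneg_left (norm_sum_le _ _) ha
        _ ≤ ∑ _j : Fin d, ‖M‖ * ((d * ‖M‖) ^ mlen β * V) := by
            rw [Finset.mul_sum]
            exact Finset.sum_le_sum fun j _ => h1 j
        _ = _ := by
            rw [mlen_add, mlen_single, pow_succ]
            simp
            ring

lemma mfact_le_factorial_mlen (α : Fin d → ℕ) : mfact α ≤ (mlen α).factorial :=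
  Nat.le_of_dvd (Nat.factorial_pos _) (Nat.prod_factorial_dvd_factorial_sum _ _)

lemma factorial_mlen_le (α : Fin d → ℕ) : (mlen α).factorial ≤ (2 ^ d) ^ mlen α * mfact α := by
  have key : ∀ S : Finset (Fin d), (∑ i ∈ S, α i).factorial ≤
      (2 ^ S.card) ^ mlen α * ∏ i ∈ S, (α i).factorial := by
    intro S
    induction S using Finset.induction_on with
    | empty => simp
    | insert i S hi ih =>
      rw [Finset.sum_insert hi, Finset.prod_insert hi, Finset.card_insert_of_notMem hi]
      have h0 : α i + ∑ j ∈ S, α j ≤ mlen α := by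
        rw [← Finset.sum_insert hi]
        exact Finset.sum_le_sum_of_subset (Finset.subset_univ _)
      have h1 : (α i + ∑ j ∈ S, α j).factorial ≤
          2 ^ mlen α * ((α i).factorial * (∑ j ∈ S, α j).factorial) := by
        rw [← Nat.add_choose_mul_factorial_mul_factorial, mul_assoc]
        exact Nat.mul_le_mul_right _ ((Nat.choose_le_two_pow _ _).trans
          (Nat.pow_le_pow_right (by norm_num) h0))
      refine h1.trans ((Nat.mul_le_mul_left _ (Nat.mul_le_mul_left _ ih)).trans (le_of_eq ?_))
      rw [pow_succ, mul_pow]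
      ring
  simpa [mlen, mfact] using key Finset.univ

/-- Multi-indices of equal length have comparable factorials, because α! ≤ |α|! ≤ 2^{d|α|} α!. So a
linear map, which mixes coordinates but preserves degrees, costs only geometric factors. -/
lemma mfact_rpow_le {p : ℝ} (hp : 0 < p) {α β : Fin d → ℕ} (h : mlen β = mlen α) :
    (mfact β : ℝ) ^ p ≤ ((2 ^ d) ^ p) ^ mlen α * (mfact α : ℝ) ^ p := by
  have h1 : (mfact β : ℝ) ≤ (2 ^ d) ^ mlen α * mfact α := by
    have := mfact_le_factorial_mlen β
    rw [h] at this
    replace this := this.trans (factorial_mlen_le α)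
    exact_mod_cast this
  have h2 := Real.rpow_le_rpow (by positivity) h1 hp.le
  rw [Real.mul_rpow (by positivity) (by positivity)] at h2
  refine h2.trans (le_of_eq ?_)
  congr 1
  have h3 : (0 : ℝ) ≤ 2 ^ d := by positivity
  generalize (2 : ℝ) ^ d = c at h3
  rw [← Real.rpow_natCast, ← Real.rpow_natCast, ← Real.rpow_mul h3, ← Real.rpow_mul h3, mul_comm]

/-- Each coordinate of N y is at most ‖N‖ d |y j|, where j is the largest coordinate of y. All of
|α| is placed on that j, so α' depends on y. -/
lemma exists_mpow_le (N : E d →L[ℝ] E d) : ∃ C : ℝ, 0 ≤ C ∧ ∀ (α : Fin d → ℕ) (y : E d),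
    ∃ α' : Fin d → ℕ, mlen α' = mlen α ∧ |mpow α (N y)| ≤ C ^ mlen α * |mpow α' y| := by
  refine ⟨‖N‖ * d, by positivity, fun α y => ?_⟩
  rcases Nat.eq_zero_or_pos d with rfl | hd
  · exact ⟨α, rfl, by simp [mpow, mlen]⟩
  · have : NeZero d := ⟨hd.ne'⟩
    obtain ⟨j, hj⟩ := norm_le_card_mul_coord y
    refine ⟨Pi.single j (mlen α), mlen_single _ _, ?_⟩
    rw [mpow_single, mpow, Finset.abs_prod, abs_pow, ← mul_pow, mlen, ← Finset.prod_pow_eq_pow_sum]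
    refine Finset.prod_le_prod (fun i _ => abs_nonneg _) fun i _ => ?_
    rw [abs_pow]
    refine pow_le_pow_left₀ (abs_nonneg _) ?_ _
    calc |N y i| ≤ ‖N y‖ := PiLp.norm_apply_le (N y) i
      _ ≤ ‖N‖ * ‖y‖ := N.le_opNorm y
      _ ≤ ‖N‖ * (d * |y j|) := by gcongr
      _ = _ := by ring

/-- Since x = N(M x), both the monomial and the derivatives can be moved to the point M x, where
indices of the same lengths occur. The geometric constants of the two moves are c₁ and c₂, and h' =
h/(c₁ + c₂) absorbs both. -/
lemma GSBound.compLin {t s : ℝ} (ht : 0 < t) (hs : 0 < s) (M N : E d →L[ℝ] E d)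
    (hNM : ∀ x, N (M x) = x) {h : ℝ} (hh : 0 < h) :
    ∃ h' : ℝ, 0 < h' ∧ ∀ (f : Sm d) (B : ℝ), 0 ≤ B → GSBound t s h' B f →
      GSBound t s h B (compLin M f) := by
  obtain ⟨C₁, hC₁, H₁⟩ := exists_mpow_le N
  obtain ⟨C₂, hC₂, H₂⟩ := exists_md_compLin M
  set c₁ : ℝ := (C₁ + 1) * (2 ^ d) ^ t with hc₁
  set c₂ : ℝ := (C₂ + 1) * (2 ^ d) ^ s with hc₂
  have hc₁0 : 0 < c₁ := by positivity
  have hc₂0 : 0 < c₂ := by positivity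
  set h' := h / (c₁ + c₂) with hh'
  have hp : 0 < h' := by positivity
  refine ⟨h', hp, fun f B hB hf α β x => ?_⟩
  obtain ⟨α', hα', Hα'⟩ := H₁ α (M x)
  obtain ⟨R, hR, HR⟩ := H₂ β
  rw [hNM] at Hα'
  rw [← Module.End.mul_apply, hR, Module.End.mul_apply, compLin_apply]
  have hfa := mfact_pos α
  have hfb := mfact_pos β
  have h3 := HR f 0 (M x) |mpow α' (M x)| (B * (h' ^ mlen α * (((2 ^ d) ^ t) ^ mlen α * (mfact α : ℝ) ^ t) *
      (h' ^ mlen β * (((2 ^ d) ^ s) ^ mlen β * (mfact β : ℝ) ^ s)))) (abs_nonneg _) (by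
    intro γ hγ
    rw [mlen_zero, add_zero] at hγ
    have h4 := hf α' γ (M x)
    rw [norm_mul, Complex.norm_real, Real.norm_eq_abs] at h4
    refine h4.trans ?_
    rw [wt_eq, hα', hγ]
    have h5 := mfact_rpow_le ht hα'
    have h6 := mfact_rpow_le hs hγ
    gcongr)
  rw [md_zero] at h3
  change _ * ‖(R f).1 (M x)‖ ≤ _ at h3
  rw [norm_mul, Complex.norm_real, Real.norm_eq_abs]
  calc _ ≤ C₁ ^ mlen α * |mpow α' (M x)| * ‖(R f).1 (M x)‖ := by gcongr
    _ = C₁ ^ mlen α * (|mpow α' (M x)| * ‖(R f).1 (M x)‖) := by ring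
    _ ≤ C₁ ^ mlen α * (C₂ ^ mlen β * _) := mul_le_mul_of_nonneg_left h3 (by positivity)
    _ = B * ((h' * (C₁ * (2 ^ d) ^ t)) ^ mlen α * (mfact α : ℝ) ^ t *
        ((h' * (C₂ * (2 ^ d) ^ s)) ^ mlen β * (mfact β : ℝ) ^ s)) := by
        rw [mul_pow h', mul_pow h', mul_pow C₁, mul_pow C₂]; ring
    _ ≤ B * wt t s h α β := by
        rw [wt_eq]
        have h7 : h' * (C₁ * (2 ^ d) ^ t) ≤ h := by
          have : C₁ * (2 ^ d) ^ t ≤ c₁ + c₂ := by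
            have : C₁ * (2 ^ d) ^ t ≤ c₁ := by rw [hc₁]; gcongr; linarith
            linarith
          calc _ ≤ h' * (c₁ + c₂) := by gcongr
            _ = h := by rw [hh']; field_simp
        have h8 : h' * (C₂ * (2 ^ d) ^ s) ≤ h := by
          have : C₂ * (2 ^ d) ^ s ≤ c₁ + c₂ := by
            have : C₂ * (2 ^ d) ^ s ≤ c₂ := by rw [hc₂]; gcongr; linarith
            linarith
          calc _ ≤ h' * (c₁ + c₂) := by gcongr
            _ = h := by rw [hh']; field_simp
        gcongr

lemma compLin_mem {t s : ℝ} (ht : 0 < t) (hs : 0 < s) (M N : E d →L[ℝ] E d)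
    (hNM : ∀ x, N (M x) = x) {f : E d → ℂ} (hf : f ∈ GSSpace d t s) :
    (fun x => f (M x)) ∈ GSSpace d t s := by
  refine mem_gsSpace (compLin M ⟨f, hf.1⟩) fun h hh => ?_
  obtain ⟨h', hh', H⟩ := GSBound.compLin ht hs M N hNM hh
  obtain ⟨B, hB, hfB⟩ := exists_gsBound ⟨f, hf⟩ hh'
  exact ⟨B, H _ B hB hfB⟩

/-! ### Bounds for translations -/

/-- The constant is kept explicit as a function of a: taken at a = ‖v‖, it yields growth of
exponential type in ‖v‖^{1/p}, hence in ρ. -/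
lemma pow_le_exp_mul {p h a : ℝ} (hp : 0 < p) (hh : 0 < h) (ha : 0 ≤ a) (m : ℕ) :
    a ^ m ≤ Real.exp (p * (a / h) ^ (1 / p)) * (h ^ m * (m.factorial : ℝ) ^ p) := by
  have h1 := Real.pow_div_factorial_le_exp (x := (a / h) ^ (1 / p)) (by positivity) m
  have hm : (0 : ℝ) < m.factorial := by exact_mod_cast Nat.factorial_pos m
  rw [div_le_iff₀ hm] at h1
  have h2 := Real.rpow_le_rpow (by positivity) h1 hp.le
  rw [Real.mul_rpow (by positivity) hm.le, ← Real.rpow_natCast, ← Real.rpow_mul (by positivity),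
    ← Real.rpow_mul (by positivity), ← Real.exp_mul] at h2
  have e : 1 / p * (m * p) = (m : ℝ) := by field_simp
  rw [e, Real.rpow_natCast, div_pow, div_le_iff₀ (by positivity), mul_comm _ p] at h2
  linarith

lemma abs_mpow_le_exp_mul {p h : ℝ} (hp : 0 < p) (hh : 0 < h) (α : Fin d → ℕ) (v : E d) :
    |mpow α v| ≤ Real.exp (d * (p * (‖v‖ / h) ^ (1 / p))) *
      (h ^ mlen α * (mfact α : ℝ) ^ p) := by
  rw [mpow, Finset.abs_prod]
  have h1 : ∀ i ∈ Finset.univ, |v i ^ α i| ≤ Real.exp (p * (‖v‖ / h) ^ (1 / p)) *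
      (h ^ α i * ((α i).factorial : ℝ) ^ p) := by
    intro i _
    rw [abs_pow]
    refine (pow_le_pow_left₀ (abs_nonneg _) (PiLp.norm_apply_le v i) _).trans ?_
    exact pow_le_exp_mul hp hh (norm_nonneg v) _
  refine (Finset.prod_le_prod (fun i _ => abs_nonneg _) h1).trans (le_of_eq ?_)
  rw [Finset.prod_mul_distrib, Finset.prod_mul_distrib, Finset.prod_const, Finset.card_univ,
    Fintype.card_fin, ← Real.exp_nat_mul, Finset.prod_pow_eq_pow_sum,
    Real.finsetProd_rpow _ _ fun i _ => by positivity]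
  congr 3
  rw [mfact]
  push_cast
  rfl

/-- In each coordinate |zᵢ + vᵢ| ≤ 2 max(|zᵢ|, |vᵢ|). Giving the whole exponent to the larger term
replaces the binomial sum by one product, at the price of 2^{|α|}. -/
lemma exists_mpow_add_le (α : Fin d → ℕ) (z v : E d) : ∃ α₁ α₂ : Fin d → ℕ,
    mlen α₁ + mlen α₂ = mlen α ∧ mfact α₁ * mfact α₂ = mfact α ∧
      |mpow α (z + v)| ≤ 2 ^ mlen α * (|mpow α₁ z| * |mpow α₂ v|) := by
  classical
  refine ⟨fun i => if |v i| ≤ |z i| then α i else 0, fun i => if |v i| ≤ |z i| then 0 else α i,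
    ?_, ?_, ?_⟩
  · rw [mlen, mlen, mlen, ← Finset.sum_add_distrib]
    refine Finset.sum_congr rfl fun i _ => ?_
    split_ifs <;> simp
  · rw [mfact, mfact, mfact, ← Finset.prod_mul_distrib]
    refine Finset.prod_congr rfl fun i _ => ?_
    split_ifs <;> simp
  · rw [mpow, mpow, mpow, Finset.abs_prod, Finset.abs_prod, Finset.abs_prod, mlen,
      ← Finset.prod_pow_eq_pow_sum, ← Finset.prod_mul_distrib, ← Finset.prod_mul_distrib]
    refine Finset.prod_le_prod (fun i _ => abs_nonneg _) fun i _ => ?_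
    have h0 : |(z + v) i| ≤ |z i| + |v i| := abs_add_le _ _
    rw [abs_pow]
    split_ifs with h
    · rw [pow_zero, abs_one, mul_one, abs_pow, ← mul_pow]
      exact pow_le_pow_left₀ (abs_nonneg _) (by linarith) _
    · rw [pow_zero, abs_one, one_mul, abs_pow, ← mul_pow]
      exact pow_le_pow_left₀ (abs_nonneg _) (by linarith) _

lemma GSBound.tr {t s h B : ℝ} (ht : 0 < t) (hh : 0 < h) (hB : 0 ≤ B) {f : Sm d}
    (hf : GSBound t s (h / 2) B f) (v : E d) :
    GSBound t s h (Real.exp (d * (t * (‖v‖ / (h / 2)) ^ (1 / t))) * B) (tr v f) := by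
  intro α β x
  rw [← Module.End.mul_apply, md_tr]
  change ‖(mpow α x : ℂ) * (md β f).1 (x - v)‖ ≤ _
  obtain ⟨α₁, α₂, e1, e2, h1⟩ := exists_mpow_add_le α (x - v) v
  rw [sub_add_cancel] at h1
  have h2 := abs_mpow_le_exp_mul ht (half_pos hh) α₂ v
  have h3 := hf α₁ β (x - v)
  rw [norm_mul, Complex.norm_real, Real.norm_eq_abs] at h3 ⊢
  set X := Real.exp (d * (t * (‖v‖ / (h / 2)) ^ (1 / t)))
  have e3 : (mfact α₁ : ℝ) ^ t * (mfact α₂ : ℝ) ^ t = (mfact α : ℝ) ^ t := by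
    rw [← Real.mul_rpow (by positivity) (by positivity), ← e2]
    push_cast
    rfl
  have := mfact_pos α₁
  have := mfact_pos α₂
  have := mfact_pos β
  have := mfact_pos α
  calc _ ≤ 2 ^ mlen α * (|mpow α₁ (x - v)| * |mpow α₂ v|) * ‖(md β f).1 (x - v)‖ := by gcongr
    _ = 2 ^ mlen α * |mpow α₂ v| * (|mpow α₁ (x - v)| * ‖(md β f).1 (x - v)‖) := by ring
    _ ≤ 2 ^ mlen α * (X * ((h / 2) ^ mlen α₂ * (mfact α₂ : ℝ) ^ t)) * (B * wt t s (h / 2) α₁ β) := by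
      gcongr
    _ = X * B * ((2 ^ mlen α * (h / 2) ^ (mlen α₁ + mlen α₂) *
        ((mfact α₁ : ℝ) ^ t * (mfact α₂ : ℝ) ^ t)) * ((h / 2) ^ mlen β * (mfact β : ℝ) ^ s)) := by
      rw [wt_eq, pow_add]; ring
    _ = X * B * ((h ^ mlen α * (mfact α : ℝ) ^ t) * ((h / 2) ^ mlen β * (mfact β : ℝ) ^ s)) := by
      rw [e1, e3, ← mul_pow, mul_div_cancel₀ _ two_ne_zero]
    _ ≤ _ := by
      rw [wt_eq]
      gcongr
      linarith

lemma norm_fderiv_apply_le_sum (f : Sm d) (x v : E d) :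
    ‖fderiv ℝ f.1 x v‖ ≤ ‖v‖ * ∑ j, ‖(pd j f).1 x‖ := by
  have e : v = ∑ j, v j • EuclideanSpace.single j (1 : ℝ) := by
    ext k
    simp [Finset.sum_apply, Pi.single_apply]
  calc ‖fderiv ℝ f.1 x v‖ = ‖∑ j, v j • (pd j f).1 x‖ := by
        conv_lhs => rw [e]
        rw [map_sum]
        congr 1
        refine Finset.sum_congr rfl fun j _ => ?_
        rw [map_smul]
        rfl
    _ ≤ ∑ j, ‖v j • (pd j f).1 x‖ := norm_sum_le _ _
    _ ≤ ∑ j, ‖v‖ * ‖(pd j f).1 x‖ := by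
        refine Finset.sum_le_sum fun j _ => ?_
        rw [norm_smul]
        gcongr
        exact PiLp.norm_apply_le v j
    _ = _ := (Finset.mul_sum _ _ _).symm

/-- The mean value inequality along σ ↦ y - σv. The derivative involves translates of ∂ⱼ f by σv,
whose bounds are uniform for ‖v‖ ≤ 1. The factor ‖v‖ yields continuity of the shifts in z. -/
lemma GSBound.tr_sub {t s h : ℝ} (ht : 0 < t) (hs : 0 < s) (hh : 0 < h) :
    ∃ h' K : ℝ, 0 < h' ∧ 0 ≤ K ∧ ∀ (f : Sm d) (B : ℝ), 0 ≤ B → GSBound t s h' B f →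
      ∀ v : E d, ‖v‖ ≤ 1 → GSBound t s h (K * ‖v‖ * B) (GelfandShilov.tr v f - f) := by
  obtain ⟨K, hK, H⟩ := GSBound.pd (d := d) (t := t) hs (half_pos hh)
  set X := Real.exp (d * (t * (1 / (h / 2)) ^ (1 / t))) with hX
  refine ⟨h / 2 / 2 ^ s, d * X * K, by positivity, by positivity,
    fun f B hB hf v hv α β y => ?_⟩
  set g := md β f with hg
  have hgc : ContDiff ℝ ∞ g.1 := g.2
  have hgd : Differentiable ℝ g.1 := hgc.differentiable (by simp)
  have hW := wt_pos (t := t) (s := s) hh α β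
  have h1 : ∀ (σ : ℝ), σ ∈ Set.Icc (0 : ℝ) 1 → ∀ j,
      |mpow α y| * ‖(GelfandShilov.pd j g).1 (y - σ • v)‖ ≤ X * (K * B) * wt t s h α β := by
    intro σ hσ j
    have h2 := ((H f B hB hf j).tr ht hh (by positivity) (σ • v)) α β y
    rw [← Module.End.mul_apply (md β), md_tr, Module.End.mul_apply, ← Module.End.mul_apply (md β),
      md_mul_pd, md_add_single, norm_mul, Complex.norm_real, Real.norm_eq_abs] at h2
    refine h2.trans ?_
    gcongr
    rw [hX]
    have h3 : ‖σ • v‖ ≤ 1 := by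
      rw [norm_smul, Real.norm_of_nonneg hσ.1]
      exact mul_le_one₀ hσ.2 (norm_nonneg _) hv
    gcongr
  have h4 : ∀ σ ∈ Set.Icc (0 : ℝ) 1, HasDerivWithinAt (fun σ : ℝ => (mpow α y : ℂ) * g.1 (y - σ • v))
      ((mpow α y : ℂ) * fderiv ℝ g.1 (y - σ • v) (-v)) (Set.Icc 0 1) σ := by
    intro σ _
    have h5 : HasDerivAt (fun σ : ℝ => y - σ • v) (-v) σ := by
      simpa using ((hasDerivAt_id σ).smul_const v).const_sub y
    exact (((hgd _).hasFDerivAt.comp_hasDerivAt σ h5).const_mul _).hasDerivWithinAt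
  have h6 := norm_image_sub_le_of_norm_deriv_le_segment_01' (C := d * X * K * ‖v‖ * B * wt t s h α β)
    h4 (by
      intro σ hσ
      have hσ' : σ ∈ Set.Icc (0 : ℝ) 1 := ⟨hσ.1, hσ.2.le⟩
      rw [norm_mul, Complex.norm_real, Real.norm_eq_abs]
      calc _ ≤ |mpow α y| * (‖-v‖ * ∑ j, ‖(GelfandShilov.pd j g).1 (y - σ • v)‖) := by
            gcongr
            exact norm_fderiv_apply_le_sum g _ _
        _ = ‖v‖ * ∑ j, |mpow α y| * ‖(GelfandShilov.pd j g).1 (y - σ • v)‖ := by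
            rw [norm_neg, ← Finset.mul_sum]; ring
        _ ≤ ‖v‖ * ∑ _j : Fin d, X * (K * B) * wt t s h α β := by
            exact mul_le_mul_of_nonneg_left (Finset.sum_le_sum fun j _ => h1 σ hσ' j) (norm_nonneg v)
        _ = _ := by simp; ring)
  have e : (md β (GelfandShilov.tr v f - f)).1 y = g.1 (y - (1 : ℝ) • v) - g.1 (y - (0 : ℝ) • v) := by
    rw [map_sub, ← Module.End.mul_apply, md_tr, one_smul, zero_smul, sub_zero]
    rfl
  rw [e, mul_sub]
  exact h6

/-! ### Bounds for modulations -/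

lemma fourierFun_sub {f g : E d → ℂ} (hf : Integrable f) (hg : Integrable g) (ξ : E d) :
    fourierFun (f - g) ξ = fourierFun f ξ - fourierFun g ξ := by
  have h1 : f - g = f + (-1 : ℂ) • g := by ext x; simp [sub_eq_add_neg]
  rw [h1, fourierFun_add hf (hg.smul _), fourierFun_smul]
  ring

lemma fourierFun_fourierFun {t s : ℝ} (ht : 0 < t) (hs : 0 < s) (hst : 1 < s + t) {f : E d → ℂ}
    (hf : f ∈ GSSpace d t s) (x : E d) : fourierFun (fourierFun f) (-x) = f x :=
  fourierFun_fourierFun_neg (continuous_of_mem hf) (integrable_of_mem ht hf)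
    (integrable_of_mem hs (fourierFun_mem ht hs hst hf)) x

/-- The reflection `x ↦ -x`. -/
def reflL (d : ℕ) : E d →L[ℝ] E d := -ContinuousLinearMap.id ℝ (E d)

lemma reflL_reflL (x : E d) : reflL d (reflL d x) = x := neg_neg x

/-- f is the reflection of the Fourier transform of f̂. This allows estimates to be proved on the
Fourier side, where modulations become translations. -/
lemma GSBound.of_fourier {t s : ℝ} (ht : 0 < t) (hs : 0 < s) (hst : 1 < s + t) {h : ℝ} (hh : 0 < h) :
    ∃ h' K : ℝ, 0 < h' ∧ 0 ≤ K ∧ ∀ (f : Sm d) (hf : f.1 ∈ GSSpace d t s) (B : ℝ), 0 ≤ B →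
      GSBound s t h' B (fourierSm ht f hf) → GSBound t s h (K * B) f := by
  obtain ⟨h₁, hh₁, H₁⟩ := GSBound.compLin (d := d) ht hs (reflL d) (reflL d) reflL_reflL hh
  obtain ⟨h₂, K₂, hh₂, hK₂, H₂⟩ := GSBound.fourier (d := d) hs ht (by rwa [add_comm]) hh₁
  refine ⟨h₂, K₂, hh₂, hK₂, fun f hf B hB hfB => ?_⟩
  have h3 := H₁ _ _ (by positivity) (H₂ _ (fourierFun_mem ht hs hst hf) B hB hfB)
  have e : GelfandShilov.compLin (reflL d)
      (fourierSm hs (fourierSm ht f hf) (fourierFun_mem ht hs hst hf)) = f := by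
    ext x
    exact fourierFun_fourierFun ht hs hst hf x
  rwa [e] at h3

/-- Modulation as an endomorphism of the smooth functions. -/
def modE (ξ : E d) : Module.End ℂ (Sm d) where
  toFun f := ⟨fun y => Complex.exp (Complex.I * (inner ℝ y ξ : ℝ)) * f.1 y, by
    have hf : ContDiff ℝ ∞ f.1 := f.2
    refine ContDiff.mul ?_ hf
    refine ContDiff.cexp (contDiff_const.mul (Complex.ofRealCLM.contDiff.comp ?_))
    exact contDiff_id.inner ℝ contDiff_const⟩
  map_add' _ _ := by ext x; exact mul_add _ _ _
  map_smul' _ _ := by ext x; exact mul_left_comm _ _ _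

lemma modE_tr_coe (x ξ : E d) (f : Sm d) : (modE ξ (tr x f)).1 = timeFreqShift x ξ f.1 := rfl

lemma tr_mem {t s : ℝ} (ht : 0 < t) {f : Sm d} (hf : f.1 ∈ GSSpace d t s) (x : E d) :
    (tr x f).1 ∈ GSSpace d t s := by
  refine mem_gsSpace _ fun h hh => ?_
  obtain ⟨B, hB, hfB⟩ := exists_gsBound ⟨f.1, hf⟩ (half_pos hh)
  exact ⟨_, hfB.tr ht hh hB x⟩

lemma modE_mem {t s : ℝ} (ht : 0 < t) (hs : 0 < s) {f : Sm d} (hf : f.1 ∈ GSSpace d t s) (ξ : E d) :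
    (modE ξ f).1 ∈ GSSpace d t s := by
  have := IsGelfandShilov.timeFreqShift ht hs 0 ξ hf
  rw [← modE_tr_coe] at this
  have e : tr 0 f = f := by
    ext x
    change f.1 (x - 0) = f.1 x
    rw [sub_zero]
  rwa [e] at this

lemma fourierFun_modE (f : E d → ℂ) (ξ η : E d) :
    fourierFun (fun y => Complex.exp (Complex.I * (inner ℝ y ξ : ℝ)) * f y) η =
      fourierFun f (η - ξ) := by
  unfold fourierFun
  congr 2
  ext x
  rw [mul_right_comm, ← Complex.exp_add, mul_comm, inner_sub_right]
  congr 2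
  push_cast
  ring

lemma fourierSm_modE {t s : ℝ} (ht : 0 < t) (hs : 0 < s) (f : Sm d) (hf : f.1 ∈ GSSpace d t s)
    (ξ : E d) : fourierSm ht (modE ξ f) (modE_mem ht hs hf ξ) = tr ξ (fourierSm ht f hf) := by
  ext η
  exact fourierFun_modE f.1 ξ η

/-- Modulation by ξ translates f̂ by ξ. As f̂ lies in Σ_s^t, the growth is exponential in ‖ξ‖^{1/s}.
-/
lemma GSBound.modE {t s : ℝ} (ht : 0 < t) (hs : 0 < s) (hst : 1 < s + t) {h : ℝ} (hh : 0 < h) :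
    ∃ h' K r : ℝ, 0 < h' ∧ 0 ≤ K ∧ 0 ≤ r ∧ ∀ (f : Sm d), f.1 ∈ GSSpace d t s → ∀ (B : ℝ), 0 ≤ B →
      GSBound t s h' B f → ∀ ξ : E d,
        GSBound t s h (K * Real.exp (r * ‖ξ‖ ^ (1 / s)) * B) (GelfandShilov.modE ξ f) := by
  obtain ⟨h₁, K₁, hh₁, hK₁, H₁⟩ := GSBound.of_fourier (d := d) ht hs hst hh
  obtain ⟨h₂, K₂, hh₂, hK₂, H₂⟩ := GSBound.fourier (d := d) ht hs hst (half_pos hh₁)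
  refine ⟨h₂, K₁ * K₂, d * (s * (1 / (h₁ / 2)) ^ (1 / s)), hh₂, by positivity, by positivity,
    fun f hf B hB hfB ξ => ?_⟩
  have h3 := (H₂ f hf B hB hfB).tr hs hh₁ (by positivity) ξ
  rw [← fourierSm_modE ht hs] at h3
  have h4 := H₁ _ _ _ (by positivity) h3
  have e : Real.exp (d * (s * (‖ξ‖ / (h₁ / 2)) ^ (1 / s))) =
      Real.exp (d * (s * (1 / (h₁ / 2)) ^ (1 / s)) * ‖ξ‖ ^ (1 / s)) := by
    rw [div_eq_mul_one_div, Real.mul_rpow (by positivity) (by positivity)]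
    congr 1; ring
  rw [e] at h4
  convert h4 using 1
  ring

lemma GSBound.modE_sub {t s : ℝ} (ht : 0 < t) (hs : 0 < s) (hst : 1 < s + t) {h : ℝ} (hh : 0 < h) :
    ∃ h' K : ℝ, 0 < h' ∧ 0 ≤ K ∧ ∀ (f : Sm d), f.1 ∈ GSSpace d t s → ∀ (B : ℝ), 0 ≤ B →
      GSBound t s h' B f → ∀ ξ : E d, ‖ξ‖ ≤ 1 →
        GSBound t s h (K * ‖ξ‖ * B) (GelfandShilov.modE ξ f - f) := by
  obtain ⟨h₁, K₁, hh₁, hK₁, H₁⟩ := GSBound.of_fourier (d := d) ht hs hst hh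
  obtain ⟨h₂, K₂, hh₂, hK₂, H₂⟩ := GSBound.tr_sub (d := d) hs ht hh₁
  obtain ⟨h₃, K₃, hh₃, hK₃, H₃⟩ := GSBound.fourier (d := d) ht hs hst hh₂
  refine ⟨h₃, K₁ * (K₂ * K₃), hh₃, by positivity, fun f hf B hB hfB ξ hξ => ?_⟩
  have hm := modE_mem ht hs hf ξ
  have h4 := H₂ _ _ (by positivity) (H₃ f hf B hB hfB) ξ hξ
  have e : GelfandShilov.tr ξ (fourierSm ht f hf) - fourierSm ht f hf =
      fourierSm ht (GelfandShilov.modE ξ f - f) ((GSSpace d t s).sub_mem hm hf) := by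
    rw [← fourierSm_modE ht hs]
    ext η
    exact (fourierFun_sub (integrable_of_mem ht hm) (integrable_of_mem ht hf) η).symm
  rw [e] at h4
  have h5 := H₁ _ _ _ (by positivity) h4
  convert h5 using 1
  ring

/-! ### Time-frequency shifts -/

/-- Time-frequency shift as an endomorphism of the smooth functions. -/
def tfs (z : E d × E d) : Module.End ℂ (Sm d) := modE z.2 * tr z.1

lemma tfs_bound {t s : ℝ} (ht : 0 < t) (hs : 0 < s) (hst : 1 < s + t) {h : ℝ} (hh : 0 < h)
    {f : Sm d} (hf : f.1 ∈ GSSpace d t s) :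
    ∃ C r : ℝ, 0 ≤ C ∧ 0 ≤ r ∧ ∀ z : E d × E d,
      GSBound t s h (C * Real.exp (r * rho t s z)) (tfs z f) := by
  obtain ⟨h₁, K₁, r₁, hh₁, hK₁, hr₁, H₁⟩ := GSBound.modE (d := d) ht hs hst hh
  obtain ⟨B, hB, hfB⟩ := exists_gsBound ⟨f.1, hf⟩ (half_pos hh₁)
  set r₂ := d * (t * (1 / (h₁ / 2)) ^ (1 / t))
  have hr₂ : 0 ≤ r₂ := by positivity
  refine ⟨K₁ * B, r₁ + r₂, by positivity, by positivity, fun z => ?_⟩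
  have h3 := H₁ _ (tr_mem ht hf z.1) _ (by positivity) (hfB.tr ht hh₁ hB z.1) z.2
  refine h3.mono hh le_rfl (by positivity) ?_
  have e : Real.exp (d * (t * (‖z.1‖ / (h₁ / 2)) ^ (1 / t))) = Real.exp (r₂ * ‖z.1‖ ^ (1 / t)) := by
    rw [div_eq_mul_one_div, Real.mul_rpow (by positivity) (by positivity)]
    congr 1; ring
  rw [e]
  calc _ = K₁ * B * (Real.exp (r₁ * ‖z.2‖ ^ (1 / s)) * Real.exp (r₂ * ‖z.1‖ ^ (1 / t))) := by ring
    _ ≤ _ := by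
      rw [← Real.exp_add]
      gcongr
      unfold rho
      have : 0 ≤ r₁ * ‖z.1‖ ^ (1 / t) := by positivity
      have : 0 ≤ r₂ * ‖z.2‖ ^ (1 / s) := by positivity
      linarith

lemma GSBound.add {t s h B B' : ℝ} {f g : Sm d} (hf : GSBound t s h B f) (hg : GSBound t s h B' g) :
    GSBound t s h (B + B') (f + g) := by
  intro α β x
  rw [map_add, Submodule.coe_add, Pi.add_apply, mul_add, add_mul]
  exact (norm_add_le _ _).trans (add_le_add (hf α β x) (hg α β x))

lemma tr_add (v w : E d) : tr (v + w) = tr v * tr w := by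
  ext f x
  change f.1 (x - (v + w)) = f.1 (x - v - w)
  rw [sub_sub]

lemma modE_add (v w : E d) : modE (v + w) = modE v * modE w := by
  ext f x
  change Complex.exp (Complex.I * (inner ℝ x (v + w) : ℝ)) * f.1 x =
    Complex.exp (Complex.I * (inner ℝ x v : ℝ)) * (Complex.exp (Complex.I * (inner ℝ x w : ℝ)) * f.1 x)
  rw [← mul_assoc, ← Complex.exp_add, inner_add_right]
  congr 2
  push_cast
  ring

lemma tfs_sub_bound {t s : ℝ} (ht : 0 < t) (hs : 0 < s) (hst : 1 < s + t) {h : ℝ} (hh : 0 < h)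
    {f : Sm d} (hf : f.1 ∈ GSSpace d t s) (z₀ : E d × E d) :
    ∃ C : ℝ, 0 ≤ C ∧ ∀ z : E d × E d, ‖z - z₀‖ ≤ 1 →
      GSBound t s h (C * ‖z - z₀‖) (tfs z f - tfs z₀ f) := by
  obtain ⟨h₁, K₁, r₁, hh₁, hK₁, hr₁, H₁⟩ := GSBound.modE (d := d) ht hs hst hh
  obtain ⟨h₂, K₂, hh₂, hK₂, H₂⟩ := GSBound.modE_sub (d := d) ht hs hst hh₁
  obtain ⟨B₂, hB₂, hfB₂⟩ := exists_gsBound ⟨_, tr_mem ht hf z₀.1⟩ hh₂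
  obtain ⟨h₃, K₃, hh₃, hK₃, H₃⟩ := GSBound.tr_sub (d := d) ht hs hh₁
  obtain ⟨B₃, hB₃, hfB₃⟩ := exists_gsBound ⟨_, tr_mem ht hf z₀.1⟩ hh₃
  set X := Real.exp (r₁ * (‖z₀.2‖ + 1) ^ (1 / s)) with hX
  refine ⟨K₁ * X * (K₃ * B₃) + K₁ * X * (K₂ * B₂), by positivity, fun z hz => ?_⟩
  have hz1 : ‖z.1 - z₀.1‖ ≤ ‖z - z₀‖ := norm_fst_le (z - z₀)
  have hz2 : ‖z.2 - z₀.2‖ ≤ ‖z - z₀‖ := norm_snd_le (z - z₀)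
  -- The translation is changed first, under the modulation by z.2; then the modulation is changed,
  -- with the translation fixed at z₀.1.
  have e1 : tfs z f - tfs z₀ f = modE z.2 (tr (z.1 - z₀.1) (tr z₀.1 f) - tr z₀.1 f) +
      modE z₀.2 (modE (z.2 - z₀.2) (tr z₀.1 f) - tr z₀.1 f) := by
    rw [← Module.End.mul_apply (tr _), ← tr_add, sub_add_cancel, map_sub, map_sub,
      ← Module.End.mul_apply (modE _) (modE _), ← modE_add, add_sub_cancel]
    simp only [tfs, Module.End.mul_apply]
    abel
  rw [e1, add_mul]
  have hX1 : ∀ ξ : E d, ‖ξ‖ ≤ ‖z₀.2‖ + 1 → Real.exp (r₁ * ‖ξ‖ ^ (1 / s)) ≤ X := by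
    intro ξ hξ
    rw [hX]
    gcongr
  refine GSBound.add ?_ ?_
  · have h4 := H₃ _ B₃ hB₃ hfB₃ (z.1 - z₀.1) (hz1.trans hz)
    have h5 := H₁ _ ((GSSpace d t s).sub_mem (tr_mem ht (tr_mem ht hf _) _) (tr_mem ht hf _)) _
      (by positivity) h4 z.2
    refine h5.mono hh le_rfl (by positivity) ?_
    have h6 : ‖z.2‖ ≤ ‖z₀.2‖ + 1 := by
      have := norm_add_le (z.2 - z₀.2) z₀.2
      rw [sub_add_cancel] at this
      linarith
    calc _ ≤ K₁ * X * (K₃ * ‖z - z₀‖ * B₃) := by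
          gcongr
          exact hX1 _ h6
      _ = _ := by ring
  · have h4 := H₂ _ (tr_mem ht hf _) B₂ hB₂ hfB₂ (z.2 - z₀.2) (hz2.trans hz)
    have h5 := H₁ _ ((GSSpace d t s).sub_mem (modE_mem ht hs (tr_mem ht hf _) _) (tr_mem ht hf _)) _
      (by positivity) h4 z₀.2
    refine h5.mono hh le_rfl (by positivity) ?_
    calc _ ≤ K₁ * X * (K₂ * ‖z - z₀‖ * B₂) := by
          gcongr
          exact hX1 _ (by linarith)
      _ = _ := by ring

/-! ### The short-time Fourier transform of test functions -/

/-- The unnormalized short-time Fourier transform `∫ f conj(M_ξ T_x ψ)` of a function. -/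
def vst (ψ f : E d → ℂ) (z : E d × E d) : ℂ :=
  ∫ y, f y * (starRingEnd ℂ) (timeFreqShift z.1 z.2 ψ y)

lemma norm_timeFreqShift (x ξ : E d) (f : E d → ℂ) (y : E d) :
    ‖timeFreqShift x ξ f y‖ = ‖f (y - x)‖ := by
  rw [timeFreqShift, norm_mul, mul_comm Complex.I, Complex.norm_exp_ofReal_mul_I, one_mul]

lemma exists_norm_le {t s : ℝ} {f : E d → ℂ} (hf : f ∈ GSSpace d t s) :
    ∃ B : ℝ, 0 ≤ B ∧ ∀ x, ‖f x‖ ≤ B := by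
  obtain ⟨B, hB, hfB⟩ := exists_gsBound ⟨f, hf⟩ one_pos
  exact ⟨B, hB, hfB.norm_le⟩

lemma continuous_vst {t s : ℝ} (ht : 0 < t) {ψ f : E d → ℂ} (hψ : ψ ∈ GSSpace d t s)
    (hf : f ∈ GSSpace d t s) : Continuous (vst ψ f) := by
  obtain ⟨B, hB, hψB⟩ := exists_norm_le hψ
  have hfc := continuous_of_mem hf
  have hψc := continuous_of_mem hψ
  have hcont : Continuous fun p : (E d × E d) × E d =>
      f p.2 * (starRingEnd ℂ) (timeFreqShift p.1.1 p.1.2 ψ p.2) := by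
    unfold timeFreqShift
    fun_prop
  refine continuous_of_dominated (bound := fun y => ‖f y‖ * B) (fun z => ?_)
    (fun z => Filter.Eventually.of_forall fun y => ?_) ((integrable_of_mem ht hf).norm.mul_const B)
    (Filter.Eventually.of_forall fun y => ?_)
  · exact (hcont.comp (Continuous.prodMk_right z)).aestronglyMeasurable
  · rw [norm_mul, RCLike.norm_conj, norm_timeFreqShift]
    gcongr
    exact hψB _
  · exact hcont.comp (Continuous.prodMk_left y)

lemma integral_mul_le_exp {p R : ℝ} (hp : 0 < p) (hR : 0 < R) {f g : E d → ℂ}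
    (hf : ∀ r : ℝ, 0 < r → ∃ C : ℝ, 0 ≤ C ∧ ∀ x, ‖f x‖ ≤ C * Real.exp (-r * ‖x‖ ^ p))
    (hg : ∀ r : ℝ, 0 < r → ∃ C : ℝ, 0 ≤ C ∧ ∀ x, ‖g x‖ ≤ C * Real.exp (-r * ‖x‖ ^ p)) :
    ∃ C : ℝ, 0 ≤ C ∧ ∀ x, ∫ y, ‖f y‖ * ‖g (y - x)‖ ≤ C * Real.exp (-R * ‖x‖ ^ p) := by
  -- From ‖x‖^p ≤ 2^p (‖y‖^p + ‖y - x‖^p): R 2^p yields the decay in x, and the extra 1 leaves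
  -- e^{-‖y‖^p} for the integration.
  set r := R * 2 ^ p + 1 with hr
  have hr0 : 0 < r := by positivity
  obtain ⟨C₁, hC₁, H₁⟩ := hf r hr0
  obtain ⟨C₂, hC₂, H₂⟩ := hg r hr0
  have hint := integrable_exp_neg_rpow (d := d) hp one_pos
  set I := ∫ y : E d, Real.exp (-1 * ‖y‖ ^ p)
  have hI : 0 ≤ I := integral_nonneg fun y => (Real.exp_pos _).le
  refine ⟨C₁ * C₂ * I, by positivity, fun x => ?_⟩
  have h1 : ∀ y, ‖f y‖ * ‖g (y - x)‖ ≤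
      C₁ * C₂ * Real.exp (-R * ‖x‖ ^ p) * Real.exp (-1 * ‖y‖ ^ p) := by
    intro y
    have h2 := norm_add_rpow_le hp y (x - y)
    rw [add_sub_cancel, ← norm_neg (x - y), neg_sub] at h2
    calc _ ≤ (C₁ * Real.exp (-r * ‖y‖ ^ p)) * (C₂ * Real.exp (-r * ‖y - x‖ ^ p)) := by
          gcongr
          · exact H₁ y
          · exact H₂ _
      _ = C₁ * C₂ * Real.exp (-r * ‖y‖ ^ p + -r * ‖y - x‖ ^ p) := by rw [Real.exp_add]; ring
      _ ≤ C₁ * C₂ * Real.exp (-R * ‖x‖ ^ p + -1 * ‖y‖ ^ p) := by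
          refine mul_le_mul_of_nonneg_left (Real.exp_le_exp.2 ?_) (by positivity)
          rw [hr]
          have : 0 ≤ ‖y - x‖ ^ p := by positivity
          have := mul_le_mul_of_nonneg_left h2 hR.le
          nlinarith
      _ = _ := by rw [Real.exp_add]; ring
  have h3 := integral_mono_of_nonneg
    (Filter.Eventually.of_forall fun y => mul_nonneg (norm_nonneg (f y)) (norm_nonneg (g (y - x))))
    (hint.const_mul (C₁ * C₂ * Real.exp (-R * ‖x‖ ^ p))) (Filter.Eventually.of_forall h1)
  rw [integral_const_mul] at h3
  exact h3.trans (le_of_eq (by ring))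

lemma norm_vst_le (ψ f : E d → ℂ) (z : E d × E d) :
    ‖vst ψ f z‖ ≤ ∫ y, ‖f y‖ * ‖ψ (y - z.1)‖ := by
  refine (norm_integral_le_integral_norm _).trans (le_of_eq ?_)
  congr 1
  ext y
  rw [norm_mul, RCLike.norm_conj, norm_timeFreqShift]

lemma fourierFun_timeFreqShift (f : E d → ℂ) (x ξ η : E d) :
    fourierFun (timeFreqShift x ξ f) η =
      Complex.exp (-Complex.I * (inner ℝ x (η - ξ) : ℝ)) * fourierFun f (η - ξ) := by
  have h1 : timeFreqShift x ξ f = fun y => Complex.exp (Complex.I * (inner ℝ y ξ : ℝ)) *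
    (fun y => f (y - x)) y := rfl
  rw [h1, fourierFun_modE, fourierFun, fourierFun, mul_left_comm,
    ← integral_const_mul (Complex.exp _), ← integral_add_right_eq_self _ x]
  congr 2
  ext y
  rw [add_sub_cancel_right, inner_add_left, mul_left_comm, ← Complex.exp_add]
  congr 2
  push_cast
  ring

/-- The direct estimate sees only the separation in x. Parseval's formula turns the integral into
one over f̂ and ψ̂, which sees the separation in ξ. -/
lemma norm_vst_le_fourier {t s : ℝ} (ht : 0 < t) (hs : 0 < s) (hst : 1 < s + t) {ψ f : E d → ℂ}
    (hψ : ψ ∈ GSSpace d t s) (hf : f ∈ GSSpace d t s) (z : E d × E d) :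
    ‖vst ψ f z‖ ≤ ∫ η, ‖fourierFun f η‖ * ‖fourierFun ψ (η - z.2)‖ := by
  have hπ : timeFreqShift z.1 z.2 ψ ∈ GSSpace d t s := IsGelfandShilov.timeFreqShift ht hs _ _ hψ
  have h1 := integral_conj_fourierFun_mul (integrable_of_mem ht hπ) (continuous_of_mem hf)
    (integrable_of_mem ht hf) (integrable_of_mem hs (fourierFun_mem ht hs hst hf))
  have h2 : vst ψ f z = ∫ x, (starRingEnd ℂ) (timeFreqShift z.1 z.2 ψ x) * f x := by
    unfold vst
    simp only [mul_comm]
  rw [h2, ← h1]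
  refine (norm_integral_le_integral_norm _).trans (le_of_eq ?_)
  congr 1
  ext η
  rw [norm_mul, RCLike.norm_conj, fourierFun_timeFreqShift, norm_mul, neg_mul, ← mul_neg, mul_comm,
    ← Complex.ofReal_neg, mul_comm Complex.I, Complex.norm_exp_ofReal_mul_I, one_mul]

/-- The short-time Fourier transform of a test function decays faster than every `exp(-R ρ)`. -/
lemma vst_decay {t s : ℝ} (ht : 0 < t) (hs : 0 < s) (hst : 1 < s + t) {ψ f : E d → ℂ}
    (hψ : ψ ∈ GSSpace d t s) (hf : f ∈ GSSpace d t s) {R : ℝ} (hR : 0 < R) :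
    ∃ C : ℝ, 0 ≤ C ∧ ∀ z, ‖vst ψ f z‖ ≤ C * Real.exp (-R * rho t s z) := by
  -- The rate is doubled because only the larger of ‖x‖^{1/t} and ‖ξ‖^{1/s} is used, and it is at
  -- least ρ/2.
  obtain ⟨C₁, hC₁, H₁⟩ := integral_mul_le_exp (p := 1 / t) (R := 2 * R) (by positivity) (by positivity)
    (fun r hr => exp_decay ht ⟨f, hf⟩ hr) (fun r hr => exp_decay ht ⟨ψ, hψ⟩ hr)
  obtain ⟨C₂, hC₂, H₂⟩ := integral_mul_le_exp (p := 1 / s) (R := 2 * R) (by positivity) (by positivity)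
    (fun r hr => exp_decay hs ⟨_, fourierFun_mem ht hs hst hf⟩ hr)
    (fun r hr => exp_decay hs ⟨_, fourierFun_mem ht hs hst hψ⟩ hr)
  refine ⟨C₁ + C₂, by positivity, fun z => ?_⟩
  have h1 := (norm_vst_le ψ f z).trans (H₁ z.1)
  have h2 := (norm_vst_le_fourier ht hs hst hψ hf z).trans (H₂ z.2)
  unfold rho
  rcases le_total (‖z.1‖ ^ (1 / t)) (‖z.2‖ ^ (1 / s)) with h | h
  · refine h2.trans (mul_le_mul (by linarith) (Real.exp_le_exp.2 ?_) (Real.exp_pos _).le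
      (by positivity))
    nlinarith
  · refine h1.trans (mul_le_mul (by linarith) (Real.exp_le_exp.2 ?_) (Real.exp_pos _).le
      (by positivity))
    nlinarith

/-- A shift of the function shifts its transform up to a phase. The integral bound for (u, π(z)φ)
thereby becomes a convolution in phase space. -/
lemma vst_timeFreqShift (ψ φ : E d → ℂ) (w z : E d × E d) :
    ‖vst ψ (timeFreqShift w.1 w.2 φ) z‖ = ‖vst ψ φ (z - w)‖ := by
  have h1 : vst ψ (timeFreqShift w.1 w.2 φ) z =
      Complex.exp (Complex.I * (inner ℝ w.1 (w.2 - z.2) : ℝ)) * vst ψ φ (z - w) := by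
    unfold vst timeFreqShift
    rw [← integral_const_mul, ← integral_add_right_eq_self _ w.1]
    congr 1
    ext y
    have e : y + w.1 - z.1 = y - (z - w).1 := by
      rw [Prod.fst_sub]; abel
    have e2 : (z - w).2 = z.2 - w.2 := rfl
    rw [add_sub_cancel_right, e, e2, map_mul, map_mul, ← Complex.exp_conj, ← Complex.exp_conj, map_mul,
      map_mul, Complex.conj_I, Complex.conj_ofReal, Complex.conj_ofReal]
    have e3 : Complex.exp (Complex.I * (inner ℝ (y + w.1) w.2 : ℝ)) *
        Complex.exp (-Complex.I * (inner ℝ (y + w.1) z.2 : ℝ)) =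
        Complex.exp (Complex.I * (inner ℝ w.1 (w.2 - z.2) : ℝ)) *
        Complex.exp (-Complex.I * (inner ℝ y (z.2 - w.2) : ℝ)) := by
      rw [← Complex.exp_add, ← Complex.exp_add, inner_add_left, inner_add_left, inner_sub_right,
        inner_sub_right]
      congr 1
      push_cast
      ring
    linear_combination (φ y * (starRingEnd ℂ) (ψ (y - (z - w).1))) * e3
  rw [h1, norm_mul, mul_comm Complex.I, Complex.norm_exp_ofReal_mul_I, one_mul]

/-! ### Reconstruction of test functions -/

lemma integrable_vst_mul {t s : ℝ} (ht : 0 < t) (hs : 0 < s) (hst : 1 < s + t) {ψ f : E d → ℂ}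
    (hψ : ψ ∈ GSSpace d t s) (hf : f ∈ GSSpace d t s) {C r : ℝ} (hr : 0 ≤ r) :
    Integrable fun z => ‖vst ψ f z‖ * (C * Real.exp (r * rho t s z)) := by
  obtain ⟨C', hC', H⟩ := vst_decay ht hs hst hψ hf (R := r + 1) (by positivity)
  refine ((integrable_exp_neg_rho (d := d) ht hs one_pos).const_mul (C' * |C|)).mono' ?_
    (Filter.Eventually.of_forall fun z => ?_)
  · exact ((continuous_vst ht hψ hf).norm.mul (continuous_const.mul (Real.continuous_exp.comp
      (continuous_const.mul (continuous_rho ht hs))))).aestronglyMeasurable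
  · rw [norm_mul, norm_norm, norm_mul, Real.norm_eq_abs C, Real.norm_of_nonneg (Real.exp_pos _).le]
    calc _ ≤ (C' * Real.exp (-(r + 1) * rho t s z)) * (|C| * Real.exp (r * rho t s z)) := by
          gcongr
          exact H z
      _ = C' * |C| * (Real.exp (-(r + 1) * rho t s z) * Real.exp (r * rho t s z)) := by ring
      _ = _ := by rw [← Real.exp_add]; congr 2; ring

lemma vst_eq_fourierFun (ψ f : E d → ℂ) (x ξ : E d) :
    (fc d : ℂ) * vst ψ f (x, ξ) = fourierFun (fun y => f y * (starRingEnd ℂ) (ψ (y - x))) ξ := by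
  unfold fourierFun vst timeFreqShift fc
  congr 2
  ext y
  rw [map_mul, ← Complex.exp_conj, map_mul, Complex.conj_I, Complex.conj_ofReal]
  ring

/-- The constant `(2π)^d ‖ψ‖²` in the reconstruction formula. -/
def recConst (ψ : E d → ℂ) : ℝ := (fc d * fc d)⁻¹ * ∫ x, ‖ψ x‖ ^ 2

lemma integrable_vst_slice {t s : ℝ} (ht : 0 < t) (hs : 0 < s) (hst : 1 < s + t) {ψ f : E d → ℂ}
    (hψ : ψ ∈ GSSpace d t s) (hf : f ∈ GSSpace d t s) (x : E d) :
    Integrable fun ξ => vst ψ f (x, ξ) := by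
  obtain ⟨C, hC, H⟩ := vst_decay ht hs hst hψ hf one_pos
  refine ((integrable_exp_neg_rpow (d := d) (p := 1 / s) (by positivity) one_pos).const_mul C).mono'
    ((continuous_vst ht hψ hf).comp (Continuous.prodMk_right x)).aestronglyMeasurable
    (Filter.Eventually.of_forall fun ξ => (H (x, ξ)).trans ?_)
  refine mul_le_mul_of_nonneg_left (Real.exp_le_exp.2 ?_) hC
  unfold rho
  have : 0 ≤ ‖x‖ ^ (1 / t) := by positivity
  simp only
  linarith

/-- For fixed x, `vst ψ f (x, ·)` is, up to a constant, the Fourier transform of f times the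
conjugate of ψ(· - x). Inversion in ξ gives a multiple of f(y)|ψ(y - x)|², and integration over x
gives ‖ψ‖² f(y). -/
lemma reconstruction {t s : ℝ} (ht : 0 < t) (hs : 0 < s) (hst : 1 < s + t) {ψ f : E d → ℂ}
    (hψ : ψ ∈ GSSpace d t s) (hf : f ∈ GSSpace d t s) (y : E d) :
    ∫ z, vst ψ f z * timeFreqShift z.1 z.2 ψ y = recConst ψ * f y := by
  obtain ⟨B, hB, hψB⟩ := exists_norm_le hψ
  have hfc := continuous_of_mem hf
  have hψc := continuous_of_mem hψ
  have hc0 : (fc d : ℂ) ≠ 0 := by exact_mod_cast (fc_pos d).ne'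
  have hint : Integrable fun z : E d × E d => vst ψ f z * timeFreqShift z.1 z.2 ψ y := by
    refine (integrable_vst_mul ht hs hst hψ hf (C := B) le_rfl).mono' ?_
      (Filter.Eventually.of_forall fun z => ?_)
    · refine ((continuous_vst ht hψ hf).mul ?_).aestronglyMeasurable
      unfold timeFreqShift
      fun_prop
    · rw [norm_mul, norm_timeFreqShift, zero_mul, Real.exp_zero, mul_one]
      gcongr
      exact hψB _
  rw [Measure.volume_eq_prod, integral_prod _ (by rwa [← Measure.volume_eq_prod])]
  have h1 : ∀ x, ∫ ξ, vst ψ f (x, ξ) * timeFreqShift x ξ ψ y =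
      ((fc d * fc d)⁻¹ : ℝ) * (f y * ((‖ψ (y - x)‖ ^ 2 : ℝ) : ℂ)) := by
    intro x
    set g : E d → ℂ := fun y => f y * (starRingEnd ℂ) (ψ (y - x)) with hg
    have hgc : Continuous g := by rw [hg]; fun_prop
    have hgi : Integrable g := by
      refine ((integrable_of_mem ht hf).norm.mul_const B).mono' hgc.aestronglyMeasurable
        (Filter.Eventually.of_forall fun y => ?_)
      rw [hg, norm_mul, RCLike.norm_conj]
      gcongr
      exact hψB _
    have h2 : ∀ ξ, fourierFun g ξ = (fc d : ℂ) * vst ψ f (x, ξ) :=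
      fun ξ => (vst_eq_fourierFun ψ f x ξ).symm
    have h3 : Integrable (fourierFun g) := by
      have : fourierFun g = fun ξ => (fc d : ℂ) * vst ψ f (x, ξ) := funext h2
      rw [this]
      exact (integrable_vst_slice ht hs hst hψ hf x).const_mul _
    have h4 := fourier_inversion hgc hgi h3 y
    have h5 : ∫ ξ, vst ψ f (x, ξ) * timeFreqShift x ξ ψ y = (fc d : ℂ)⁻¹ * ψ (y - x) *
        ∫ ξ, fourierFun g ξ * Complex.exp (Complex.I * (inner ℝ y ξ : ℝ)) := by
      rw [← integral_const_mul]
      congr 1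
      ext ξ
      rw [h2, timeFreqShift]
      field_simp
    have h6 : ψ (y - x) * (starRingEnd ℂ) (ψ (y - x)) = ((‖ψ (y - x)‖ ^ 2 : ℝ) : ℂ) := by
      rw [Complex.mul_conj, Complex.normSq_eq_norm_sq]
    rw [h5, ← h6]
    have h7 : f y * (starRingEnd ℂ) (ψ (y - x)) = g y := rfl
    rw [mul_left_comm (f y), h7, ← h4]
    push_cast
    field_simp
  simp only [h1]
  rw [integral_const_mul, integral_const_mul, recConst]
  have h8 : ∫ x, ((‖ψ (y - x)‖ ^ 2 : ℝ) : ℂ) = ((∫ x, ‖ψ x‖ ^ 2 : ℝ) : ℂ) := by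
    rw [integral_sub_left_eq_self (fun x => ((‖ψ x‖ ^ 2 : ℝ) : ℂ)) volume y]
    exact integral_ofReal
  rw [h8]
  push_cast
  ring

lemma recConst_pos {t s : ℝ} (ht : 0 < t) {ψ : E d → ℂ} (hψ : ψ ∈ GSSpace d t s) (h0 : ψ ≠ 0) :
    0 < recConst ψ := by
  obtain ⟨B, hB, hψB⟩ := exists_norm_le hψ
  obtain ⟨y, hy⟩ := Function.ne_iff.1 h0
  have hfc := fc_pos d
  refine mul_pos (by positivity) ?_
  have hc : Continuous fun x => ‖ψ x‖ ^ 2 := (continuous_of_mem hψ).norm.pow 2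
  refine integral_pos_of_integrable_nonneg_nonzero (x := y) hc ?_ (fun x => by positivity) ?_
  · refine ((integrable_of_mem ht hψ).norm.mul_const B).mono' hc.aestronglyMeasurable
      (Filter.Eventually.of_forall fun x => ?_)
    rw [Real.norm_of_nonneg (by positivity), sq]
    gcongr
    exact hψB x
  · exact pow_ne_zero _ (norm_ne_zero_iff.2 hy)

/-! ### Reconstruction of derivatives -/

lemma GSBound.norm_md_le {t s h B : ℝ} {f : Sm d} (hf : GSBound t s h B f) (β : Fin d → ℕ) (x : E d) :
    ‖(md β f).1 x‖ ≤ B * wt t s h 0 β := by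
  have := hf 0 β x
  rwa [mpow_zero, Complex.ofReal_one, one_mul] at this

lemma continuous_of_local_bound {V G : Type*} [SeminormedAddCommGroup V] [SeminormedAddCommGroup G]
    {F : V → G}
    (H : ∀ z₀, ∃ C : ℝ, 0 ≤ C ∧ ∀ z, ‖z - z₀‖ ≤ 1 → ‖F z - F z₀‖ ≤ C * ‖z - z₀‖) :
    Continuous F := by
  refine Metric.continuous_iff.2 fun z₀ ε hε => ?_
  obtain ⟨C, hC, hF⟩ := H z₀
  refine ⟨min 1 (ε / (C + 1)), by positivity, fun z hz => ?_⟩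
  rw [dist_eq_norm] at hz ⊢
  have h1 : ‖z - z₀‖ ≤ 1 := (hz.trans_le (min_le_left _ _)).le
  have h2 : ‖z - z₀‖ < ε / (C + 1) := hz.trans_le (min_le_right _ _)
  rw [lt_div_iff₀ (by positivity)] at h2
  refine (hF z h1).trans_lt ?_
  nlinarith [norm_nonneg (z - z₀)]

lemma continuous_md_tfs {t s : ℝ} (ht : 0 < t) (hs : 0 < s) (hst : 1 < s + t) {ψ : Sm d}
    (hψ : ψ.1 ∈ GSSpace d t s) (β : Fin d → ℕ) (y : E d) :
    Continuous fun z => (md β (tfs z ψ)).1 y := by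
  refine continuous_of_local_bound fun z₀ => ?_
  obtain ⟨C, hC, H⟩ := tfs_sub_bound ht hs hst one_pos hψ z₀
  have hW := wt_pos (d := d) (t := t) (s := s) one_pos 0 β
  refine ⟨C * wt t s 1 0 β, by positivity, fun z hz => ?_⟩
  have h1 := (H z hz).norm_md_le β y
  rw [map_sub] at h1
  refine h1.trans (le_of_eq ?_)
  ring

/-- The formula for β, known along the line y + a eᵢ, is differentiated in a under the integral. The
growth e^{rρ} of the derivatives of the shifts is dominated by the decay of `vst`. -/
lemma reconstruction_md {t s : ℝ} (ht : 0 < t) (hs : 0 < s) (hst : 1 < s + t) {ψ f : Sm d}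
    (hψ : ψ.1 ∈ GSSpace d t s) (hf : f.1 ∈ GSSpace d t s) (β : Fin d → ℕ) (y : E d) :
    ∫ z, vst ψ.1 f.1 z * (md β (tfs z ψ)).1 y = recConst ψ.1 * (md β f).1 y := by
  obtain ⟨C, r, hC, hr, H⟩ := tfs_bound ht hs hst one_pos hψ
  have hV := continuous_vst ht hψ hf
  have hbd : ∀ (β : Fin d → ℕ) (y : E d) z, ‖vst ψ.1 f.1 z * (md β (tfs z ψ)).1 y‖ ≤
      ‖vst ψ.1 f.1 z‖ * (C * wt t s 1 0 β * Real.exp (r * rho t s z)) := by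
    intro β y z
    rw [norm_mul]
    gcongr
    exact ((H z).norm_md_le β y).trans (le_of_eq (by ring))
  have hmeas : ∀ (β : Fin d → ℕ) (y : E d), AEStronglyMeasurable
      (fun z => vst ψ.1 f.1 z * (md β (tfs z ψ)).1 y) :=
    fun β y => (hV.mul (continuous_md_tfs ht hs hst hψ β y)).aestronglyMeasurable
  have hbint : ∀ β : Fin d → ℕ, Integrable fun z =>
      ‖vst ψ.1 f.1 z‖ * (C * wt t s 1 0 β * Real.exp (r * rho t s z)) :=
    fun β => integrable_vst_mul ht hs hst hψ hf hr
  induction β using multiindex_induction generalizing y with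
  | h0 =>
    simp only [md_zero]
    exact reconstruction ht hs hst hψ hf y
  | hs β i ih =>
    set e : E d := EuclideanSpace.single i 1 with he
    have hder : ∀ (g : Sm d) (a : ℝ), HasDerivAt (fun a : ℝ => (md β g).1 (y + a • e))
        ((md (β + Pi.single i 1) g).1 (y + a • e)) a := by
      intro g a
      have hg : ContDiff ℝ ∞ (md β g).1 := (md β g).2
      have h1 : HasDerivAt (fun a : ℝ => y + a • e) e a := by
        simpa using ((hasDerivAt_id a).smul_const e).const_add y
      have h2 := ((hg.differentiable (by simp)) (y + a • e)).hasFDerivAt.comp_hasDerivAt a h1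
      rw [md_add_single]
      exact h2
    let F : ℝ → E d × E d → ℂ := fun a z => vst ψ.1 f.1 z * (md β (tfs z ψ)).1 (y + a • e)
    let F' : ℝ → E d × E d → ℂ := fun a z =>
      vst ψ.1 f.1 z * (md (β + Pi.single i 1) (tfs z ψ)).1 (y + a • e)
    have i1 : ∀ a, AEStronglyMeasurable (F a) := fun a => hmeas β _
    have i2 : Integrable (F 0) :=
      (hbint β).mono' (i1 0) (Filter.Eventually.of_forall fun z => hbd β _ z)
    have i3 : AEStronglyMeasurable (F' 0) := hmeas _ _
    have i4 : ∀ z, ∀ a ∈ (Set.univ : Set ℝ), ‖F' a z‖ ≤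
        ‖vst ψ.1 f.1 z‖ * (C * wt t s 1 0 (β + Pi.single i 1) * Real.exp (r * rho t s z)) :=
      fun z a _ => hbd _ _ z
    have i5 : ∀ z, ∀ a ∈ (Set.univ : Set ℝ), HasDerivAt (fun a => F a z) (F' a z) a :=
      fun z a _ => (hder (tfs z ψ) a).const_mul (vst ψ.1 f.1 z)
    have h3 : HasDerivAt (fun a => ∫ z, F a z) (∫ z, F' 0 z) 0 :=
      (hasDerivAt_integral_of_dominated_loc_of_deriv_le (μ := volume) Filter.univ_mem
        (Filter.Eventually.of_forall i1) i2 i3 (Filter.Eventually.of_forall i4) (hbint _)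
        (Filter.Eventually.of_forall i5)).2
    have h4 : ∀ a, ∫ z, F a z = recConst ψ.1 * (md β f).1 (y + a • e) := fun a => ih _
    simp only [h4] at h3
    have h5 := h3.unique ((hder f 0).const_mul (recConst ψ.1 : ℂ))
    simpa only [F', zero_smul, add_zero] using h5

/-! ### Ultradistributions and reconstruction -/

/-- The index set of the conditions defining the norms. -/
abbrev Idx (d : ℕ) : Type := (Fin d → ℕ) × (Fin d → ℕ) × E d

/-- The values `x ^ α D ^ β f(x) / (h ^ |α + β| α! ^ t β! ^ s)`, as a bounded family. -/
def toLp (t s : ℝ) {h : ℝ} (hh : 0 < h) : GSSpace d t s →ₗ[ℂ] lp (fun _ : Idx d => ℂ) ∞ where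
  toFun f := ⟨fun i => (mpow i.1 i.2.2 : ℂ) * (md i.2.1 (toSm f)).1 i.2.2 / wt t s h i.1 i.2.1, by
    obtain ⟨B, hB, hf⟩ := exists_gsBound f hh
    refine memℓp_infty ⟨B, ?_⟩
    rintro _ ⟨i, rfl⟩
    have hW := wt_pos (t := t) (s := s) hh i.1 i.2.1
    simp only
    rw [norm_div, Complex.norm_real, Real.norm_of_nonneg hW.le, div_le_iff₀ hW]
    exact hf _ _ _⟩
  map_add' f g := by
    ext i
    have : toSm (f + g) = toSm f + toSm g := rfl
    simp only [this, map_add]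
    change _ * ((md i.2.1 (toSm f)).1 i.2.2 + (md i.2.1 (toSm g)).1 i.2.2) / _ = _ / _ + _ / _
    ring
  map_smul' c f := by
    ext i
    have : toSm (c • f) = c • toSm f := rfl
    simp only [this, map_smul]
    change _ * (c * (md i.2.1 (toSm f)).1 i.2.2) / _ = c * (_ / _)
    ring

lemma toLp_apply {t s h : ℝ} (hh : 0 < h) (f : GSSpace d t s) (i : Idx d) :
    toLp t s hh f i =
      (mpow i.1 i.2.2 : ℂ) * (md i.2.1 (toSm f)).1 i.2.2 / wt t s h i.1 i.2.1 := rfl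

lemma GSBound.norm_toLp_le {t s h B : ℝ} (hh : 0 < h) (hB : 0 ≤ B) {f : GSSpace d t s}
    (hf : GSBound t s h B (toSm f)) : ‖toLp t s hh f‖ ≤ B := by
  refine lp.norm_le_of_forall_le hB fun i => ?_
  have hW := wt_pos (t := t) (s := s) hh i.1 i.2.1
  rw [toLp_apply, norm_div, Complex.norm_real, Real.norm_of_nonneg hW.le, div_le_iff₀ hW]
  exact hf _ _ _

lemma gsBound_norm_toLp {t s h : ℝ} (hh : 0 < h) (f : GSSpace d t s) :
    GSBound t s h ‖toLp t s hh f‖ (toSm f) := by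
  intro α β x
  have hW := wt_pos (t := t) (s := s) hh α β
  have h1 := lp.norm_apply_le_norm ENNReal.top_ne_zero (toLp t s hh f) (α, β, x)
  rwa [toLp_apply, norm_div, Complex.norm_real, Real.norm_of_nonneg hW.le, div_le_iff₀ hW] at h1

lemma toLp_injective {t s h : ℝ} (hh : 0 < h) : Function.Injective (toLp (d := d) t s hh) := by
  rw [← LinearMap.ker_eq_bot, LinearMap.ker_eq_bot']
  intro f hf
  have h1 := gsBound_norm_toLp hh f
  rw [hf, norm_zero] at h1
  ext x
  exact norm_le_zero_iff.1 (h1.norm_le x)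

/-- The conjugate of u is complex linear and bounded for one of the norms, that is, for the norm
induced from ℓ^∞ through `toLp`. By Hahn–Banach it extends to that Banach space, where it commutes
with Bochner integrals. -/
lemma GSDual.exists_extension {t s : ℝ} (u : GSDual d t s) : ∃ (h : ℝ) (hh : 0 < h)
    (L : lp (fun _ : Idx d => ℂ) ∞ →L[ℂ] ℂ),
      ∀ f, L (toLp t s hh f) = (starRingEnd ℂ) (u.pair f) := by
  obtain ⟨h, C, hh, hC, H⟩ := u.exists_bound
  let c : GSSpace d t s →ₗ[ℂ] ℂ :=
    { toFun := fun f => (starRingEnd ℂ) (u.pair f)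
      map_add' := fun f g => by simp [GSDual.pair]
      map_smul' := fun a f => by simp [GSDual.pair] }
  let e := LinearEquiv.ofInjective (toLp t s hh) (toLp_injective (d := d) hh)
  let g : LinearMap.range (toLp (d := d) t s hh) →L[ℂ] ℂ :=
    (c.comp e.symm.toLinearMap).mkContinuous C fun v => by
      obtain ⟨f, rfl⟩ := e.surjective v
      have h1 := H f _ (norm_nonneg _) (gsBound_norm_toLp hh f)
      rw [LinearMap.comp_apply, LinearEquiv.coe_coe, LinearEquiv.symm_apply_apply]
      change ‖(starRingEnd ℂ) (u.pair f)‖ ≤ _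
      rw [RCLike.norm_conj]
      exact h1
  obtain ⟨L, hL, -⟩ := exists_extension_norm_eq _ g
  refine ⟨h, hh, L, fun f => ?_⟩
  have h2 := hL (e f)
  have h3 : g (e f) = c f := by
    change c (e.symm (e f)) = c f
    rw [LinearEquiv.symm_apply_apply]
  rw [h3] at h2
  exact h2

/-- The time-frequency shift of a test function. -/
def tfsGS {t s : ℝ} (ht : 0 < t) (hs : 0 < s) (z : E d × E d) (ψ : GSSpace d t s) : GSSpace d t s :=
  ⟨timeFreqShift z.1 z.2 (ψ : E d → ℂ), IsGelfandShilov.timeFreqShift ht hs z.1 z.2 ψ.2⟩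

lemma toSm_tfsGS {t s : ℝ} (ht : 0 < t) (hs : 0 < s) (z : E d × E d) (ψ : GSSpace d t s) :
    toSm (tfsGS ht hs z ψ) = tfs z (toSm ψ) := rfl

lemma GSDual.exists_bound_tfs {t s : ℝ} (ht : 0 < t) (hs : 0 < s) (hst : 1 < s + t)
    (u : GSDual d t s) (ψ : GSSpace d t s) : ∃ C r : ℝ, 0 ≤ C ∧ 0 ≤ r ∧
      ∀ z, ‖u.pair (tfsGS ht hs z ψ)‖ ≤ C * Real.exp (r * rho t s z) := by
  obtain ⟨h, C, hh, hC, H⟩ := u.exists_bound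
  obtain ⟨C', r, hC', hr, H'⟩ := tfs_bound ht hs hst hh (f := toSm ψ) ψ.2
  refine ⟨C * C', r, by positivity, hr, fun z => ?_⟩
  rw [mul_assoc]
  exact H _ _ (by positivity) (H' z)

/-- An ultradistribution is determined by its short-time Fourier transform. -/
lemma GSDual.norm_pair_le_integral {t s : ℝ} (ht : 0 < t) (hs : 0 < s) (hst : 1 < s + t)
    (u : GSDual d t s) (ψ f : GSSpace d t s) :
    recConst ψ.1 * ‖u.pair f‖ ≤ ∫ z, ‖vst ψ.1 f.1 z‖ * ‖u.pair (tfsGS ht hs z ψ)‖ := by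
  obtain ⟨h, hh, L, hL⟩ := u.exists_extension
  obtain ⟨C, r, hC, hr, H⟩ := tfs_bound ht hs hst hh (f := toSm ψ) ψ.2
  set F : E d × E d → lp (fun _ : Idx d => ℂ) ∞ :=
    fun z => vst ψ.1 f.1 z • toLp t s hh (tfsGS ht hs z ψ) with hF
  have hcont : Continuous fun z => toLp t s hh (tfsGS ht hs z ψ) := by
    refine continuous_of_local_bound fun z₀ => ?_
    obtain ⟨C, hC, H⟩ := tfs_sub_bound ht hs hst hh (f := toSm ψ) ψ.2 z₀
    refine ⟨C, hC, fun z hz => ?_⟩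
    rw [← map_sub]
    exact GSBound.norm_toLp_le hh (by positivity) (H z hz)
  have hint : Integrable F := by
    refine (integrable_vst_mul ht hs hst ψ.2 f.2 (C := C) hr).mono'
      ((continuous_vst ht ψ.2 f.2).smul hcont).aestronglyMeasurable
      (Filter.Eventually.of_forall fun z => ?_)
    rw [hF, norm_smul]
    gcongr
    exact GSBound.norm_toLp_le hh (by positivity) (H z)
  -- An equality in ℓ^∞ can be tested on coordinates. Evaluation at an index is continuous, so it
  -- passes under the integral and leaves the reconstruction of one derivative at one point.
  have hval : ∫ z, F z = (recConst ψ.1 : ℂ) • toLp t s hh f := by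
    ext i
    let ev : lp (fun _ : Idx d => ℂ) ∞ →L[ℂ] ℂ :=
      LinearMap.mkContinuous
        { toFun := fun v => v i
          map_add' := fun _ _ => rfl
          map_smul' := fun _ _ => rfl } 1 fun v => by
            rw [one_mul]
            exact lp.norm_apply_le_norm ENNReal.top_ne_zero v i
    have h1 := ev.integral_comp_comm hint
    have h2 : ∀ z, ev (F z) = (mpow i.1 i.2.2 : ℂ) / wt t s h i.1 i.2.1 *
        (vst ψ.1 f.1 z * (md i.2.1 (tfs z (toSm ψ))).1 i.2.2) := by
      intro z
      change vst ψ.1 f.1 z * toLp t s hh (tfsGS ht hs z ψ) i = _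
      rw [toLp_apply, toSm_tfsGS]
      ring
    simp only [h2] at h1
    have h4 := reconstruction_md ht hs hst (ψ := toSm ψ) (f := toSm f) ψ.2 f.2 i.2.1 i.2.2
    simp only [coe_toSm] at h4
    rw [integral_const_mul, h4] at h1
    change ev (∫ z, F z) = recConst ψ.1 * toLp t s hh f i
    rw [← h1, toLp_apply]
    ring
  have h5 := L.integral_comp_comm hint
  rw [hval, map_smul, hL] at h5
  have h6 : ∀ z, ‖L (F z)‖ = ‖vst ψ.1 f.1 z‖ * ‖u.pair (tfsGS ht hs z ψ)‖ := by
    intro z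
    rw [hF, map_smul, hL, norm_smul, RCLike.norm_conj]
  have h7 : 0 ≤ recConst ψ.1 := by
    unfold recConst
    have := fc_pos d
    have : 0 ≤ ∫ x, ‖ψ.1 x‖ ^ 2 := integral_nonneg fun x => by positivity
    positivity
  calc recConst ψ.1 * ‖u.pair f‖ = ‖∫ z, L (F z)‖ := by
        rw [h5, norm_smul, RCLike.norm_conj, Complex.norm_real, Real.norm_of_nonneg h7]
    _ ≤ ∫ z, ‖L (F z)‖ := norm_integral_le_integral_norm _
    _ = _ := by simp only [h6]

/-! ### Independence of the window -/

/-- The dilation `(x, ξ) ↦ (l ^ t x, l ^ s ξ)`. -/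
def dil (t s l : ℝ) (p : E d × E d) : E d × E d := (l ^ t • p.1, l ^ s • p.2)

lemma norm_stft {t s : ℝ} (ht : 0 < t) (hs : 0 < s) (ψ : GSSpace d t s) (u : GSDual d t s)
    (z : E d × E d) : ‖stft ht hs ψ u z.1 z.2‖ = fc d * ‖u.pair (tfsGS ht hs z ψ)‖ := by
  change ‖((fc d : ℝ) : ℂ) * u.pair (tfsGS ht hs z ψ)‖ = _
  rw [norm_mul, Complex.norm_real, Real.norm_of_nonneg (fc_pos d).le]

lemma rho_dil {t s l : ℝ} (ht : 0 < t) (hs : 0 < s) (hl : 0 ≤ l) (p : E d × E d) :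
    rho t s (dil t s l p) = l * rho t s p := rho_dilate ht hs hl p.1 p.2

lemma dil_sub (t s l : ℝ) (p q : E d × E d) : dil t s l (p - q) = dil t s l p - dil t s l q := by
  unfold dil
  rw [Prod.fst_sub, Prod.snd_sub, smul_sub, smul_sub]
  rfl

lemma exists_dil_eq {l : ℝ} (hl : 0 < l) (t s : ℝ) (w : E d × E d) : ∃ q, dil t s l q = w := by
  refine ⟨((l ^ t)⁻¹ • w.1, (l ^ s)⁻¹ • w.2), ?_⟩
  unfold dil
  rw [smul_inv_smul₀ (Real.rpow_pos_of_pos hl t).ne', smul_inv_smul₀ (Real.rpow_pos_of_pos hl s).ne']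

lemma rho_le_of_norm_le {t s M : ℝ} (ht : 0 < t) (hs : 0 < s) {p : E d × E d} (hp : ‖p‖ ≤ M) :
    rho t s p ≤ M ^ (1 / t) + M ^ (1 / s) := by
  have h1 := (norm_fst_le p).trans hp
  have h2 := (norm_snd_le p).trans hp
  unfold rho
  gcongr

lemma le_rho_of_le_norm {t s ε : ℝ} (ht : 0 < t) (hs : 0 < s) (hε : 0 ≤ ε) {p : E d × E d}
    (hp : ε ≤ ‖p‖) : min (ε ^ (1 / t)) (ε ^ (1 / s)) ≤ rho t s p := by
  rw [Prod.norm_def] at hp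
  unfold rho
  rcases le_max_iff.1 hp with h | h
  · refine (min_le_left _ _).trans ((Real.rpow_le_rpow hε h (by positivity)).trans ?_)
    exact le_add_of_nonneg_right (by positivity)
  · refine (min_le_right _ _).trans ((Real.rpow_le_rpow hε h (by positivity)).trans ?_)
    exact le_add_of_nonneg_left (by positivity)

/-- Decay for ψ near z is transferred to φ by the convolution estimate over w = `dil t s l q`, split
according to whether q is within ε of p. -/
lemma waveFrontSet_subset {t s : ℝ} (ht : 0 < t) (hs : 0 < s) (hst : 1 < s + t) (u : GSDual d t s)
    {ψ : GSSpace d t s} (hψ : ψ ≠ 0) (φ : GSSpace d t s) :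
    waveFrontSet ht hs φ u ⊆ waveFrontSet ht hs ψ u := by
  rintro z ⟨hz0, hz⟩
  refine ⟨hz0, fun ⟨U, hU, hU0, hzU, HU⟩ => hz ?_⟩
  obtain ⟨ε', hε', hball⟩ := Metric.isOpen_iff.1 hU z hzU
  -- Half the radius: if p is within ε of z and q within ε of p, then q still lies in U.
  set ε := ε' / 2 with hε
  have hε0 : 0 < ε := half_pos hε'
  have hsub : Metric.ball z ε ⊆ U := (Metric.ball_subset_ball (by linarith)).trans hball
  refine ⟨Metric.ball z ε, Metric.isOpen_ball, hsub.trans hU0, Metric.mem_ball_self hε0, fun r hr => ?_⟩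
  obtain ⟨K, hK, HK⟩ := rho_add_le (d := d) ht hs
  obtain ⟨Cu, r₀, hCu, hr₀, Hu⟩ := u.exists_bound_tfs ht hs hst ψ
  obtain ⟨C₁, HC₁⟩ := HU r hr
  set M := (‖z‖ + ε) ^ (1 / t) + (‖z‖ + ε) ^ (1 / s) with hM
  have hM0 : 0 ≤ M := by positivity
  set c := min (ε ^ (1 / t)) (ε ^ (1 / s)) with hc
  have hc0 : 0 < c := by positivity
  -- With ρ = ρ(w - z), 1 leaves an integrable e^{-ρ}, and r₀K cancels the part of the growth
  -- e^{r₀K(ρ + λM)} that depends on ρ. As ρ ≥ cλ for the far points, the last term pays for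
  -- e^{r₀KMλ} and still yields e^{-rλ}.
  set R := 1 + r₀ * K + (r₀ * K * M + r) / c with hR
  have hR1 : 1 ≤ R := by
    have : 0 ≤ r₀ * K + (r₀ * K * M + r) / c := by positivity
    linarith
  obtain ⟨C₂, hC₂, HC₂⟩ := vst_decay ht hs hst ψ.2 φ.2 (R := R) (by linarith)
  have hfc := fc_pos d
  have hrec := recConst_pos ht ψ.2 fun h => hψ (Subtype.ext h)
  have hC₁0 : 0 ≤ C₁ := le_trans (by positivity) (HC₁ 1 one_pos z hzU)
  set C₃ := C₂ * (C₁ / fc d + Cu) with hC₃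
  have hC₃0 : 0 ≤ C₃ := by positivity
  have key : ∀ l : ℝ, 0 < l → ∀ p ∈ Metric.ball z ε, ∀ w,
      ‖vst ψ.1 φ.1 (w - dil t s l p)‖ * ‖u.pair (tfsGS ht hs w ψ)‖ ≤
        Real.exp (-(r * l)) * C₃ * Real.exp (-1 * rho t s (w - dil t s l p)) := by
    intro l hl p hp w
    obtain ⟨q, rfl⟩ := exists_dil_eq hl t s w
    have hV := HC₂ (dil t s l q - dil t s l p)
    set ρ := rho t s (dil t s l q - dil t s l p) with hρ
    have hρ0 : 0 ≤ ρ := rho_nonneg _ _ _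
    by_cases hq : ‖q - p‖ < ε
    · have hqU : q ∈ U := by
        refine hball ?_
        rw [Metric.mem_ball, dist_eq_norm] at hp ⊢
        calc ‖q - z‖ = ‖(q - p) + (p - z)‖ := by rw [sub_add_sub_cancel]
          _ ≤ ‖q - p‖ + ‖p - z‖ := norm_add_le _ _
          _ < ε' := by linarith
      have h1 := HC₁ l hl q hqU
      have h2 := norm_stft ht hs ψ u (dil t s l q)
      change Real.exp (r * l) * ‖stft ht hs ψ u (dil t s l q).1 (dil t s l q).2‖ ≤ C₁ at h1
      rw [h2] at h1
      have h3 : ‖u.pair (tfsGS ht hs (dil t s l q) ψ)‖ ≤ Real.exp (-(r * l)) * (C₁ / fc d) := by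
        rw [Real.exp_neg, ← div_eq_inv_mul, div_div, le_div_iff₀ (by positivity)]
        linarith
      calc _ ≤ (C₂ * Real.exp (-R * ρ)) * (Real.exp (-(r * l)) * (C₁ / fc d)) := by gcongr
        _ ≤ (C₂ * Real.exp (-1 * ρ)) * (Real.exp (-(r * l)) * (C₁ / fc d + Cu)) := by
          gcongr
          linarith
        _ = _ := by rw [hC₃]; ring
    · have h1 : l * c ≤ ρ := by
        rw [hρ, ← dil_sub, rho_dil ht hs hl.le]
        gcongr
        exact le_rho_of_le_norm ht hs hε0.le (not_lt.1 hq)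
      have h2 : rho t s p ≤ M := by
        refine rho_le_of_norm_le ht hs ?_
        rw [Metric.mem_ball, dist_eq_norm] at hp
        have := norm_add_le (p - z) z
        rw [sub_add_cancel] at this
        linarith
      have h3 : rho t s (dil t s l q) ≤ K * (ρ + l * M) := by
        have h4 := HK (dil t s l q - dil t s l p) (dil t s l p)
        rw [sub_add_cancel, rho_dil ht hs hl.le p] at h4
        refine h4.trans ?_
        gcongr
      have h5 : -R * ρ + r₀ * rho t s (dil t s l q) ≤ -(r * l) + -1 * ρ := by
        have h6 : r₀ * rho t s (dil t s l q) ≤ r₀ * (K * (ρ + l * M)) := by gcongr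
        have h7 : (r₀ * K * M + r) * l ≤ (r₀ * K * M + r) / c * ρ := by
          rw [div_mul_eq_mul_div, le_div_iff₀ hc0, mul_assoc]
          gcongr
        rw [hR]
        nlinarith
      calc _ ≤ (C₂ * Real.exp (-R * ρ)) * (Cu * Real.exp (r₀ * rho t s (dil t s l q))) := by
            gcongr
            exact Hu _
        _ = C₂ * Cu * Real.exp (-R * ρ + r₀ * rho t s (dil t s l q)) := by rw [Real.exp_add]; ring
        _ ≤ C₂ * Cu * Real.exp (-(r * l) + -1 * ρ) := by gcongr
        _ ≤ C₃ * Real.exp (-(r * l) + -1 * ρ) := by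
            gcongr
            rw [hC₃]
            gcongr
            exact le_add_of_nonneg_left (by positivity)
        _ = _ := by rw [Real.exp_add]; ring
  set I := ∫ w : E d × E d, Real.exp (-1 * rho t s w) with hI
  refine ⟨fc d * (C₃ * I / recConst ψ.1), fun l hl p hp => ?_⟩
  have h1 := u.norm_pair_le_integral ht hs hst ψ (tfsGS ht hs (dil t s l p) φ)
  have h2 : ∀ w, ‖vst ψ.1 (tfsGS ht hs (dil t s l p) φ).1 w‖ = ‖vst ψ.1 φ.1 (w - dil t s l p)‖ :=
    fun w => vst_timeFreqShift ψ.1 φ.1 (dil t s l p) w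
  simp only [h2] at h1
  have : (volume : Measure (E d × E d)).IsAddRightInvariant := by
    rw [Measure.volume_eq_prod]
    infer_instance
  have hint : Integrable fun w : E d × E d => Real.exp (-1 * rho t s (w - dil t s l p)) :=
    (integrable_exp_neg_rho (d := d) ht hs one_pos).comp_sub_right _
  have h3 := integral_mono_of_nonneg
    (Filter.Eventually.of_forall fun w => mul_nonneg (norm_nonneg (vst ψ.1 φ.1 (w - dil t s l p)))
      (norm_nonneg (u.pair (tfsGS ht hs w ψ))))
    (hint.const_mul (Real.exp (-(r * l)) * C₃)) (Filter.Eventually.of_forall (key l hl p hp))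
  rw [integral_const_mul,
    integral_sub_right_eq_self (fun w : E d × E d => Real.exp (-1 * rho t s w)), ← hI] at h3
  have h4 := h1.trans h3
  change Real.exp (r * l) * ‖stft ht hs φ u (dil t s l p).1 (dil t s l p).2‖ ≤ _
  rw [norm_stft]
  have h5 : Real.exp (r * l) * ‖u.pair (tfsGS ht hs (dil t s l p) φ)‖ ≤ C₃ * I / recConst ψ.1 := by
    rw [le_div_iff₀ hrec]
    rw [Real.exp_neg, mul_assoc, ← div_eq_inv_mul, le_div_iff₀ (Real.exp_pos _)] at h4
    linarith
  calc _ = fc d * (Real.exp (r * l) * ‖u.pair (tfsGS ht hs (dil t s l p) φ)‖) := by ring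
    _ ≤ _ := by gcongr

/-- The wave front set does not depend on the window. -/
lemma waveFrontSet_eq {t s : ℝ} (ht : 0 < t) (hs : 0 < s) (hst : 1 < s + t) (u : GSDual d t s)
    {ψ φ : GSSpace d t s} (hψ : ψ ≠ 0) (hφ : φ ≠ 0) :
    waveFrontSet ht hs φ u = waveFrontSet ht hs ψ u :=
  (waveFrontSet_subset ht hs hst u hψ φ).antisymm (waveFrontSet_subset ht hs hst u hφ ψ)

/-! ### Transport of wave front sets -/

/-- A good neighbourhood U of Θ p pulls back to the good neighbourhood Θ⁻¹(U) of p, with the same λ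
and r; only the constant is multiplied by k. -/
lemma mem_waveFrontSet_of_le {t s t' s' : ℝ} (ht : 0 < t) (hs : 0 < s) (ht' : 0 < t') (hs' : 0 < s')
    {u : GSDual d t s} {ψ : GSSpace d t s} {v : GSDual d t' s'} {φ : GSSpace d t' s'}
    {Θ : E d × E d → E d × E d} (hΘ : Continuous Θ) (hΘ0 : ∀ p, Θ p = 0 ↔ p = 0) {k : ℝ} (hk : 0 ≤ k)
    (H : ∀ l : ℝ, 0 < l → ∀ p, ‖v.pair (tfsGS ht' hs' (dil t' s' l p) φ)‖ ≤
      k * ‖u.pair (tfsGS ht hs (dil t s l (Θ p)) ψ)‖) {p : E d × E d}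
    (hp : p ∈ waveFrontSet ht' hs' φ v) : Θ p ∈ waveFrontSet ht hs ψ u := by
  obtain ⟨hp0, hp⟩ := hp
  refine ⟨fun h => hp0 ((hΘ0 p).1 h), fun ⟨U, hU, hU0, hpU, HU⟩ => hp ?_⟩
  refine ⟨Θ ⁻¹' U, hU.preimage hΘ, fun q hq hq0 => hU0 hq ((hΘ0 q).2 hq0), hpU, fun r hr => ?_⟩
  obtain ⟨C, HC⟩ := HU r hr
  refine ⟨k * C, fun l hl q hq => ?_⟩
  have h1 := HC l hl (Θ q) hq
  have hfc := fc_pos d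
  change Real.exp (r * l) * ‖stft ht' hs' φ v (dil t' s' l q).1 (dil t' s' l q).2‖ ≤ _
  change Real.exp (r * l) * ‖stft ht hs ψ u (dil t s l (Θ q)).1 (dil t s l (Θ q)).2‖ ≤ _ at h1
  rw [norm_stft] at h1 ⊢
  calc _ ≤ Real.exp (r * l) * (fc d * (k * ‖u.pair (tfsGS ht hs (dil t s l (Θ q)) ψ)‖)) := by
        gcongr
        exact H l hl q
    _ = k * (Real.exp (r * l) * (fc d * ‖u.pair (tfsGS ht hs (dil t s l (Θ q)) ψ)‖)) := by ring
    _ ≤ _ := by gcongr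

lemma waveFrontSet_eq_image {t s t' s' : ℝ} (ht : 0 < t) (hs : 0 < s) (ht' : 0 < t') (hs' : 0 < s')
    {u : GSDual d t s} {ψ : GSSpace d t s} {v : GSDual d t' s'} {φ : GSSpace d t' s'}
    {Θ Θ' : E d × E d → E d × E d} (hΘ : Continuous Θ) (hΘ' : Continuous Θ')
    (h1 : ∀ p, Θ (Θ' p) = p) (h2 : ∀ p, Θ' (Θ p) = p) (h0 : Θ 0 = 0) {k : ℝ} (hk : 0 < k)
    (H : ∀ l : ℝ, 0 < l → ∀ p, ‖v.pair (tfsGS ht' hs' (dil t' s' l (Θ p)) φ)‖ =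
      k * ‖u.pair (tfsGS ht hs (dil t s l p) ψ)‖) :
    waveFrontSet ht' hs' φ v = Θ '' waveFrontSet ht hs ψ u := by
  have h0' : Θ' 0 = 0 := by rw [← h0, h2, h0]
  ext p
  constructor
  · intro hp
    refine ⟨Θ' p, mem_waveFrontSet_of_le ht hs ht' hs' hΘ' (fun q => ⟨fun h => ?_, fun h => ?_⟩)
      hk.le (fun l hl q => ?_) hp, h1 p⟩
    · rw [← h1 q, h, h0]
    · rw [h, h0']
    · rw [← H l hl, h1]
  · rintro ⟨q, hq, rfl⟩
    refine mem_waveFrontSet_of_le ht' hs' ht hs hΘ (fun q => ⟨fun h => ?_, fun h => ?_⟩)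
      (inv_nonneg.2 hk.le) (fun l hl q => ?_) hq
    · rw [← h2 q, h, h0']
    · rw [h, h0]
    · rw [H l hl, inv_mul_cancel_left₀ hk.ne']

/-! ### Fourier transform of ultradistributions -/

lemma fourierInv_mem {t s : ℝ} (ht : 0 < t) (hs : 0 < s) (hst : 1 < s + t) {g : E d → ℂ}
    (hg : g ∈ GSSpace d s t) : (fun x => fourierFun g (-x)) ∈ GSSpace d t s :=
  compLin_mem ht hs (reflL d) (reflL d) reflL_reflL (fourierFun_mem hs ht (by rwa [add_comm]) hg)

/-- The inverse Fourier transform from `Σ_s^t` to `Σ_t^s`. -/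
def fourierInvGS {t s : ℝ} (ht : 0 < t) (hs : 0 < s) (hst : 1 < s + t) :
    GSSpace d s t →ₗ[ℂ] GSSpace d t s where
  toFun g := ⟨fun x => fourierFun (g : E d → ℂ) (-x), fourierInv_mem ht hs hst g.2⟩
  map_add' f g := by
    ext x
    exact fourierFun_add (integrable_of_mem hs f.2) (integrable_of_mem hs g.2) (-x)
  map_smul' c f := by
    ext x
    exact fourierFun_smul c f.1 (-x)

lemma GSBound.fourierInvGS {t s : ℝ} (ht : 0 < t) (hs : 0 < s) (hst : 1 < s + t) {h : ℝ}
    (hh : 0 < h) : ∃ h' K : ℝ, 0 < h' ∧ 0 ≤ K ∧ ∀ (g : GSSpace d s t) (B : ℝ), 0 ≤ B →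
      GSBound s t h' B (toSm g) →
        GSBound t s h (K * B) (toSm (GelfandShilov.fourierInvGS ht hs hst g)) := by
  obtain ⟨h₁, hh₁, H₁⟩ := GSBound.compLin (d := d) ht hs (reflL d) (reflL d) reflL_reflL hh
  obtain ⟨h₂, K₂, hh₂, hK₂, H₂⟩ := GSBound.fourier (d := d) hs ht (by rwa [add_comm]) hh₁
  refine ⟨h₂, K₂, hh₂, hK₂, fun g B hB hg => ?_⟩
  have e : toSm (GelfandShilov.fourierInvGS ht hs hst g) =
      GelfandShilov.compLin (reflL d) (fourierSm hs (toSm g) g.2) := rfl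
  rw [e]
  exact H₁ _ _ (by positivity) (H₂ (toSm g) g.2 B hB hg)

lemma fourierFun_fourierInvGS {t s : ℝ} (ht : 0 < t) (hs : 0 < s) (hst : 1 < s + t)
    (g : GSSpace d s t) : fourierFun (fourierInvGS ht hs hst g : E d → ℂ) = g := by
  ext ξ
  change fourierFun (fun x => fourierFun g.1 (-x)) ξ = g.1 ξ
  rw [fourierFun_comp_neg]
  exact fourierFun_fourierFun hs ht (by rwa [add_comm]) g.2 ξ

lemma fourierInvGS_fourierFun {t s : ℝ} (ht : 0 < t) (hs : 0 < s) (hst : 1 < s + t)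
    (φ : GSSpace d t s) (h : fourierFun (φ : E d → ℂ) ∈ GSSpace d s t) :
    fourierInvGS ht hs hst ⟨fourierFun (φ : E d → ℂ), h⟩ = φ := by
  ext x
  exact fourierFun_fourierFun ht hs hst φ.2 x

lemma GSDual.ext_pair {t s : ℝ} {u v : GSDual d t s} (h : ∀ φ, u.pair φ = v.pair φ) : u = v :=
  Subtype.ext (LinearMap.ext h)

lemma GSDual.exists_pair_eq {t s : ℝ} (L : GSSpace d t s →ₗ⋆[ℂ] ℂ)
    (H : ∃ h C : ℝ, 0 < h ∧ 0 ≤ C ∧ ∀ (f : GSSpace d t s) (B : ℝ), 0 ≤ B →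
      GSBound t s h B (toSm f) → ‖L f‖ ≤ C * B) : ∃ v : GSDual d t s, ∀ f, v.pair f = L f :=
  ⟨GSDual.ofBound L H, fun _ => rfl⟩

/-- Every g in Σ_s^t is the transform of its inverse transform, so û can only be u composed with the
inverse. Continuity of the inverse shows that this is an ultradistribution. -/
lemma existsUnique_fourierTransform {t s : ℝ} (ht : 0 < t) (hs : 0 < s) (hst : 1 < s + t)
    (u : GSDual d t s) : ∃! v : GSDual d s t, IsFourierTransform u v := by
  obtain ⟨h, C, hh, hC, H⟩ := u.exists_bound
  obtain ⟨h', K, hh', hK, H'⟩ := GSBound.fourierInvGS (d := d) ht hs hst hh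
  obtain ⟨v, hv⟩ : ∃ v : GSDual d s t, ∀ g, v.pair g = u.pair (fourierInvGS ht hs hst g) := by
    refine GSDual.exists_pair_eq (u.1.comp (fourierInvGS ht hs hst))
      ⟨h', C * K, hh', by positivity, fun g B hB hg => ?_⟩
    rw [LinearMap.comp_apply, mul_assoc]
    exact H _ _ (by positivity) (H' g B hB hg)
  refine ⟨v, fun φ => ⟨fourierFun_mem ht hs hst φ.2, ?_⟩, fun w hw => GSDual.ext_pair fun g => ?_⟩
  · rw [hv, fourierInvGS_fourierFun]
  · obtain ⟨h1, h2⟩ := hw (fourierInvGS ht hs hst g)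
    rw [hv, ← h2]
    congr 1
    exact Subtype.ext (fourierFun_fourierInvGS ht hs hst g).symm

lemma GSDual.pair_smul {t s : ℝ} (u : GSDual d t s) (c : ℂ) (f : GSSpace d t s) :
    u.pair (c • f) = (starRingEnd ℂ) c * u.pair f := by
  simp [GSDual.pair]

/-- The transform of M_ξ T_x ψ is e^{i⟨x,ξ⟩} M_{-x} T_ξ ψ̂; the phase disappears in the modulus. -/
lemma IsFourierTransform.norm_pair_tfs {t s : ℝ} (ht : 0 < t) (hs : 0 < s) {u : GSDual d t s}
    {v : GSDual d s t} (huv : IsFourierTransform u v) (ψ : GSSpace d t s)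
    (h : fourierFun (ψ : E d → ℂ) ∈ GSSpace d s t) (z : E d × E d) :
    ‖v.pair (tfsGS hs ht (symplecticJ z) ⟨fourierFun (ψ : E d → ℂ), h⟩)‖ =
      ‖u.pair (tfsGS ht hs z ψ)‖ := by
  obtain ⟨h1, h2⟩ := huv (tfsGS ht hs z ψ)
  rw [← h2]
  have e : (⟨_, h1⟩ : GSSpace d s t) = Complex.exp (Complex.I * (inner ℝ z.1 z.2 : ℝ)) •
      tfsGS hs ht (symplecticJ z) ⟨fourierFun (ψ : E d → ℂ), h⟩ := by
    ext η
    change fourierFun (timeFreqShift z.1 z.2 ψ.1) η =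
      Complex.exp (Complex.I * (inner ℝ z.1 z.2 : ℝ)) *
        (Complex.exp (Complex.I * (inner ℝ η (-z.1) : ℝ)) * fourierFun ψ.1 (η - z.2))
    rw [fourierFun_timeFreqShift, ← mul_assoc, ← Complex.exp_add, inner_sub_right, inner_neg_right,
      real_inner_comm η z.1]
    congr 2
    push_cast
    ring
  rw [e, GSDual.pair_smul, norm_mul, RCLike.norm_conj, mul_comm Complex.I,
    Complex.norm_exp_ofReal_mul_I, one_mul]

lemma waveFrontSet_fourier {t s : ℝ} (ht : 0 < t) (hs : 0 < s) (hst : 1 < s + t) {u : GSDual d t s}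
    {v : GSDual d s t} (huv : IsFourierTransform u v) {ψ : GSSpace d t s} (hψ : ψ ≠ 0)
    {φ : GSSpace d s t} (hφ : φ ≠ 0) :
    waveFrontSet hs ht φ v = symplecticJ '' waveFrontSet ht hs ψ u := by
  have hm := fourierFun_mem ht hs hst ψ.2
  have h0 : (⟨fourierFun (ψ : E d → ℂ), hm⟩ : GSSpace d s t) ≠ 0 := by
    intro h
    have h1 := fourierInvGS_fourierFun ht hs hst ψ hm
    rw [h, map_zero] at h1
    exact hψ h1.symm
  -- The window φ is replaced by ψ̂, for which the moduli agree exactly.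
  rw [waveFrontSet_eq hs ht (by rwa [add_comm]) v h0 hφ]
  refine waveFrontSet_eq_image (Θ' := fun z => (-z.2, z.1)) ht hs hs ht
    (continuous_snd.prodMk continuous_fst.neg) (continuous_snd.neg.prodMk continuous_fst)
    (fun p => ?_) (fun p => ?_) ?_ one_pos fun l hl p => ?_
  · simp [symplecticJ]
  · simp [symplecticJ]
  · simp [symplecticJ]
  · have e : dil s t l (symplecticJ p) = symplecticJ (dil t s l p) := by
      simp [dil, symplecticJ]
    rw [e, huv.norm_pair_tfs ht hs ψ hm, one_mul]

/-! ### Linear changes of variables of ultradistributions -/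

/-- The action of a matrix as a continuous linear map. -/
def matL (A : Matrix (Fin d) (Fin d) ℝ) : E d →L[ℝ] E d :=
  LinearMap.toContinuousLinearMap
    { toFun := matAct A
      map_add' := fun x y => by
        ext i; simp [matAct, Matrix.mulVec_add]
      map_smul' := fun c x => by
        ext i; simp [matAct, Matrix.mulVec_smul] }

lemma matAct_matAct (A B : Matrix (Fin d) (Fin d) ℝ) (x : E d) :
    matAct A (matAct B x) = matAct (A * B) x := by
  simp [matAct, Matrix.mulVec_mulVec]

lemma matAct_one (x : E d) : matAct 1 x = x := by
  simp [matAct]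

lemma inner_matAct (A : Matrix (Fin d) (Fin d) ℝ) (x y : E d) :
    (inner ℝ (matAct A x) y : ℝ) = inner ℝ x (matAct A.transpose y) := by
  simp only [matAct, EuclideanSpace.inner_eq_star_dotProduct, star_trivial]
  rw [Matrix.mulVec_transpose, Matrix.dotProduct_mulVec]

section Dilation

variable (A : Matrix.GeneralLinearGroup (Fin d) ℝ)

lemma matAct_inv_left (x : E d) : matAct (A⁻¹).1 (matAct A.1 x) = x := by
  rw [matAct_matAct, ← Units.val_mul, inv_mul_cancel, Units.val_one, matAct_one]

lemma matAct_inv_right (x : E d) : matAct A.1 (matAct (A⁻¹).1 x) = x := by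
  rw [matAct_matAct, ← Units.val_mul, mul_inv_cancel, Units.val_one, matAct_one]

lemma matAct_transpose_inv_left (x : E d) :
    matAct (A⁻¹).1.transpose (matAct A.1.transpose x) = x := by
  rw [matAct_matAct, ← Matrix.transpose_mul, ← Units.val_mul, mul_inv_cancel, Units.val_one,
    Matrix.transpose_one, matAct_one]

lemma matAct_transpose_inv_right (x : E d) :
    matAct A.1.transpose (matAct (A⁻¹).1.transpose x) = x := by
  rw [matAct_matAct, ← Matrix.transpose_mul, ← Units.val_mul, inv_mul_cancel, Units.val_one,
    Matrix.transpose_one, matAct_one]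

lemma comp_matAct_inv_mem {t s : ℝ} (ht : 0 < t) (hs : 0 < s) {f : E d → ℂ}
    (hf : f ∈ GSSpace d t s) : (fun x => f (matAct (A⁻¹).1 x)) ∈ GSSpace d t s :=
  compLin_mem ht hs (matL (A⁻¹).1) (matL A.1) (matAct_inv_right A) hf

/-- The change of variables `f ↦ f(A⁻¹ ·)` on `Σ_t^s`. -/
def compInvGS {t s : ℝ} (ht : 0 < t) (hs : 0 < s) : GSSpace d t s →ₗ[ℂ] GSSpace d t s where
  toFun f := ⟨fun x => (f : E d → ℂ) (matAct (A⁻¹).1 x), comp_matAct_inv_mem A ht hs f.2⟩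
  map_add' _ _ := rfl
  map_smul' _ _ := rfl

lemma existsUnique_dilation {t s : ℝ} (ht : 0 < t) (hs : 0 < s) (c : ℂ) (u : GSDual d t s) :
    ∃! v : GSDual d t s, IsDilation c A u v := by
  obtain ⟨h, C, hh, hC, H⟩ := u.exists_bound
  obtain ⟨h', hh', H'⟩ := GSBound.compLin ht hs (matL (A⁻¹).1) (matL A.1) (matAct_inv_right A) hh
  set k : ℂ := c * ((|A.1.det|⁻¹ : ℝ) : ℂ) with hk
  let v : GSDual d t s := GSDual.ofBound (k • u.1.comp (compInvGS A ht hs))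
    ⟨h', ‖k‖ * C, hh', by positivity, fun g B hB hg => by
      change ‖k * u.pair (compInvGS A ht hs g)‖ ≤ _
      rw [norm_mul, mul_assoc]
      gcongr
      exact H _ _ hB (H' (toSm g) B hB hg)⟩
  refine ⟨v, fun φ => ⟨comp_matAct_inv_mem A ht hs φ.2, rfl⟩, fun w hw => GSDual.ext_pair fun g => ?_⟩
  obtain ⟨_, h2⟩ := hw g
  exact h2

/-- Since ⟨A⁻¹y, Aᵀξ⟩ = ⟨y, ξ⟩ and A⁻¹y - A⁻¹x = A⁻¹(y - x), composing the shift of φ at (A⁻¹x, Aᵀξ)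
with A⁻¹ gives the shift of φ(A⁻¹ ·) at (x, ξ), without any phase. -/
lemma IsDilation.norm_pair_tfs {t s : ℝ} (ht : 0 < t) (hs : 0 < s) {c : ℂ} {u v : GSDual d t s}
    (huv : IsDilation c A u v) (φ : GSSpace d t s) (z : E d × E d) :
    ‖v.pair (tfsGS ht hs (symplecticDiag A z) φ)‖ =
      ‖c‖ * |A.1.det|⁻¹ * ‖u.pair (tfsGS ht hs z (compInvGS A ht hs φ))‖ := by
  obtain ⟨h1, h2⟩ := huv (tfsGS ht hs (symplecticDiag A z) φ)
  rw [h2, norm_mul, norm_mul, Complex.norm_real, Real.norm_of_nonneg (by positivity)]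
  congr 3
  ext y
  change Complex.exp (Complex.I * (inner ℝ (matAct (A⁻¹).1 y) (matAct A.1.transpose z.2) : ℝ)) *
      φ.1 (matAct (A⁻¹).1 y - matAct (A⁻¹).1 z.1) =
    Complex.exp (Complex.I * (inner ℝ y z.2 : ℝ)) * φ.1 (matAct (A⁻¹).1 (y - z.1))
  rw [inner_matAct, matAct_transpose_inv_left]
  have : matAct (A⁻¹).1 (y - z.1) = matAct (A⁻¹).1 y - matAct (A⁻¹).1 z.1 :=
    map_sub (matL (A⁻¹).1) y z.1
  rw [this]

lemma waveFrontSet_dilation {t s : ℝ} (ht : 0 < t) (hs : 0 < s) (hst : 1 < s + t) {c : ℂ} (hc : c ≠ 0)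
    {u v : GSDual d t s} (huv : IsDilation c A u v) {ψ φ : GSSpace d t s} (hψ : ψ ≠ 0) (hφ : φ ≠ 0) :
    waveFrontSet ht hs φ v = symplecticDiag A '' waveFrontSet ht hs ψ u := by
  have h0 : compInvGS A ht hs φ ≠ 0 := by
    intro h
    refine hφ ?_
    ext x
    have h1 := congrFun (congrArg Subtype.val h) (matAct A.1 x)
    change φ.1 (matAct (A⁻¹).1 (matAct A.1 x)) = 0 at h1
    rw [matAct_inv_left] at h1
    exact h1
  have hdet : A.1.det ≠ 0 := ((Matrix.isUnit_iff_isUnit_det _).1 A.isUnit).ne_zero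
  -- Here the window is changed on the side of u, from ψ to φ(A⁻¹ ·).
  rw [← waveFrontSet_eq ht hs hst u hψ h0]
  have hc1 : ∀ M N : E d →L[ℝ] E d, Continuous fun z : E d × E d => (M z.1, N z.2) := fun M N =>
    (M.continuous.comp continuous_fst).prodMk (N.continuous.comp continuous_snd)
  refine waveFrontSet_eq_image (Θ' := fun z => (matAct A.1 z.1, matAct (A⁻¹).1.transpose z.2))
    ht hs ht hs (hc1 (matL (A⁻¹).1) (matL A.1.transpose)) (hc1 (matL A.1) (matL (A⁻¹).1.transpose))
    (fun p => ?_) (fun p => ?_) ?_ (k := ‖c‖ * |A.1.det|⁻¹) ?_ fun l hl p => ?_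
  · exact Prod.ext (matAct_inv_left A p.1) (matAct_transpose_inv_right A p.2)
  · exact Prod.ext (matAct_inv_right A p.1) (matAct_transpose_inv_left A p.2)
  · exact Prod.ext (map_zero (matL (A⁻¹).1)) (map_zero (matL A.1.transpose))
  · have := norm_pos_iff.2 hc
    have := abs_pos.2 hdet
    positivity
  · have e : dil t s l (symplecticDiag A p) = symplecticDiag A (dil t s l p) :=
      Prod.ext (map_smul (matL (A⁻¹).1) _ _).symm (map_smul (matL A.1.transpose) _ _).symm
    rw [e, huv.norm_pair_tfs A ht hs]

end Dilation

end GelfandShilov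

end

open GelfandShilov

theorem proposition3p6 {d : ℕ} {t s : ℝ} (ht : 0 < t) (hs : 0 < s) (hst : 1 < s + t)
    (u : GSDual d t s) :
    ((∃! v : GSDual d s t, IsFourierTransform u v) ∧
      ∀ v : GSDual d s t, IsFourierTransform u v →
        ∀ ψ : GSSpace d t s, ψ ≠ 0 → ∀ φ : GSSpace d s t, φ ≠ 0 →
          waveFrontSet hs ht φ v = symplecticJ '' waveFrontSet ht hs ψ u) ∧
    ∀ (A : Matrix.GeneralLinearGroup (Fin d) ℝ) (c : ℂ), ‖c‖ = |A.1.det| ^ (1 / 2 : ℝ) →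
      (∃! v : GSDual d t s, IsDilation c A u v) ∧
      ∀ v : GSDual d t s, IsDilation c A u v →
        ∀ ψ : GSSpace d t s, ψ ≠ 0 → ∀ φ : GSSpace d t s, φ ≠ 0 →
          waveFrontSet ht hs φ v = symplecticDiag A '' waveFrontSet ht hs ψ u := by
  refine ⟨⟨existsUnique_fourierTransform ht hs hst u, fun v huv ψ hψ φ hφ =>
    waveFrontSet_fourier ht hs hst huv hψ hφ⟩, fun A c hc =>
    ⟨existsUnique_dilation A ht hs c u, fun v huv ψ hψ φ hφ =>
      waveFrontSet_dilation A ht hs hst ?_ huv hψ hφ⟩⟩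
  have hdet : A.1.det ≠ 0 := ((Matrix.isUnit_iff_isUnit_det _).1 A.isUnit).ne_zero
  have h1 := Real.rpow_pos_of_pos (abs_pos.2 hdet) (1 / 2)
  rw [← hc] at h1
  exact norm_pos_iff.1 h1
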